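/- Let $d\ge 3$. For $t>0$ let $A_tf(x)$ denote the average of $f$ over the sphere of radius $t$ centered at $x\in\mathbb R^d$. Let $E\subset[1,2]$ be nonempty and $M_Ef(x)=\sup_{t\in E}|A_tf(x)|$. Let $L^p_{\rm rad}$ be the space of radial functions $f(x)=f_0(|x|)$ in $L^p(\mathbb R^d)$, and let the radial type set of $M_E$ be $$\mathcal T_E^{\rm rad}=\{(\tfrac1p,\tfrac1q)\in[0,1]^2:\ M_E \text{ is bounded } L^p_{\rm rad}\to L^q(\mathbb R^d)\}$$ (with $p=\infty$ if $\frac1p=0$, and likewise for $q$). Let $N(E,\delta)$ be the minimal number of intervals of length $\delta$ needed to cover $E$, let $$\beta=\limsup_{\delta\to0+}\frac{\log N(E,\delta)}{\log\frac1\delta}$$ be the upper Minkowski dimension of $E$, and let $\Delta_\beta$ be the closed triangle with vertices $$P_1=(0,0),\qquad P_{2,\beta}=\Big(\tfrac{d-1}{d-1+\beta},\tfrac{d-1}{d-1+\beta}\Big),\qquad P_{3,\beta}^{\rm rad}=\Big(\tfrac{d(d-1)}{d^2-1+\beta},\tfrac{d-1}{d^2-1+\beta}\Big).$$ Then $\overline{\mathcal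 T_E^{\rm rad}}=\Delta_\beta$. More precisely: (i) If $\beta<1$ and $\sup_{0<\delta<1}\delta^\beta N(E,\delta)<\infty$, then $\mathcal T_E^{\rm rad}=\Delta_\beta$. (ii) If $\beta<1$ and $\sup_{0<\delta<1}\delta^\beta N(E,\delta)=\infty$, then $\mathcal T_E^{\rm rad}=\Delta_\beta\setminus[P_{2,\beta},P_{3,\beta}^{\rm rad}]$, where $[P_{2,\beta},P_{3,\beta}^{\rm rad}]$ is the closed edge. (iii) If $\beta=1$, then $$\mathcal T_E^{\rm rad}=\Big\{(\tfrac1p,\tfrac1q)\in\Delta_1:\ \tfrac1p<\tfrac{d-1}d\ \text{ or }\ \sup_{0<\delta<1/2}\delta\,(\log\tfrac1\delta)^{q/d}N(E,\delta)<\infty\Big\}.$$ -/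

import Mathlib

open MeasureTheory Set Filter Topology
open scoped ENNReal NNReal

namespace RadialSpherical

/-- The spherical average `A_t f(x)`: the mean of `f` over the sphere of radius `t` centred
at `x`, with respect to surface measure (`⨍` divides by the total mass). -/
noncomputable def sphericalAvg {d : ℕ} (t : ℝ) (f : EuclideanSpace ℝ (Fin d) → ℂ)
    (x : EuclideanSpace ℝ (Fin d)) : ℂ :=
  ⨍ y : Metric.sphere (0 : EuclideanSpace ℝ (Fin d)) 1,
    f (x - t • (y : EuclideanSpace ℝ (Fin d)))
      ∂((volume : Measure (EuclideanSpace ℝ (Fin d))).toSphere)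

/-- `f` is integrable over the sphere of radius `t` centred at `x`, so that `A_t f(x)` is a
genuine integral. -/
def SphereIntegrable {d : ℕ} (t : ℝ) (f : EuclideanSpace ℝ (Fin d) → ℂ)
    (x : EuclideanSpace ℝ (Fin d)) : Prop :=
  Integrable (fun y : Metric.sphere (0 : EuclideanSpace ℝ (Fin d)) 1 =>
    f (x - t • (y : EuclideanSpace ℝ (Fin d))))
      ((volume : Measure (EuclideanSpace ℝ (Fin d))).toSphere)

/-- The spherical maximal function `M_E f(x) = sup_{t ∈ E} |A_t f(x)|`, with values in
`[0, ∞]`. -/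
noncomputable def sphericalMax {d : ℕ} (E : Set ℝ) (f : EuclideanSpace ℝ (Fin d) → ℂ)
    (x : EuclideanSpace ℝ (Fin d)) : ℝ≥0∞ :=
  ⨆ t ∈ E, ‖sphericalAvg t f x‖ₑ

/-- Radial functions: `f(x) = f₀(|x|)`. -/
def IsRadial {d : ℕ} (f : EuclideanSpace ℝ (Fin d) → ℂ) : Prop :=
  ∃ f₀ : ℝ → ℂ, ∀ x, f x = f₀ ‖x‖

/-- `M_E` is bounded from `L^p_rad(ℝ^d)` to `L^q(ℝ^d)`: for every radial `f ∈ L^p` the function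
`M_E f` is well defined almost everywhere and lies in `L^q`, with
`‖M_E f‖_q ≤ C ‖f‖_p` and `C` independent of `f`.
For `d ≥ 2`, two radial functions that agree almost everywhere have the same spherical averages
about every `x ≠ 0`, so this is a condition on classes modulo null sets. -/
def BoundedRadial (d : ℕ) (E : Set ℝ) (p q : ℝ≥0∞) : Prop :=
  ∃ C : ℝ≥0, ∀ f : EuclideanSpace ℝ (Fin d) → ℂ, IsRadial f → MemLp f p volume →
    (∀ᵐ x : EuclideanSpace ℝ (Fin d), ∀ t ∈ E, SphereIntegrable t f x) ∧
    MemLp (sphericalMax E f) q volume ∧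
    eLpNorm (sphericalMax E f) q volume ≤ (C : ℝ≥0∞) * eLpNorm f p volume

/-- The radial type set of `M_E`: the pairs `(1/p, 1/q) ∈ [0,1]²` such that
`M_E : L^p_rad → L^q` is bounded. The inverse is taken in `[0, ∞]`, so that `1/p = 0` means
`p = ∞`. -/
def radialTypeSet (d : ℕ) (E : Set ℝ) : Set (ℝ × ℝ) :=
  {z | z.1 ∈ Icc (0 : ℝ) 1 ∧ z.2 ∈ Icc (0 : ℝ) 1 ∧
    BoundedRadial d E (ENNReal.ofReal z.1)⁻¹ (ENNReal.ofReal z.2)⁻¹}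

/-- `N(E, δ)`: the minimal number of (closed) intervals of length `δ` needed to cover `E`.
For bounded `E` and `δ > 0` the set of admissible `n` is nonempty. -/
noncomputable def coverNum (E : Set ℝ) (δ : ℝ) : ℕ :=
  sInf {n : ℕ | ∃ a : Fin n → ℝ, E ⊆ ⋃ i, Icc (a i) (a i + δ)}

/-- The upper Minkowski dimension `limsup_{δ → 0+} log N(E, δ) / log (1/δ)`. -/
noncomputable def upperMinkowskiDim (E : Set ℝ) : ℝ :=
  limsup (fun δ : ℝ => Real.log (coverNum E δ) / Real.log (1 / δ)) (𝓝[>] 0)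

/-- The vertex `P_{2,β}`. -/
noncomputable def vertexTwo (d : ℕ) (β : ℝ) : ℝ × ℝ :=
  (((d : ℝ) - 1) / ((d : ℝ) - 1 + β), ((d : ℝ) - 1) / ((d : ℝ) - 1 + β))

/-- The vertex `P_{3,β}^rad`. -/
noncomputable def vertexThree (d : ℕ) (β : ℝ) : ℝ × ℝ :=
  ((d : ℝ) * ((d : ℝ) - 1) / ((d : ℝ) ^ 2 - 1 + β), ((d : ℝ) - 1) / ((d : ℝ) ^ 2 - 1 + β))

/-- The closed triangle `Δ_β` with vertices `P_1 = (0,0)`, `P_{2,β}` and `P_{3,β}^rad`. -/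
noncomputable def triangle (d : ℕ) (β : ℝ) : Set (ℝ × ℝ) :=
  convexHull ℝ {((0 : ℝ), (0 : ℝ)), vertexTwo d β, vertexThree d β}

end RadialSpherical

/-! For radial f the average A_t f(x) depends only on t and r = |x|. If y is uniform on the unit
sphere, the law of cosines gives |x - t y| the explicit density `kern d r t`
(`map_norm_sub_smul_sphereProb`), so M_E becomes a maximal function on the half-line whose kernels
live on |r - t| < s < r + t. As t lies in [1, 2], there are three ranges of r. For r ≤ 1/2 the
kernel is O(1/r) on a window of radius r about t, and the estimate holds for p ≤ q ≤ dp except at p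
= 1, q = d. For r ≥ 4 the kernel is bounded and local, and p ≤ q suffices. For 1/2 ≤ r ≤ 4 the
kernel is O(s^(d-2)), and the supremum over t only replaces |r - t| by dist(r, E). What remains is
the Hardy operator that integrates s^(d-2) G(s) over dist(r, E) < s < 6. The set E enters the upper
bounds only here, through the measure of {dist(r, E) < ρ}, which is controlled by ρ N(E, ρ).

To bound the Hardy operator let γ = p' = p/(p-1), dν = s^(d-1-γ) ds and ψ = s^(γ-1) G. The operator
then integrates ψ against ν over (dist(r, E), 6), and the L^p norm of ψ in ν is at most that of G
with weight s^(d-1). Boundedness into L^q follows if the set where ν(dist(r, E), 6) exceeds y has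
measure O(y^(-q/p')) (`lintegral_rpow_le_of_truncation`). Three cases arise. If p > d/(d-1), ν is
finite and Hölder's inequality suffices for every E. If p = d/(d-1), ν(ρ, 6) = log(6/ρ), and the
condition reads |{dist(r, E) < ρ}| = O(log(1/ρ)^(-q/d)). If 1 < p < d/(d-1), it reads |{dist(r, E) <
ρ}| = O(ρ^κ) with κ = q(d/p - (d-1)); for N(E, ρ) = O(ρ^(-b)) this is the line (1-b)/q = d/p -
(d-1), which for b = β carries the edge [P_2, P_3]. The point p = q = 1 is settled by Fubini.

Necessity comes from one test for each side of the triangle. Large balls give p ≤ q, thin shells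
give q ≤ dp, and functions concentrated at |x| ~ δ, whose maximal function is at least of order
δ^(d-1) on a set of measure at least of order δ N(E, δ), give the third side. When p = d/(d-1) the
truncated power |x|^(1-d) gains the logarithm of case (iii). -/

namespace RadialSpherical

/-! ### Polar and cylindrical coordinates; the law of one coordinate on the sphere -/

/-- Integration in polar coordinates, for nonnegative functions. -/
lemma lintegral_eq_lintegral_sphere {E : Type*} [NormedAddCommGroup E] [NormedSpace ℝ E]
    [FiniteDimensional ℝ E] [Nontrivial E] [MeasurableSpace E] [BorelSpace E]
    (μ : Measure E) [μ.IsAddHaarMeasure] {F : E → ℝ≥0∞} (hF : Measurable F) :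
    ∫⁻ x, F x ∂μ = ∫⁻ y : Metric.sphere (0 : E) 1, (∫⁻ r in Ioi (0 : ℝ),
      ENNReal.ofReal (r ^ (Module.finrank ℝ E - 1)) * F (r • (y : E))) ∂μ.toSphere := by
  have h1 : ∫⁻ x, F x ∂μ = ∫⁻ x : ({(0)}ᶜ : Set E), F x ∂(μ.comap (↑)) := by
    rw [lintegral_subtype_comap (measurableSet_singleton _).compl, restrict_compl_singleton]
  have h2 := μ.measurePreserving_homeomorphUnitSphereProd.lintegral_comp_emb
    (Homeomorph.measurableEmbedding _)
    (fun p => F ((p.2 : ℝ) • (p.1 : E)))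
  have h3 : ∀ x : ({(0)}ᶜ : Set E), ((homeomorphUnitSphereProd E x).2 : ℝ) •
      ((homeomorphUnitSphereProd E x).1 : E) = x := by
    intro x
    have hx : ‖(x : E)‖ ≠ 0 := norm_ne_zero_iff.2 x.2
    simp [homeomorphUnitSphereProd_apply_fst_coe, smul_smul, hx]
  simp only [h3] at h2
  rw [h1, h2, lintegral_prod _ (by fun_prop)]
  refine lintegral_congr fun y => ?_
  rw [Measure.volumeIoiPow, lintegral_withDensity_eq_lintegral_mul _ (by fun_prop) (by fun_prop)]
  simp only [Pi.mul_apply]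
  rw [lintegral_subtype_comap measurableSet_Ioi
    (fun r : ℝ => ENNReal.ofReal (r ^ (Module.finrank ℝ E - 1)) * F (r • (y : E)))]

lemma lintegral_fun_norm {E : Type*} [NormedAddCommGroup E] [NormedSpace ℝ E]
    [FiniteDimensional ℝ E] [Nontrivial E] [MeasurableSpace E] [BorelSpace E]
    (μ : Measure E) [μ.IsAddHaarMeasure] {h : ℝ → ℝ≥0∞} (hh : Measurable h) :
    ∫⁻ x, h ‖x‖ ∂μ = μ.toSphere univ * ∫⁻ r in Ioi (0 : ℝ),
      ENNReal.ofReal (r ^ (Module.finrank ℝ E - 1)) * h r := by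
  rw [lintegral_eq_lintegral_sphere μ (by fun_prop)]
  have : ∀ y : Metric.sphere (0 : E) 1, ∫⁻ r in Ioi (0 : ℝ),
      ENNReal.ofReal (r ^ (Module.finrank ℝ E - 1)) * h ‖r • (y : E)‖ = ∫⁻ r in Ioi (0 : ℝ),
      ENNReal.ofReal (r ^ (Module.finrank ℝ E - 1)) * h r := by
    intro y
    refine setLIntegral_congr_fun measurableSet_Ioi fun r hr => ?_
    simp [norm_smul, abs_of_pos (mem_Ioi.1 hr)]
  simp_rw [this]
  rw [lintegral_const, mul_comm]

/-- Cylindrical coordinates around the axis spanned by a unit vector. -/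
lemma lintegral_inner_norm {E : Type*} [NormedAddCommGroup E] [InnerProductSpace ℝ E]
    [FiniteDimensional ℝ E] [MeasurableSpace E] [BorelSpace E] {d : ℕ} (hd : 2 ≤ d)
    (hE : Module.finrank ℝ E = d) {e : E} (he : ‖e‖ = 1) :
    ∃ c : ℝ≥0∞, ∀ H : ℝ × ℝ → ℝ≥0∞, Measurable H → ∫⁻ x : E, H (inner ℝ e x, ‖x‖) =
      c * ∫⁻ a : ℝ, ∫⁻ ρ in Ioi (0 : ℝ), ENNReal.ofReal (ρ ^ (d - 2)) * H (a, √(a ^ 2 + ρ ^ 2)) := by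
  let K : Submodule ℝ E := Submodule.span ℝ {e}
  have he0 : e ≠ 0 := by rintro rfl; simp at he
  have hK : Module.finrank ℝ Kᗮ = d - 1 := by
    have h1 := K.finrank_add_finrank_orthogonal
    have h2 : Module.finrank ℝ K = 1 := finrank_span_singleton he0
    omega
  have : Nontrivial Kᗮ := Module.nontrivial_of_finrank_pos (R := ℝ) (by omega)
  let u : ℝ ≃ₗᵢ[ℝ] K := LinearIsometryEquiv.toSpanUnitSingleton e he
  have hu : ∀ a, ((u a : K) : E) = a • e := fun a => rfl
  have mp1 : MeasurePreserving (fun p : ℝ × Kᗮ => (u p.1, p.2)) :=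
    u.measurePreserving.prod (MeasurePreserving.id _)
  have mp2 := (WithLp.volume_preserving_toLp K Kᗮ).comp mp1
  have mp3 := K.orthogonalDecomposition.symm.measurePreserving.comp mp2
  have key : ∀ p : ℝ × Kᗮ, (K.orthogonalDecomposition.symm (WithLp.toLp 2 (u p.1, p.2)) : E)
      = p.1 • e + p.2 := by
    intro p
    rw [Submodule.orthogonalDecomposition_symm_apply]
    simp [hu]
  -- The constant is the area of the unit sphere of e^⊥. Its value is never used: it is absorbed
  -- when the law on the sphere is normalised.
  refine ⟨(volume : Measure Kᗮ).toSphere univ, fun H hH => ?_⟩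
  have hmF : Measurable (fun x : E => H (inner ℝ e x, ‖x‖)) := by fun_prop
  rw [← mp3.lintegral_comp hmF]
  have h5 : ∀ p : ℝ × Kᗮ, (K.orthogonalDecomposition.symm ∘ (WithLp.toLp 2 ∘
      fun p : ℝ × Kᗮ => (u p.1, p.2))) p = p.1 • e + (p.2 : E) := key
  have h6 : ∀ p : ℝ × Kᗮ, inner ℝ e (p.1 • e + (p.2 : E)) = p.1 := by
    intro p
    have : inner ℝ e (p.2 : E) = 0 := p.2.2 e (Submodule.mem_span_singleton_self e)
    rw [inner_add_right, this, inner_smul_right, real_inner_self_eq_norm_sq, he]; simp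
  have h7 : ∀ p : ℝ × Kᗮ, ‖p.1 • e + (p.2 : E)‖ = √(p.1 ^ 2 + ‖p.2‖ ^ 2) := by
    intro p
    have h8 : inner ℝ (p.1 • e) (p.2 : E) = 0 := by
      rw [inner_smul_left, p.2.2 e (Submodule.mem_span_singleton_self e)]; simp
    rw [← Real.sqrt_sq (norm_nonneg (p.1 • e + (p.2 : E))), sq,
      norm_add_sq_eq_norm_sq_add_norm_sq_of_inner_eq_zero _ _ h8, norm_smul, he]
    simp [← sq]
  simp_rw [h5, h6, h7]
  rw [Measure.volume_eq_prod, lintegral_prod _ (by fun_prop)]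
  rw [← lintegral_const_mul' _ _ (measure_ne_top _ _)]
  refine lintegral_congr fun a => ?_
  rw [lintegral_fun_norm (volume : Measure Kᗮ) (h := fun ρ => H (a, √(a ^ 2 + ρ ^ 2)))
    (by fun_prop), hK]
  rfl


/-- The distribution of the coordinate `⟪e, y⟫` on the unit sphere. -/
lemma lintegral_sphere_inner {E : Type*} [NormedAddCommGroup E] [InnerProductSpace ℝ E]
    [FiniteDimensional ℝ E] [MeasurableSpace E] [BorelSpace E] {d : ℕ} (hd : 2 ≤ d)
    (hE : Module.finrank ℝ E = d) {e : E} (he : ‖e‖ = 1) :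
    ∃ c : ℝ≥0∞, ∀ h : ℝ → ℝ≥0∞, Measurable h →
      ∫⁻ y : Metric.sphere (0 : E) 1, h (inner ℝ e (y : E)) ∂(volume : Measure E).toSphere =
      c * ∫⁻ θ in Ioo 0 Real.pi, ENNReal.ofReal (Real.sin θ ^ (d - 2)) * h (Real.cos θ) := by
  have : Nontrivial E := Module.nontrivial_of_finrank_pos (R := ℝ) (by omega)
  obtain ⟨c, hc⟩ := lintegral_inner_norm hd hE he
  refine ⟨c, fun h hh => ?_⟩
  set J : ℝ≥0∞ := ∫⁻ r in Ioi (0 : ℝ), ENNReal.ofReal (r ^ (d - 1)) * (Iio (1 : ℝ)).indicator 1 r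
    with hJ
  have hJ' : J = ENNReal.ofReal (1 / d) := by
    have h1 : J = ∫⁻ r in Ioo (0 : ℝ) 1, ENNReal.ofReal (r ^ (d - 1)) := by
      rw [hJ, ← Ioi_inter_Iio, inter_comm, ← setLIntegral_indicator measurableSet_Iio]
      refine lintegral_congr fun r => ?_
      by_cases hr : r ∈ Iio (1 : ℝ) <;> simp [hr]
    rw [h1, setLIntegral_congr Ioo_ae_eq_Ioc, ← ofReal_integral_eq_lintegral_ofReal
      (intervalIntegral.intervalIntegrable_pow (a := 0) (b := 1) (d - 1)).1,
      ← intervalIntegral.integral_of_le zero_le_one, integral_pow]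
    · have : ((d - 1 : ℕ) : ℝ) + 1 = d := by
        rw [Nat.cast_sub (by omega)]; simp
      simp [this]
    · filter_upwards [ae_restrict_mem measurableSet_Ioc] with y hy
      exact pow_nonneg hy.1.le _
  have hJ0 : J ≠ 0 := by
    rw [hJ']; simp; omega
  have hJt : J ≠ ∞ := by rw [hJ']; simp
  -- The function h(⟨e, x⟩/|x|) on the unit ball is integrated in two ways: in polar coordinates of
  -- the whole space, and in cylindrical coordinates followed by polar coordinates of the
  -- half-plane. Both produce the same finite nonzero radial factor J, which cancels.
  let H : ℝ × ℝ → ℝ≥0∞ := fun p => h (p.1 / p.2) * (Iio (1 : ℝ)).indicator 1 p.2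
  have hH : Measurable H := by
    have : Measurable ((Iio (1 : ℝ)).indicator (1 : ℝ → ℝ≥0∞)) :=
      measurable_one.indicator measurableSet_Iio
    fun_prop
  have key := hc H hH
  have hL : ∫⁻ x : E, H (inner ℝ e x, ‖x‖) =
      J * ∫⁻ y : Metric.sphere (0 : E) 1, h (inner ℝ e (y : E)) ∂(volume : Measure E).toSphere := by
    rw [lintegral_eq_lintegral_sphere volume (by fun_prop), ← lintegral_const_mul' _ _ hJt]
    refine lintegral_congr fun y => ?_
    rw [hJ, ← lintegral_mul_const _ (by
      have : Measurable ((Iio (1 : ℝ)).indicator (1 : ℝ → ℝ≥0∞)) :=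
        measurable_one.indicator measurableSet_Iio
      fun_prop)]
    refine setLIntegral_congr_fun measurableSet_Ioi fun r hr => ?_
    have hr' : (0 : ℝ) < r := hr
    have h1 : ‖r • (y : E)‖ = r := by simp [norm_smul, abs_of_pos hr']
    simp only [H, h1, inner_smul_right, hE]
    rw [mul_div_cancel_left₀ _ hr'.ne']
    ring
  have hR : ∫⁻ a : ℝ, ∫⁻ ρ in Ioi (0 : ℝ), ENNReal.ofReal (ρ ^ (d - 2)) * H (a, √(a ^ 2 + ρ ^ 2))
      = J * ∫⁻ θ in Ioo 0 Real.pi, ENNReal.ofReal (Real.sin θ ^ (d - 2)) * h (Real.cos θ) := by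
    let G : ℝ × ℝ → ℝ≥0∞ := fun p => (Ioi (0 : ℝ)).indicator 1 p.2 *
      (ENNReal.ofReal (p.2 ^ (d - 2)) * H (p.1, √(p.1 ^ 2 + p.2 ^ 2)))
    have hi : Measurable ((Ioi (0 : ℝ)).indicator (1 : ℝ → ℝ≥0∞)) :=
      measurable_one.indicator measurableSet_Ioi
    have hi' : Measurable ((Iio (1 : ℝ)).indicator (1 : ℝ → ℝ≥0∞)) :=
      measurable_one.indicator measurableSet_Iio
    have hG : Measurable G := by fun_prop
    have h1 : ∫⁻ a : ℝ, ∫⁻ ρ in Ioi (0 : ℝ),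
        ENNReal.ofReal (ρ ^ (d - 2)) * H (a, √(a ^ 2 + ρ ^ 2)) = ∫⁻ p, G p := by
      rw [Measure.volume_eq_prod, lintegral_prod _ hG.aemeasurable]
      refine lintegral_congr fun a => ?_
      rw [← lintegral_indicator measurableSet_Ioi]
      refine lintegral_congr fun ρ => ?_
      by_cases hρ : ρ ∈ Ioi (0 : ℝ) <;> simp [G, hρ]
    rw [h1, ← lintegral_comp_polarCoord_symm, polarCoord_target, Measure.volume_eq_prod,
      ← Measure.prod_restrict, lintegral_prod _ (by
        refine Measurable.aemeasurable ?_
        simp only [smul_eq_mul, polarCoord_symm_apply]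
        fun_prop)]
    have h2 : ∀ R ∈ Ioi (0 : ℝ), ∫⁻ θ in Ioo (-Real.pi) Real.pi,
        ENNReal.ofReal R • G (polarCoord.symm (R, θ)) =
        ENNReal.ofReal (R ^ (d - 1)) * (Iio (1 : ℝ)).indicator 1 R *
          ∫⁻ θ in Ioo 0 Real.pi, ENNReal.ofReal (Real.sin θ ^ (d - 2)) * h (Real.cos θ) := by
      intro R hR
      have hR' : (0 : ℝ) < R := hR
      have hsub : Ioo 0 Real.pi ⊆ Ioo (-Real.pi) Real.pi :=
        Ioo_subset_Ioo_left (by linarith [Real.pi_pos])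
      rw [← lintegral_const_mul _ (by fun_prop), ← lintegral_indicator measurableSet_Ioo,
        ← lintegral_indicator measurableSet_Ioo]
      refine lintegral_congr fun θ => ?_
      by_cases hθ : θ ∈ Ioo 0 Real.pi
      · have hs : 0 < Real.sin θ := Real.sin_pos_of_mem_Ioo hθ
        rw [indicator_of_mem (hsub hθ), indicator_of_mem hθ]
        have h3 : R * Real.sin θ ∈ Ioi (0 : ℝ) := mul_pos hR' hs
        have h4 : (R * Real.cos θ) ^ 2 + (R * Real.sin θ) ^ 2 = R ^ 2 := by
          linear_combination R ^ 2 * Real.sin_sq_add_cos_sq θ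
        simp only [G, H, polarCoord_symm_apply, indicator_of_mem h3, h4, Real.sqrt_sq hR'.le,
          Pi.one_apply, one_mul, smul_eq_mul, mul_div_cancel_left₀ _ hR'.ne']
        rw [mul_pow, ENNReal.ofReal_mul (by positivity)]
        have h5 : R ^ (d - 1) = R * R ^ (d - 2) := by
          rw [← pow_succ']; congr 1; omega
        rw [h5, ENNReal.ofReal_mul hR'.le]
        ring
      · rw [indicator_of_notMem hθ]
        by_cases hθ' : θ ∈ Ioo (-Real.pi) Real.pi
        · rw [indicator_of_mem hθ']
          have h3 : R * Real.sin θ ∉ Ioi (0 : ℝ) := by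
            have : Real.sin θ ≤ 0 := by
              refine Real.sin_nonpos_of_nonpos_of_neg_pi_le ?_ hθ'.1.le
              by_contra hlt
              exact hθ ⟨not_le.1 hlt, hθ'.2⟩
            simp only [mem_Ioi, not_lt]
            exact mul_nonpos_of_nonneg_of_nonpos hR'.le this
          simp [G, polarCoord_symm_apply, h3]
        · rw [indicator_of_notMem hθ']
    rw [setLIntegral_congr_fun measurableSet_Ioi h2, lintegral_mul_const _ (by fun_prop)]
  rw [hL, hR, ← mul_assoc, mul_comm c, mul_assoc] at key
  exact (ENNReal.mul_right_inj hJ0 hJt).1 key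

/-! ### The kernel of the averages on radial functions -/

/-- The density of `s = |x - t y|` when `|x| = r` and `y` is uniformly distributed on the unit
sphere of `ℝ^d`. -/
noncomputable def kern (d : ℕ) (r t s : ℝ) : ℝ :=
  (Ioo |r - t| (r + t)).indicator (fun s => (∫ θ in (0 : ℝ)..Real.pi, Real.sin θ ^ (d - 2))⁻¹ *
    (s / (r * t) * √(1 - ((r ^ 2 + t ^ 2 - s ^ 2) / (2 * r * t)) ^ 2) ^ (d - 3))) s

lemma sinInt_pos (d : ℕ) : 0 < ∫ θ in (0 : ℝ)..Real.pi, Real.sin θ ^ (d - 2) :=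
  integral_sin_pow_pos _

lemma measurable_kern (d : ℕ) (r t : ℝ) : Measurable (kern d r t) := by
  unfold kern
  exact Measurable.indicator (by fun_prop) measurableSet_Ioo

lemma kern_nonneg {d : ℕ} {r t : ℝ} (hr : 0 < r) (ht : 0 < t) (s : ℝ) : 0 ≤ kern d r t s := by
  unfold kern
  refine indicator_nonneg (fun s hs => ?_) s
  have hs0 : 0 < s := lt_of_le_of_lt (abs_nonneg _) hs.1
  have := sinInt_pos d
  positivity

lemma cosineLaw_image {r t : ℝ} (hr : 0 < r) (ht : 0 < t) :
    (fun θ => √(r ^ 2 + t ^ 2 - 2 * r * t * Real.cos θ)) '' Ioo 0 Real.pi = Ioo |r - t| (r + t) := by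
  have hrt : 0 < 2 * r * t := by positivity
  ext s
  simp only [mem_image, mem_Ioo]
  constructor
  · rintro ⟨θ, hθ, rfl⟩
    have h1 : Real.cos θ < 1 := by
      rw [← Real.cos_zero]
      exact Real.cos_lt_cos_of_nonneg_of_le_pi le_rfl hθ.2.le hθ.1
    have h2 : -1 < Real.cos θ := by
      rw [← Real.cos_pi]
      exact Real.cos_lt_cos_of_nonneg_of_le_pi hθ.1.le le_rfl hθ.2
    constructor
    · rw [← Real.sqrt_sq_eq_abs]
      apply Real.sqrt_lt_sqrt (sq_nonneg _)
      nlinarith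
    · rw [Real.sqrt_lt' (by positivity)]
      nlinarith
  · rintro ⟨h1, h2⟩
    have hs0 : 0 < s := lt_of_le_of_lt (abs_nonneg _) h1
    have h3 : (r - t) ^ 2 < s ^ 2 := by
      rw [← sq_abs (r - t)]
      exact pow_lt_pow_left₀ h1 (abs_nonneg _) two_ne_zero
    have h4 : s ^ 2 < (r + t) ^ 2 := pow_lt_pow_left₀ h2 hs0.le two_ne_zero
    have h5 : (r ^ 2 + t ^ 2 - s ^ 2) / (2 * r * t) < 1 := by
      rw [div_lt_one hrt]; nlinarith
    have h6 : -1 < (r ^ 2 + t ^ 2 - s ^ 2) / (2 * r * t) := by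
      rw [lt_div_iff₀ hrt]; nlinarith
    refine ⟨Real.arccos ((r ^ 2 + t ^ 2 - s ^ 2) / (2 * r * t)), ⟨?_, ?_⟩, ?_⟩
    · exact Real.arccos_pos.2 h5
    · exact lt_of_le_of_ne (Real.arccos_le_pi _) (by rw [Ne, Real.arccos_eq_pi]; exact not_le.2 h6)
    · rw [Real.cos_arccos h6.le h5.le, mul_div_cancel₀ _ hrt.ne', sub_sub_cancel,
        Real.sqrt_sq hs0.le]

/-- Substitution of the third side of a triangle for the angle between two sides. -/
lemma lintegral_cosineLaw {d : ℕ} (hd : 3 ≤ d) {r t : ℝ} (hr : 0 < r) (ht : 0 < t)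
    (h : ℝ → ℝ≥0∞) :
    ∫⁻ θ in Ioo 0 Real.pi, ENNReal.ofReal (Real.sin θ ^ (d - 2)) *
        h (√(r ^ 2 + t ^ 2 - 2 * r * t * Real.cos θ)) =
      ENNReal.ofReal (∫ θ in (0 : ℝ)..Real.pi, Real.sin θ ^ (d - 2)) *
        ∫⁻ s, ENNReal.ofReal (kern d r t s) * h s := by
  have hrt : 0 < 2 * r * t := by positivity
  have hpos := sinInt_pos d
  have hQ : ∀ θ ∈ Ioo 0 Real.pi, 0 < r ^ 2 + t ^ 2 - 2 * r * t * Real.cos θ := by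
    intro θ hθ
    have h1 : Real.cos θ < 1 := by
      rw [← Real.cos_zero]
      exact Real.cos_lt_cos_of_nonneg_of_le_pi le_rfl hθ.2.le hθ.1
    nlinarith [sq_nonneg (r - t)]
  have hderiv : ∀ θ ∈ Ioo 0 Real.pi, HasDerivWithinAt
      (fun θ => √(r ^ 2 + t ^ 2 - 2 * r * t * Real.cos θ))
      (2 * r * t * Real.sin θ / (2 * √(r ^ 2 + t ^ 2 - 2 * r * t * Real.cos θ)))
      (Ioo 0 Real.pi) θ := by
    intro θ hθ
    have := (((Real.hasDerivAt_cos θ).const_mul (2 * r * t)).const_sub (r ^ 2 + t ^ 2)).sqrt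
      (hQ θ hθ).ne'
    exact this.hasDerivWithinAt.congr_deriv (by ring)
  have hinj : InjOn (fun θ => √(r ^ 2 + t ^ 2 - 2 * r * t * Real.cos θ)) (Ioo 0 Real.pi) := by
    intro a ha b hb hab
    have h1 := (Real.sqrt_inj (hQ a ha).le (hQ b hb).le).1 hab
    refine Real.injOn_cos ⟨ha.1.le, ha.2.le⟩ ⟨hb.1.le, hb.2.le⟩ ?_
    have : 2 * r * t * Real.cos a = 2 * r * t * Real.cos b := by linarith
    exact mul_left_cancel₀ hrt.ne' this
  have key := lintegral_image_eq_lintegral_abs_deriv_mul measurableSet_Ioo hderiv hinj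
    (fun s => ENNReal.ofReal (kern d r t s) * h s)
  rw [cosineLaw_image hr ht] at key
  have h1 : ∫⁻ s, ENNReal.ofReal (kern d r t s) * h s =
      ∫⁻ s in Ioo |r - t| (r + t), ENNReal.ofReal (kern d r t s) * h s := by
    rw [← lintegral_indicator measurableSet_Ioo]
    refine lintegral_congr fun s => ?_
    by_cases hs : s ∈ Ioo |r - t| (r + t)
    · simp [hs]
    · simp [hs, kern]
  rw [h1, key, ← lintegral_const_mul' _ _ (by simp)]
  refine setLIntegral_congr_fun measurableSet_Ioo fun θ hθ => ?_
  have hs : 0 < Real.sin θ := Real.sin_pos_of_mem_Ioo hθ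
  set s := √(r ^ 2 + t ^ 2 - 2 * r * t * Real.cos θ) with hsdef
  have hs0 : 0 < s := Real.sqrt_pos.2 (hQ θ hθ)
  have hmem : s ∈ Ioo |r - t| (r + t) := by
    rw [← cosineLaw_image hr ht]; exact ⟨θ, hθ, rfl⟩
  have hs2 : s ^ 2 = r ^ 2 + t ^ 2 - 2 * r * t * Real.cos θ := Real.sq_sqrt (hQ θ hθ).le
  have hcos : (r ^ 2 + t ^ 2 - s ^ 2) / (2 * r * t) = Real.cos θ := by
    rw [hs2]; field_simp; ring
  have hk : kern d r t s = (∫ θ in (0 : ℝ)..Real.pi, Real.sin θ ^ (d - 2))⁻¹ *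
    (s / (r * t) * Real.sin θ ^ (d - 3)) := by
    rw [kern, indicator_of_mem hmem, hcos, ← Real.sin_sq, Real.sqrt_sq hs.le]
  simp only [hk]
  rw [← mul_assoc, ← mul_assoc, ← ENNReal.ofReal_mul hpos.le, ← ENNReal.ofReal_mul (by positivity)]
  congr 2
  rw [abs_of_pos (by positivity)]
  -- One factor sin θ is used up by the Jacobian ds/dθ = r t sin θ / s. The remaining power d - 3 is
  -- nonnegative for d ≥ 3, so the sine contributes no singularity to the kernel.
  have h5 : Real.sin θ ^ (d - 2) = Real.sin θ * Real.sin θ ^ (d - 3) := by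
    rw [← pow_succ']; congr 1; omega
  rw [h5]
  field_simp

/-- Normalised surface measure on the unit sphere. -/
noncomputable abbrev sphereProb (d : ℕ) :
    Measure (Metric.sphere (0 : EuclideanSpace ℝ (Fin d)) 1) :=
  ((volume : Measure (EuclideanSpace ℝ (Fin d))).toSphere univ)⁻¹ •
    (volume : Measure (EuclideanSpace ℝ (Fin d))).toSphere

/-- With e = x/|x| one has |x - t y|² = |x|² + t² - 2|x| t ⟨e, y⟩, so the law of the coordinate ⟨e,
y⟩ combined with the cosine substitution gives the density. Testing on h = 1 identifies the unknown
constant times the sine integral with the total surface measure. -/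
lemma map_norm_sub_smul_sphereProb {d : ℕ} (hd : 3 ≤ d) {x : EuclideanSpace ℝ (Fin d)}
    (hx : x ≠ 0) {t : ℝ} (ht : 0 < t) :
    (sphereProb d).map (fun y : Metric.sphere (0 : EuclideanSpace ℝ (Fin d)) 1 =>
       ‖x - t • (y : EuclideanSpace ℝ (Fin d))‖) =
      volume.withDensity (fun s => ENNReal.ofReal (kern d ‖x‖ t s)) := by
  have hr : 0 < ‖x‖ := norm_pos_iff.2 hx
  have hE : Module.finrank ℝ (EuclideanSpace ℝ (Fin d)) = d := by simp
  have : Nontrivial (EuclideanSpace ℝ (Fin d)) :=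
    Module.nontrivial_of_finrank_pos (R := ℝ) (by omega)
  set e : EuclideanSpace ℝ (Fin d) := ‖x‖⁻¹ • x with he
  have hen : ‖e‖ = 1 := by rw [he, norm_smul, norm_inv, norm_norm, inv_mul_cancel₀ hr.ne']
  obtain ⟨c, hc⟩ := lintegral_sphere_inner (by omega : 2 ≤ d) hE hen
  have hpos := sinInt_pos d
  set σ := (volume : Measure (EuclideanSpace ℝ (Fin d))).toSphere with hσ
  have hW : ∫⁻ θ in Ioo 0 Real.pi, ENNReal.ofReal (Real.sin θ ^ (d - 2)) =
      ENNReal.ofReal (∫ θ in (0 : ℝ)..Real.pi, Real.sin θ ^ (d - 2)) := by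
    rw [setLIntegral_congr Ioo_ae_eq_Ioc, intervalIntegral.integral_of_le Real.pi_pos.le,
      ofReal_integral_eq_lintegral_ofReal]
    · exact (Continuous.intervalIntegrable (by fun_prop) _ _).1
    · filter_upwards [ae_restrict_mem measurableSet_Ioc] with θ hθ
      exact pow_nonneg (Real.sin_nonneg_of_nonneg_of_le_pi hθ.1.le hθ.2) _
  have hσ1 : σ univ = c * ENNReal.ofReal (∫ θ in (0 : ℝ)..Real.pi, Real.sin θ ^ (d - 2)) := by
    have := hc 1 measurable_one
    simpa [hW] using this
  have hσ0 : σ univ ≠ 0 := by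
    rw [Ne, Measure.measure_univ_eq_zero]; exact Measure.toSphere_ne_zero _
  have hσt : σ univ ≠ ∞ := measure_ne_top _ _
  refine Measure.ext fun s hs => ?_
  have hm : Measurable (fun y : Metric.sphere (0 : EuclideanSpace ℝ (Fin d)) 1 =>
    ‖x - t • (y : EuclideanSpace ℝ (Fin d))‖) := by fun_prop
  rw [← lintegral_indicator_one hs, lintegral_map (measurable_one.indicator hs) hm,
    lintegral_smul_measure, withDensity_apply _ hs]
  have hnorm : ∀ y : Metric.sphere (0 : EuclideanSpace ℝ (Fin d)) 1,
      ‖x - t • (y : EuclideanSpace ℝ (Fin d))‖ =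
        √(‖x‖ ^ 2 + t ^ 2 - 2 * ‖x‖ * t * inner ℝ e (y : EuclideanSpace ℝ (Fin d))) := by
    intro y
    rw [← Real.sqrt_sq (norm_nonneg (x - _)), norm_sub_sq_real, inner_smul_right, norm_smul,
      he, inner_smul_left]
    have : ‖(y : EuclideanSpace ℝ (Fin d))‖ = 1 := by simp
    rw [this]
    simp only [Real.norm_eq_abs, mul_one, sq_abs, conj_trivial]
    congr 1
    field_simp
    ring
  simp_rw [hnorm]
  rw [hc (fun u => s.indicator 1 (√(‖x‖ ^ 2 + t ^ 2 - 2 * ‖x‖ * t * u)))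
    ((measurable_one.indicator hs).comp (by fun_prop)), lintegral_cosineLaw hd hr ht, ← mul_assoc c,
    ← hσ1, smul_eq_mul, ← mul_assoc, ENNReal.inv_mul_cancel hσ0 hσt, one_mul,
    ← lintegral_indicator hs]
  refine lintegral_congr fun u => ?_
  by_cases hu : u ∈ s <;> simp [hu]

/-! ### Pointwise bounds for the kernel -/

/-- The normalising factor of the kernel. -/
noncomputable def kernConst (d : ℕ) : ℝ := (∫ θ in (0 : ℝ)..Real.pi, Real.sin θ ^ (d - 2))⁻¹

lemma kernConst_pos (d : ℕ) : 0 < kernConst d := inv_pos.2 (sinInt_pos d)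

lemma kern_of_mem {d : ℕ} {r t s : ℝ} (hs : s ∈ Ioo |r - t| (r + t)) :
    kern d r t s = kernConst d *
      (s / (r * t) * √(1 - ((r ^ 2 + t ^ 2 - s ^ 2) / (2 * r * t)) ^ 2) ^ (d - 3)) := by
  rw [kern, indicator_of_mem hs, kernConst]

lemma kern_of_notMem {d : ℕ} {r t s : ℝ} (hs : s ∉ Ioo |r - t| (r + t)) : kern d r t s = 0 := by
  rw [kern, indicator_of_notMem hs]

lemma kern_le {d : ℕ} {r t s : ℝ} (hr : 0 < r) (ht : 0 < t) (hs : s ∈ Ioo |r - t| (r + t)) :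
    kern d r t s ≤ kernConst d * (s / (r * t)) := by
  have hs0 : 0 < s := lt_of_le_of_lt (abs_nonneg _) hs.1
  have h1 : √(1 - ((r ^ 2 + t ^ 2 - s ^ 2) / (2 * r * t)) ^ 2) ≤ 1 := by
    rw [Real.sqrt_le_one]
    linarith [sq_nonneg ((r ^ 2 + t ^ 2 - s ^ 2) / (2 * r * t))]
  have h2 := pow_le_one₀ (n := d - 3) (Real.sqrt_nonneg _) h1
  rw [kern_of_mem hs]
  refine mul_le_mul_of_nonneg_left ?_ (kernConst_pos d).le
  exact mul_le_of_le_one_right (by positivity) h2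

/-- Near the origin the kernel is at most a multiple of the normalised indicator function of
`(t - r, t + r)`. -/
lemma kern_le_near {d : ℕ} {r t : ℝ} (hr : 0 < r) (hr' : r ≤ 1 / 2) (ht : t ∈ Icc (1 : ℝ) 2)
    (s : ℝ) : kern d r t s ≤ (Ioo (t - r) (t + r)).indicator (fun _ => kernConst d * (3 / r)) s := by
  have hc := kernConst_pos d
  have ht0 : 0 < t := by linarith [ht.1]
  by_cases hs : s ∈ Ioo |r - t| (r + t)
  · have hs' : s ∈ Ioo (t - r) (t + r) :=
      ⟨by linarith [hs.1, neg_abs_le (r - t)], by linarith [hs.2]⟩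
    rw [indicator_of_mem hs']
    refine (kern_le hr ht0 hs).trans (mul_le_mul_of_nonneg_left ?_ hc.le)
    rw [div_le_div_iff₀ (by positivity) hr]
    nlinarith [hs.2, ht.1, ht.2, mul_pos hr ht0]
  · rw [kern_of_notMem hs]
    exact indicator_nonneg (fun _ _ => by positivity) _

/-- Far from the origin the kernel is bounded and lives on `(r - 2, r + 2)`. -/
lemma kern_le_far {d : ℕ} {r t : ℝ} (hr : 4 ≤ r) (ht : t ∈ Icc (1 : ℝ) 2) (s : ℝ) :
    kern d r t s ≤ (Ioo (r - 2) (r + 2)).indicator (fun _ => kernConst d * 2) s := by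
  have hc := kernConst_pos d
  have ht0 : 0 < t := by linarith [ht.1]
  have hr0 : 0 < r := by linarith
  by_cases hs : s ∈ Ioo |r - t| (r + t)
  · have hs' : s ∈ Ioo (r - 2) (r + 2) :=
      ⟨by linarith [hs.1, le_abs_self (r - t), ht.2], by linarith [hs.2, ht.2]⟩
    rw [indicator_of_mem hs']
    refine (kern_le hr0 ht0 hs).trans (mul_le_mul_of_nonneg_left ?_ hc.le)
    rw [div_le_iff₀ (by positivity)]
    nlinarith [hs.2, ht.1, ht.2, mul_pos hr0 ht0]
  · rw [kern_of_notMem hs]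
    exact indicator_nonneg (fun _ _ => by positivity) _

/-- The kernel is at most a multiple of `s ^ (d - 2)`, locally uniformly in `r > 0`. -/
lemma kern_le_pow {d : ℕ} (hd : 3 ≤ d) {r t : ℝ} (hr0 : 0 < r) (ht : 1 ≤ t) (s : ℝ) :
    kern d r t s ≤ (Ioo |r - t| (r + t)).indicator (fun s => kernConst d / r * s ^ (d - 2)) s := by
  have hc := kernConst_pos d
  have ht0 : 0 < t := by linarith
  by_cases hs : s ∈ Ioo |r - t| (r + t)
  · rw [indicator_of_mem hs, kern_of_mem hs, div_eq_mul_inv (kernConst d) r, mul_assoc (kernConst d)]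
    have hs0 : 0 < s := lt_of_le_of_lt (abs_nonneg _) hs.1
    refine mul_le_mul_of_nonneg_left ?_ hc.le
    have h1 : √(1 - ((r ^ 2 + t ^ 2 - s ^ 2) / (2 * r * t)) ^ 2) ≤ s := by
      rw [Real.sqrt_le_left hs0.le]
      set c := (r ^ 2 + t ^ 2 - s ^ 2) / (2 * r * t) with hcdef
      -- In the triangle with sides r, t, s the altitude onto the side r has length t sin θ and is
      -- at most s. As t ≥ 1 this gives sin θ ≤ s.
      have h2 : s ^ 2 = (r - t * c) ^ 2 + t ^ 2 * (1 - c ^ 2) := by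
        rw [hcdef]; field_simp; ring
      rcases le_total 0 (1 - c ^ 2) with h3 | h3
      · nlinarith [sq_nonneg (r - t * c), mul_nonneg (by nlinarith : 0 ≤ t ^ 2 - 1) h3]
      · nlinarith
    have h4 : s ^ (d - 2) = s * s ^ (d - 3) := by
      rw [← pow_succ']; congr 1; omega
    rw [h4, ← mul_assoc]
    refine mul_le_mul ?_ (pow_le_pow_left₀ (Real.sqrt_nonneg _) h1 _) (by positivity) (by positivity)
    rw [inv_mul_eq_div]
    exact div_le_div_of_nonneg_left hs0.le hr0 (le_mul_of_one_le_right hr0.le ht)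
  · rw [kern_of_notMem hs, indicator_of_notMem hs]

/-- At unit distance from the origin the kernel is at most a multiple of `s ^ (d - 2)`. -/
lemma kern_le_mid {d : ℕ} (hd : 3 ≤ d) {r t : ℝ} (hr : 1 / 2 ≤ r) (ht : 1 ≤ t) (s : ℝ) :
    kern d r t s ≤ (Ioo |r - t| (r + t)).indicator (fun s => kernConst d * 2 * s ^ (d - 2)) s := by
  have hc := kernConst_pos d
  refine (kern_le_pow hd (by linarith) ht s).trans ?_
  by_cases hs : s ∈ Ioo |r - t| (r + t)
  · have hs0 : 0 < s := lt_of_le_of_lt (abs_nonneg _) hs.1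
    rw [indicator_of_mem hs, indicator_of_mem hs]
    refine mul_le_mul_of_nonneg_right ?_ (by positivity)
    rw [div_le_iff₀ (by linarith)]
    nlinarith
  · rw [indicator_of_notMem hs, indicator_of_notMem hs]

/-- This is a converse to `kern_le_mid`, used for the test functions. If s ≥ 2|r - t| the triangle
is far from degenerate relative to s: with c = cos θ one has 1 - c ≥ s²/12 and 1 + c ≥ 2/9, hence
sin²θ ≥ s²/54 ≥ (s/8)². The range [3/4, 9/4] of r is the 1/4-neighbourhood of [1, 2]. -/
lemma le_kern {d : ℕ} (hd : 3 ≤ d) {r t s : ℝ} (hr : r ∈ Icc (3 / 4 : ℝ) (9 / 4))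
    (ht : t ∈ Icc (1 : ℝ) 2) (hs0 : 0 < s) (hs : 2 * |r - t| ≤ s) (hs1 : s ≤ 1) :
    kernConst d * (s / 8) ^ (d - 2) ≤ kern d r t s := by
  have hc := kernConst_pos d
  have ht0 : 0 < t := by linarith [ht.1]
  have hr0 : 0 < r := by linarith [hr.1]
  have hmem : s ∈ Ioo |r - t| (r + t) :=
    ⟨by linarith [abs_nonneg (r - t)], by linarith [ht.1, hr.1]⟩
  have hrt : 2 * r * t ≤ 9 := by nlinarith [hr.2, ht.2]
  rw [kern_of_mem hmem]
  refine mul_le_mul_of_nonneg_left ?_ hc.le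
  have h4 : (s / 8) ^ (d - 2) = s / 8 * (s / 8) ^ (d - 3) := by
    rw [← pow_succ']; congr 1; omega
  rw [h4]
  have h1 : s / 8 ≤ s / (r * t) :=
    div_le_div_of_nonneg_left hs0.le (by positivity) (by linarith)
  have h2 : s / 8 ≤ √(1 - ((r ^ 2 + t ^ 2 - s ^ 2) / (2 * r * t)) ^ 2) := by
    apply Real.le_sqrt_of_sq_le
    set c := (r ^ 2 + t ^ 2 - s ^ 2) / (2 * r * t) with hcdef
    have hsq : 4 * (r - t) ^ 2 ≤ s ^ 2 := by
      have := pow_le_pow_left₀ (by positivity) hs 2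
      rw [mul_pow, sq_abs] at this
      linarith
    have h5 : s ^ 2 / 12 ≤ 1 - c := by
      have : 1 - c = (s ^ 2 - (r - t) ^ 2) / (2 * r * t) := by
        rw [hcdef]; field_simp; ring
      rw [this, le_div_iff₀ (by positivity)]
      nlinarith [sq_nonneg s]
    have h6 : 2 / 9 ≤ 1 + c := by
      have : 1 + c = ((r + t) ^ 2 - s ^ 2) / (2 * r * t) := by
        rw [hcdef]; field_simp; ring
      rw [this, le_div_iff₀ (by positivity)]
      nlinarith [hr.1, ht.1]
    have : s ^ 2 / 12 * (2 / 9) ≤ (1 - c) * (1 + c) :=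
      mul_le_mul h5 h6 (by norm_num) ((by positivity : (0 : ℝ) ≤ s ^ 2 / 12).trans h5)
    nlinarith [sq_nonneg s]
  exact mul_le_mul h1 (pow_le_pow_left₀ (by positivity) h2 _) (by positivity) (by positivity)

/-! ### From radial functions to one-dimensional profiles -/

/-- By polar coordinates a null set meets almost every ray in a one-dimensional null set. One such
ray is enough to read off the profile of a radial function. -/
lemma ae_radial_of_ae {d : ℕ} (hd : 1 ≤ d) {P : EuclideanSpace ℝ (Fin d) → Prop}
    (hP : ∀ᵐ x, P x) :
    ∃ y : EuclideanSpace ℝ (Fin d), ‖y‖ = 1 ∧ ∀ᵐ r ∂(volume.restrict (Ioi (0 : ℝ))), P (r • y) := by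
  have hE : Module.finrank ℝ (EuclideanSpace ℝ (Fin d)) = d := by simp
  have : Nontrivial (EuclideanSpace ℝ (Fin d)) :=
    Module.nontrivial_of_finrank_pos (R := ℝ) (by omega)
  obtain ⟨N, hN, hNm, hN0⟩ := exists_measurable_superset_of_null (ae_iff.1 hP)
  have h1 : Measurable (N.indicator (1 : EuclideanSpace ℝ (Fin d) → ℝ≥0∞)) :=
    measurable_one.indicator hNm
  have h2 := lintegral_eq_lintegral_sphere (volume : Measure (EuclideanSpace ℝ (Fin d))) h1
  rw [lintegral_indicator_one hNm, hN0] at h2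
  have h3 := (lintegral_eq_zero_iff (by fun_prop)).1 h2.symm
  have h4 : ((volume : Measure (EuclideanSpace ℝ (Fin d))).toSphere) ≠ 0 :=
    Measure.toSphere_ne_zero _
  have := ae_neBot.2 h4
  obtain ⟨y, hy⟩ := h3.exists
  refine ⟨y, by simp, ?_⟩
  have h5 := (lintegral_eq_zero_iff (by fun_prop)).1 hy
  filter_upwards [h5, ae_restrict_mem measurableSet_Ioi] with r hr hr0
  by_contra hPr
  have h6 : r • (y : EuclideanSpace ℝ (Fin d)) ∈ N := hN hPr
  simp only [indicator_of_mem h6, Pi.zero_apply, Pi.one_apply, mul_one, ENNReal.ofReal_eq_zero] at hr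
  exact absurd hr (not_le.2 (pow_pos hr0 _))

lemma ae_norm_of_ae {d : ℕ} (hd : 1 ≤ d) {P : ℝ → Prop}
    (hP : ∀ᵐ r ∂(volume.restrict (Ioi (0 : ℝ))), P r) :
    ∀ᵐ x : EuclideanSpace ℝ (Fin d), P ‖x‖ := by
  have hE : Module.finrank ℝ (EuclideanSpace ℝ (Fin d)) = d := by simp
  have : Nontrivial (EuclideanSpace ℝ (Fin d)) :=
    Module.nontrivial_of_finrank_pos (R := ℝ) (by omega)
  obtain ⟨N, hN, hNm, hN0⟩ := exists_measurable_superset_of_null (ae_iff.1 hP)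
  have h1 := lintegral_fun_norm (volume : Measure (EuclideanSpace ℝ (Fin d)))
    (h := N.indicator 1) (measurable_one.indicator hNm)
  have h2 : ∫⁻ r in Ioi (0 : ℝ), ENNReal.ofReal
      (r ^ (Module.finrank ℝ (EuclideanSpace ℝ (Fin d)) - 1)) * N.indicator 1 r = 0 := by
    rw [lintegral_congr_ae (g := fun _ => 0)]
    · simp
    · filter_upwards [measure_eq_zero_iff_ae_notMem.1 hN0] with r hr
      simp [hr]
  have h3 : Measurable (fun x : EuclideanSpace ℝ (Fin d) => N.indicator (1 : ℝ → ℝ≥0∞) ‖x‖) :=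
    (measurable_one.indicator hNm).comp measurable_norm
  rw [h2, mul_zero, lintegral_eq_zero_iff h3] at h1
  filter_upwards [h1] with x hx
  by_contra hne
  have : ‖x‖ ∈ N := hN hne
  simp [this] at hx

/-- The spherical averages of a radial function are one-dimensional integrals of a measurable
profile against the kernel. -/
lemma exists_radial_profile {d : ℕ} (hd : 3 ≤ d) {f : EuclideanSpace ℝ (Fin d) → ℂ}
    (hf : IsRadial f) (hm : AEStronglyMeasurable f volume) :
    ∃ g : ℝ → ℂ, StronglyMeasurable g ∧ (f =ᵐ[volume] fun x => g ‖x‖) ∧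
      ∀ x : EuclideanSpace ℝ (Fin d), x ≠ 0 → ∀ t : ℝ, 0 < t →
        (SphereIntegrable t f x ↔ ∫⁻ s, ENNReal.ofReal (kern d ‖x‖ t s) * ‖g s‖ₑ < ∞) ∧
        sphericalAvg t f x = ∫ s, kern d ‖x‖ t s • g s := by
  obtain ⟨f₀, hf₀⟩ := hf
  obtain ⟨F, hF, hfF⟩ := hm
  obtain ⟨y, hy1, hy⟩ := ae_radial_of_ae (by omega) hfF
  have hE : Module.finrank ℝ (EuclideanSpace ℝ (Fin d)) = d := by simp
  have : Nontrivial (EuclideanSpace ℝ (Fin d)) :=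
    Module.nontrivial_of_finrank_pos (R := ℝ) (by omega)
  -- The given profile f₀ need not be measurable. Restricting a measurable representative of f to a
  -- good ray yields a measurable profile that agrees with f₀ almost everywhere on (0, ∞).
  let g : ℝ → ℂ := fun r => F (r • y)
  have hg : StronglyMeasurable g := hF.comp_measurable (by fun_prop)
  have hfg : ∀ᵐ r ∂(volume.restrict (Ioi (0 : ℝ))), f₀ r = g r := by
    filter_upwards [hy, ae_restrict_mem measurableSet_Ioi] with r hr hr0
    rw [hf₀, norm_smul, hy1, mul_one, Real.norm_of_nonneg (le_of_lt hr0)] at hr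
    exact hr
  obtain ⟨N, hN, hNm, hN0⟩ := exists_measurable_superset_of_null (ae_iff.1 hfg)
  rw [Measure.restrict_apply hNm] at hN0
  refine ⟨g, hg, ?_, fun x hx t ht => ?_⟩
  · filter_upwards [ae_norm_of_ae (by omega) hfg] with x hx
    rw [hf₀, hx]
  have hmap := map_norm_sub_smul_sphereProb hd hx ht
  have hr : 0 < ‖x‖ := norm_pos_iff.2 hx
  set φ : Metric.sphere (0 : EuclideanSpace ℝ (Fin d)) 1 → ℝ :=
    fun y => ‖x - t • (y : EuclideanSpace ℝ (Fin d))‖ with hφ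
  have hφm : Measurable φ := by fun_prop
  have hkm := measurable_kern d ‖x‖ t
  have hae : (fun y : Metric.sphere (0 : EuclideanSpace ℝ (Fin d)) 1 =>
      f (x - t • (y : EuclideanSpace ℝ (Fin d)))) =ᵐ[sphereProb d] g ∘ φ := by
    -- The distance |x - t y| has an absolutely continuous law carried by (0, ∞), so no sphere about
    -- x ≠ 0 sees the exceptional radii. The formula for the average therefore holds at every x ≠ 0,
    -- not just almost everywhere.
    have h1 : ∀ᵐ s ∂((sphereProb d).map φ), s ∉ N := by
      rw [hmap, ae_withDensity_iff (by fun_prop)]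
      have : ∀ᵐ s : ℝ, s ∉ N ∩ Ioi 0 := by
        exact measure_eq_zero_iff_ae_notMem.1 hN0
      filter_upwards [this] with s hs hk hsN
      refine hs ⟨hsN, ?_⟩
      by_contra hs0
      apply hk
      rw [kern_of_notMem, ENNReal.ofReal_zero]
      exact fun h => hs0 (lt_of_le_of_lt (abs_nonneg _) h.1)
    filter_upwards [ae_of_ae_map hφm.aemeasurable h1] with z hz
    rw [hf₀]
    by_contra hne
    exact hz (hN hne)
  have hc0 : (((volume : Measure (EuclideanSpace ℝ (Fin d))).toSphere univ)⁻¹) ≠ 0 :=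
    ENNReal.inv_ne_zero.2 (measure_ne_top _ _)
  have hct : (((volume : Measure (EuclideanSpace ℝ (Fin d))).toSphere univ)⁻¹) ≠ ∞ := by
    rw [Ne, ENNReal.inv_eq_top, Measure.measure_univ_eq_zero]
    exact Measure.toSphere_ne_zero _
  constructor
  · rw [SphereIntegrable, ← integrable_smul_measure hc0 hct, integrable_congr hae,
      ← integrable_map_measure hg.aestronglyMeasurable hφm.aemeasurable, hmap]
    rw [Integrable, and_iff_right hg.aestronglyMeasurable, HasFiniteIntegral,
      lintegral_withDensity_eq_lintegral_mul _ (by fun_prop) hg.enorm]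
    rfl
  · rw [sphericalAvg, average, integral_congr_ae hae]
    have := integral_map (μ := sphereProb d) hφm.aemeasurable (f := g) hg.aestronglyMeasurable
    simp only [Function.comp_def]
    rw [← this, hmap]
    have h2 := integral_withDensity_eq_integral_smul (μ := volume)
      (f := fun s => Real.toNNReal (kern d ‖x‖ t s)) (by fun_prop) g
    refine h2.trans (integral_congr_ae (Eventually.of_forall fun s => ?_))
    simp only [NNReal.smul_def, Real.coe_toNNReal _ (kern_nonneg hr ht s)]

/-! ### Hardy-type inequalities -/

/-- `∫_0^b λ^(e-1) dλ ≤ b^e / e`, for an extended nonnegative `b`. -/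
lemma lintegral_rpow_lt_le {e : ℝ} (he : 0 < e) (b : ℝ≥0∞) :
    ∫⁻ l in Ioi (0 : ℝ), {l : ℝ | ENNReal.ofReal l < b}.indicator
      (fun l => ENNReal.ofReal (l ^ (e - 1))) l ≤ ENNReal.ofReal (1 / e) * b ^ e := by
  rcases eq_or_ne b ∞ with rfl | hb
  · rw [ENNReal.top_rpow_of_pos he, ENNReal.mul_top (by simpa using he)]
    exact le_top
  lift b to ℝ≥0 using hb
  have h1 : ∫⁻ l in Ioi (0 : ℝ), {l : ℝ | ENNReal.ofReal l < b}.indicator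
      (fun l => ENNReal.ofReal (l ^ (e - 1))) l ≤
      ∫⁻ l in Ioc (0 : ℝ) b, ENNReal.ofReal (l ^ (e - 1)) := by
    rw [← lintegral_indicator measurableSet_Ioi, ← lintegral_indicator measurableSet_Ioc]
    refine lintegral_mono fun l => ?_
    by_cases hl : l ∈ Ioi (0 : ℝ)
    · rw [indicator_of_mem hl]
      by_cases hlb : ENNReal.ofReal l < b
      · have : l ∈ Ioc (0 : ℝ) b := by
          refine ⟨hl, ?_⟩
          rw [ENNReal.ofReal_lt_coe_iff (le_of_lt hl)] at hlb
          exact hlb.le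
        rw [indicator_of_mem this, indicator_of_mem (by exact hlb)]
      · rw [indicator_of_notMem (by exact hlb)]
        exact zero_le
    · rw [indicator_of_notMem hl]
      exact zero_le
  refine h1.trans (le_of_eq ?_)
  rw [← ofReal_integral_eq_lintegral_ofReal, ← intervalIntegral.integral_of_le b.coe_nonneg,
    integral_rpow (Or.inl (by linarith))]
  · rw [sub_add_cancel, Real.zero_rpow he.ne', sub_zero, div_eq_inv_mul, ENNReal.ofReal_mul
      (by positivity), ← ENNReal.ofReal_rpow_of_nonneg b.coe_nonneg he.le, ENNReal.ofReal_coe_nnreal,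
      one_div]
  · exact (intervalIntegral.intervalIntegrable_rpow' (by linarith)).1
  · filter_upwards [ae_restrict_mem measurableSet_Ioc] with l hl
    exact Real.rpow_nonneg hl.1.le _

/-- Truncated integrals are controlled by the `L^p` norm (Chebyshev). -/
lemma lintegral_truncation_le {Y : Type*} [MeasurableSpace Y] (ν : Measure Y) {ψ : Y → ℝ≥0∞}
    (hψ : Measurable ψ) {p : ℝ} (hp : 1 < p) {τ : ℝ≥0∞} (h0 : τ ≠ 0) (ht : τ ≠ ∞) :
    ∫⁻ b in {b | τ < ψ b}, ψ b ∂ν ≤ τ ^ (1 - p) * ∫⁻ b, ψ b ^ p ∂ν := by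
  rw [← lintegral_const_mul _ (by fun_prop)]
  refine (setLIntegral_mono' (measurableSet_lt measurable_const hψ) (fun b hb => ?_)).trans
    (setLIntegral_le_lintegral _ _)
  have hb : τ < ψ b := hb
  rcases eq_or_ne (ψ b) ∞ with h | h
  · rw [h, ENNReal.top_rpow_of_pos (by linarith), ENNReal.mul_top]
    exact (ENNReal.rpow_pos (pos_iff_ne_zero.2 h0) ht).ne'
  · have hb0 : ψ b ≠ 0 := (lt_of_le_of_lt zero_le hb).ne'
    calc ψ b = ψ b ^ (1 - p) * ψ b ^ p := by
          rw [← ENNReal.rpow_add _ _ hb0 h]; simp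
      _ ≤ τ ^ (1 - p) * ψ b ^ p := by
          gcongr ?_ * _
          rw [← neg_sub p 1, ENNReal.rpow_neg, ENNReal.rpow_neg]
          exact ENNReal.inv_le_inv.2 (ENNReal.rpow_le_rpow hb.le (by linarith))

/-- A Hardy-type inequality: `G` is an average of `ψ` over sets of measure at most `x`, in the weak
sense of `hG`. -/
lemma lintegral_rpow_average_le {X Y : Type*} [MeasurableSpace X] [MeasurableSpace Y]
    (n : Measure X) (ν : Measure Y) [SFinite ν] {x G : X → ℝ≥0∞} {ψ : Y → ℝ≥0∞}
    (hGm : Measurable G) (hψ : Measurable ψ)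
    {p : ℝ} (hp : 1 < p) {C : ℝ≥0∞} (hx0 : ∀ a, x a ≠ 0) (hxt : ∀ a, x a ≠ ∞)
    (hx : ∀ y ≠ ∞, n {a | x a ≤ y} ≤ C * y)
    (hG : ∀ a τ, G a * x a ≤ ∫⁻ b in {b | τ < ψ b}, ψ b ∂ν + τ * x a)
    (hfin : ∫⁻ b, ψ b ^ p ∂ν ≠ ∞) :
    ∫⁻ a, G a ^ p ∂n ≤
      ENNReal.ofReal (p * 2 ^ p / (p - 1)) * C * ∫⁻ b, ψ b ^ p ∂ν := by
  have hp0 : 0 < p := by linarith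
  have hp1 : 0 < p - 1 := by linarith
  let F : ℝ≥0∞ → ℝ≥0∞ := fun τ => ∫⁻ b in {b | τ < ψ b}, ψ b ∂ν
  have hF : ∀ τ, τ ≠ 0 → τ ≠ ∞ → F τ ≠ ∞ := fun τ h0 ht =>
    ((lintegral_truncation_le ν hψ hp h0 ht).trans_lt (ENNReal.mul_lt_top
      (ENNReal.rpow_ne_top_of_ne_zero h0 ht).lt_top hfin.lt_top)).ne
  have hGfin : ∀ a, G a ≠ ∞ := by
    intro a ha
    have := hG a 1
    rw [ha, ENNReal.top_mul (hx0 a), top_le_iff, one_mul] at this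
    exact ENNReal.add_ne_top.2 ⟨hF 1 one_ne_zero ENNReal.one_ne_top, hxt a⟩ this
  have hlevel : ∀ l ∈ Ioi (0 : ℝ), n {a | l < (G a).toReal} * ENNReal.ofReal (l ^ (p - 1)) ≤
      (2 * C) * (ENNReal.ofReal (l ^ (p - 1 - 1)) * F (ENNReal.ofReal (l / 2))) := by
    intro l hl
    have hl : (0 : ℝ) < l := hl
    set L := ENNReal.ofReal (l / 2) with hL
    have hL0 : L ≠ 0 := by rw [hL]; simpa using hl
    have hLt : L ≠ ∞ := ENNReal.ofReal_ne_top
    -- Where G > l = 2L, the hypothesis `hG` with τ = L reads 2L x ≤ F(L) + L x. Half of the left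
    -- side absorbs the last term and leaves x ≤ F(L)/L.
    have h1 : {a | l < (G a).toReal} ⊆ {a | x a ≤ F L / L} := by
      intro a ha
      have h2 : 2 * L < G a := by
        rw [← ENNReal.ofReal_toReal (hGfin a), hL, ← ENNReal.ofReal_ofNat,
          ← ENNReal.ofReal_mul zero_le_two, ENNReal.ofReal_lt_ofReal_iff']
        have ha : l < (G a).toReal := ha
        exact ⟨by linarith, by linarith⟩
      have h3 := (mul_le_mul_left h2.le (x a)).trans (hG a L)
      rw [two_mul, add_mul] at h3
      have h4 : L * x a ≤ F L :=
        (ENNReal.add_le_add_iff_right (ENNReal.mul_ne_top hLt (hxt a))).1 h3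
      rw [mem_ofPred_eq, ENNReal.le_div_iff_mul_le (Or.inl hL0) (Or.inl hLt), mul_comm]
      exact h4
    have h5 : n {a | l < (G a).toReal} ≤ C * (F L / L) :=
      (measure_mono h1).trans (hx _ (ENNReal.div_ne_top (hF L hL0 hLt) hL0))
    calc _ ≤ C * (F L / L) * ENNReal.ofReal (l ^ (p - 1)) := by gcongr
      _ = _ := by
        have h6 : L⁻¹ * ENNReal.ofReal (l ^ (p - 1)) = 2 * ENNReal.ofReal (l ^ (p - 1 - 1)) := by
          rw [hL, ← ENNReal.ofReal_inv_of_pos (by positivity), ← ENNReal.ofReal_mul (by positivity),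
            ← ENNReal.ofReal_ofNat, ← ENNReal.ofReal_mul zero_le_two,
            Real.rpow_sub_one hl.ne' (p - 1)]
          congr 1
          field_simp
        rw [div_eq_mul_inv, mul_assoc, mul_assoc, h6]
        ring
  calc ∫⁻ a, G a ^ p ∂n = ∫⁻ a, ENNReal.ofReal ((G a).toReal ^ p) ∂n := by
        refine lintegral_congr fun a => ?_
        rw [← ENNReal.ofReal_rpow_of_nonneg ENNReal.toReal_nonneg hp0.le,
          ENNReal.ofReal_toReal (hGfin a)]
    _ = ENNReal.ofReal p * ∫⁻ l in Ioi (0 : ℝ), n {a | l < (G a).toReal} *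
          ENNReal.ofReal (l ^ (p - 1)) :=
        lintegral_rpow_eq_lintegral_meas_lt_mul n (Eventually.of_forall fun a =>
          ENNReal.toReal_nonneg) hGm.ennreal_toReal.aemeasurable hp0
    _ ≤ ENNReal.ofReal p * ∫⁻ l in Ioi (0 : ℝ),
          (2 * C) * (ENNReal.ofReal (l ^ (p - 1 - 1)) * F (ENNReal.ofReal (l / 2))) := by
        gcongr ENNReal.ofReal p * ?_
        exact setLIntegral_mono' measurableSet_Ioi hlevel
    _ ≤ ENNReal.ofReal p * ((2 * C) * ∫⁻ b, ENNReal.ofReal (1 / (p - 1)) * 2 ^ (p - 1) *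
          ψ b ^ p ∂ν) := by
        gcongr ENNReal.ofReal p * ?_
        have hS : MeasurableSet {z : ℝ × Y | ENNReal.ofReal (z.1 / 2) < ψ z.2} :=
          measurableSet_lt (by fun_prop) (by fun_prop)
        have hmeas : Measurable (Function.uncurry fun (l : ℝ) (b : Y) =>
            {z : ℝ × Y | ENNReal.ofReal (z.1 / 2) < ψ z.2}.indicator
              (fun z => ENNReal.ofReal (z.1 ^ (p - 1 - 1)) * ψ z.2) (l, b)) :=
          (Measurable.indicator (by fun_prop) hS)
        have hinner : ∀ l, ENNReal.ofReal (l ^ (p - 1 - 1)) * F (ENNReal.ofReal (l / 2)) =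
            ∫⁻ b, {z : ℝ × Y | ENNReal.ofReal (z.1 / 2) < ψ z.2}.indicator
              (fun z => ENNReal.ofReal (z.1 ^ (p - 1 - 1)) * ψ z.2) (l, b) ∂ν := by
          intro l
          simp only [F]
          rw [← lintegral_indicator (measurableSet_lt measurable_const hψ),
            ← lintegral_const_mul' _ _ ENNReal.ofReal_ne_top]
          refine lintegral_congr fun b => ?_
          by_cases hb : ENNReal.ofReal (l / 2) < ψ b <;> simp [indicator, hb]
        simp_rw [hinner]
        have hmeas2 : Measurable fun l : ℝ => ∫⁻ b,
            {z : ℝ × Y | ENNReal.ofReal (z.1 / 2) < ψ z.2}.indicator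
              (fun z => ENNReal.ofReal (z.1 ^ (p - 1 - 1)) * ψ z.2) (l, b) ∂ν :=
          hmeas.lintegral_prod_right'
        rw [lintegral_const_mul _ hmeas2, lintegral_lintegral_swap
          hmeas.aemeasurable]
        gcongr (2 * C) * ?_
        refine lintegral_mono fun b => ?_
        -- After the exchange of integrals, l runs over l < 2ψ(b). Integrating l^(p-2) there gives
        -- (2ψ)^(p-1)/(p-1), and the remaining factor ψ completes ψ^p; this needs p > 1.
        have h2 : ∀ l ∈ Ioi (0 : ℝ), {z : ℝ × Y | ENNReal.ofReal (z.1 / 2) < ψ z.2}.indicator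
            (fun z => ENNReal.ofReal (z.1 ^ (p - 1 - 1)) * ψ z.2) (l, b) =
            {l : ℝ | ENNReal.ofReal l < 2 * ψ b}.indicator
              (fun l => ENNReal.ofReal (l ^ (p - 1 - 1))) l * ψ b := by
          intro l hl
          have h3 : ENNReal.ofReal (l / 2) < ψ b ↔ ENNReal.ofReal l < 2 * ψ b := by
            rw [ENNReal.ofReal_div_of_pos zero_lt_two, ENNReal.ofReal_ofNat,
              ENNReal.div_lt_iff (Or.inl two_ne_zero) (Or.inl ENNReal.ofNat_ne_top), mul_comm]
          by_cases hb : ENNReal.ofReal l < 2 * ψ b <;> simp [indicator, h3, hb]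
        rw [setLIntegral_congr_fun measurableSet_Ioi h2, lintegral_mul_const _ (by
          refine Measurable.indicator (by fun_prop)
            (measurableSet_lt (by fun_prop) measurable_const))]
        refine (mul_le_mul_left (lintegral_rpow_lt_le hp1 _) _).trans (le_of_eq ?_)
        rw [ENNReal.mul_rpow_of_nonneg _ _ hp1.le, mul_assoc, mul_assoc, mul_assoc]
        congr 2
        nth_rewrite 2 [← ENNReal.rpow_one (ψ b)]
        rw [← ENNReal.rpow_add_of_nonneg _ _ hp1.le zero_le_one, sub_add_cancel]
    _ = _ := by
        rw [lintegral_const_mul _ (by fun_prop)]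
        have h2 : (2 : ℝ≥0∞) ^ (p - 1) = ENNReal.ofReal (2 ^ (p - 1)) := by
          rw [← ENNReal.ofReal_rpow_of_pos zero_lt_two, ENNReal.ofReal_ofNat]
        rw [h2, ← ENNReal.ofReal_mul (by positivity)]
        have h3 : ENNReal.ofReal (p * 2 ^ p / (p - 1)) =
            ENNReal.ofReal p * (2 * ENNReal.ofReal (1 / (p - 1) * 2 ^ (p - 1))) := by
          rw [← ENNReal.ofReal_ofNat, ← ENNReal.ofReal_mul zero_le_two,
            ← ENNReal.ofReal_mul hp0.le, Real.rpow_sub_one two_ne_zero]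
          congr 1
          field_simp
        rw [h3]
        ring

/-- The off-diagonal form of the Hardy-type inequality. -/
lemma lintegral_rpow_le_of_truncation {X Y : Type*} [MeasurableSpace X] [MeasurableSpace Y]
    (m : Measure X) (ν : Measure Y) [SFinite ν] {x T : X → ℝ≥0∞} {ψ : Y → ℝ≥0∞}
    (hTm : Measurable T) (hxm : Measurable x) (hψ : Measurable ψ)
    {p q : ℝ} (hp : 1 < p) (hpq : p ≤ q) {C : ℝ≥0∞} (hx0 : ∀ a, x a ≠ 0) (hxt : ∀ a, x a ≠ ∞)
    (hm : ∀ y, y ≠ 0 → y ≠ ∞ → m {a | y < x a} ≤ C * y ^ (-(q - q / p)))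
    (hT : ∀ a τ, T a ≤ ∫⁻ b in {b | τ < ψ b}, ψ b ∂ν + τ * x a)
    (hfin : ∫⁻ b, ψ b ^ p ∂ν ≠ ∞) :
    ∫⁻ a, T a ^ q ∂m ≤ 2 ^ (q - p) * (ENNReal.ofReal (p * 2 ^ p / (p - 1)) *
      (2 ^ (q - q / p + 1) * C)) * (∫⁻ b, ψ b ^ p ∂ν) ^ (q / p) := by
  have hp0 : 0 < p := by linarith
  have hp1 : 0 < p - 1 := by linarith
  have hq0 : 0 < q := by linarith
  set e := q - q / p with he
  have he0 : 0 < e := by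
    have : q / p < q := div_lt_self hq0 hp
    linarith
  set I := ∫⁻ b, ψ b ^ p ∂ν with hI
  -- Weighting by x^(e+1), where e = q/p', turns the tail bound m{x > y} ≤ C y^(-e) into n{x ≤ y} =
  -- O(y): on the slice z/2 < x ≤ z the weight is at most z^(e+1) and the mass is O(z^(-e)), and the
  -- dyadic slices sum geometrically. The diagonal inequality then applies to T/x.
  let n : Measure X := m.withDensity (fun a => x a ^ (e + 1))
  have hn : ∀ y ≠ ∞, n {a | x a ≤ y} ≤ (2 ^ (e + 1) * C) * y := by
    intro y hy
    rcases eq_or_ne y 0 with rfl | hy0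
    · have : {a | x a ≤ 0} = ∅ := by
        ext a; simpa using hx0 a
      rw [this]; simp
    let z : ℕ → ℝ≥0∞ := fun i => y * 2⁻¹ ^ i
    have hz0 : ∀ i, z i ≠ 0 := fun i => mul_ne_zero hy0 (pow_ne_zero _ (by simp))
    have hzt : ∀ i, z i ≠ ∞ := fun i => ENNReal.mul_ne_top hy (ENNReal.pow_ne_top (by simp))
    have hz2 : ∀ i, z i = 2 * z (i + 1) := by
      intro i
      simp only [z, pow_succ]
      rw [mul_comm (2⁻¹ ^ i), ← mul_assoc, ← mul_assoc, mul_comm 2 y, mul_assoc y,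
        ENNReal.mul_inv_cancel two_ne_zero ENNReal.ofNat_ne_top, mul_one]
    have hcover : {a | x a ≤ y} ⊆ ⋃ i, {a | z (i + 1) < x a ∧ x a ≤ z i} := by
      intro a ha
      have ha : x a ≤ y := ha
      have hlim : Tendsto z atTop (𝓝 0) := by
        have := ENNReal.Tendsto.const_mul (a := y)
          (ENNReal.tendsto_pow_atTop_nhds_zero_of_lt_one
          (by simp : (2⁻¹ : ℝ≥0∞) < 1)) (Or.inr hy)
        simpa using this
      have hex : ∃ i, z i < x a := (hlim.eventually_lt_const (pos_iff_ne_zero.2 (hx0 a))).exists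
      classical
      have h1 := Nat.find_spec hex
      rcases hk : Nat.find hex with _ | k
      · rw [hk] at h1
        simp only [z, pow_zero, mul_one] at h1
        exact absurd ha (not_le.2 h1)
      · rw [hk] at h1
        exact mem_iUnion.2 ⟨k, h1, not_lt.1 (Nat.find_min hex (by omega))⟩
    have hslice : ∀ i, n {a | z (i + 1) < x a ∧ x a ≤ z i} ≤ 2 ^ e * C * z i := by
      intro i
      have hms : MeasurableSet {a | z (i + 1) < x a ∧ x a ≤ z i} :=
        (measurableSet_lt measurable_const hxm).inter (measurableSet_le hxm measurable_const)
      rw [withDensity_apply _ hms]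
      calc _ ≤ ∫⁻ a in {a | z (i + 1) < x a ∧ x a ≤ z i}, z i ^ (e + 1) ∂m :=
            setLIntegral_mono' hms fun a ha => ENNReal.rpow_le_rpow ha.2 (by linarith)
        _ = z i ^ (e + 1) * m {a | z (i + 1) < x a ∧ x a ≤ z i} := by
            rw [setLIntegral_const]
        _ ≤ z i ^ (e + 1) * (C * z (i + 1) ^ (-e)) := by
            gcongr
            exact (measure_mono fun a ha => ha.1).trans (hm _ (hz0 _) (hzt _))
        _ = 2 ^ e * C * z i := by
            rw [hz2 i, ENNReal.mul_rpow_of_nonneg _ _ (by linarith : 0 ≤ e + 1),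
              ENNReal.rpow_add _ _ two_ne_zero ENNReal.ofNat_ne_top, ENNReal.rpow_one,
              ENNReal.rpow_add _ _ (hz0 _) (hzt _), ENNReal.rpow_one, ENNReal.rpow_neg]
            have : z (i + 1) ^ e * (z (i + 1) ^ e)⁻¹ = 1 := ENNReal.mul_inv_cancel
              (ENNReal.rpow_pos (pos_iff_ne_zero.2 (hz0 _)) (hzt _)).ne'
              (ENNReal.rpow_ne_top_of_nonneg he0.le (hzt _))
            calc _ = 2 ^ e * C * (2 * z (i + 1)) * (z (i + 1) ^ e * (z (i + 1) ^ e)⁻¹) := by ring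
              _ = _ := by rw [this, mul_one]
    calc n {a | x a ≤ y} ≤ ∑' i, n {a | z (i + 1) < x a ∧ x a ≤ z i} :=
          (measure_mono hcover).trans (measure_iUnion_le _)
      _ ≤ ∑' i, 2 ^ e * C * z i := ENNReal.tsum_le_tsum hslice
      _ = 2 ^ (e + 1) * C * y := by
          simp only [z]
          rw [ENNReal.tsum_mul_left, ENNReal.tsum_mul_left, ENNReal.tsum_geometric,
            ENNReal.one_sub_inv_two, inv_inv,
            ENNReal.rpow_add _ _ two_ne_zero ENNReal.ofNat_ne_top, ENNReal.rpow_one]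
          ring
  have hG : ∀ a τ, T a / x a * x a ≤ ∫⁻ b in {b | τ < ψ b}, ψ b ∂ν + τ * x a := by
    intro a τ
    rw [ENNReal.div_mul_cancel (hx0 a) (hxt a)]
    exact hT a τ
  have hmain := lintegral_rpow_average_le n ν (hTm.div hxm) hψ hp hx0 hxt hn hG hfin
  have hbound : ∀ a, T a ≤ 2 * I ^ (1 / p) * x a ^ (1 - 1 / p) := by
    intro a
    rcases eq_or_ne I 0 with h0 | h0
    · have h1 : ∫⁻ b in {b | (0 : ℝ≥0∞) < ψ b}, ψ b ∂ν = 0 := by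
        rw [hI, lintegral_eq_zero_iff (by fun_prop)] at h0
        refine le_antisymm ((setLIntegral_le_lintegral _ _).trans (le_of_eq ?_)) zero_le
        rw [lintegral_eq_zero_iff hψ]
        filter_upwards [h0] with b hb
        simpa [hp0, hp0.not_gt] using hb
      have := hT a 0
      rw [h1, zero_mul, add_zero] at this
      exact this.trans zero_le
    · have hxp : x a ^ (-(1 / p)) ≠ 0 := (ENNReal.rpow_pos (pos_iff_ne_zero.2 (hx0 a)) (hxt a)).ne'
      have hxp' : x a ^ (-(1 / p)) ≠ ∞ := ENNReal.rpow_ne_top_of_ne_zero (hx0 a) (hxt a)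
      have hIp : I ^ (1 / p) ≠ 0 := (ENNReal.rpow_pos (pos_iff_ne_zero.2 h0) hfin).ne'
      have hIp' : I ^ (1 / p) ≠ ∞ := ENNReal.rpow_ne_top_of_ne_zero h0 hfin
      -- This level balances the two terms of the truncation bound and yields the Hölder bound T ≤ 2
      -- I^(1/p) x^(1/p').
      set τ := I ^ (1 / p) * x a ^ (-(1 / p)) with hτ
      have hτ0 : τ ≠ 0 := mul_ne_zero hIp hxp
      have hτt : τ ≠ ∞ := ENNReal.mul_ne_top hIp' hxp'
      have h1 := lintegral_truncation_le ν hψ hp hτ0 hτt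
      have h2 : τ ^ (1 - p) * I = I ^ (1 / p) * x a ^ (1 - 1 / p) := by
        rw [hτ, ENNReal.mul_rpow_of_ne_top hIp' hxp', ← ENNReal.rpow_mul, ← ENNReal.rpow_mul,
          mul_right_comm]
        nth_rewrite 2 [← ENNReal.rpow_one I]
        rw [← ENNReal.rpow_add _ _ h0 hfin]
        congr 2 <;> field_simp <;> ring
      have h3 : τ * x a = I ^ (1 / p) * x a ^ (1 - 1 / p) := by
        rw [hτ, mul_assoc]
        nth_rewrite 2 [← ENNReal.rpow_one (x a)]
        rw [← ENNReal.rpow_add _ _ (hx0 a) (hxt a)]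
        congr 2; ring
      refine (hT a τ).trans ?_
      rw [← hI, h2] at h1
      rw [h3, mul_assoc, two_mul]
      gcongr
  -- The pointwise bound is spent on q - p of the q factors of T. The resulting power of x is
  -- exactly the density of n, because (1 - 1/p)(q - p) + p = e + 1.
  have hpoint : ∀ a, T a ^ q ≤
      (2 ^ (q - p) * I ^ ((q - p) / p)) * (x a ^ (e + 1) * (T a / x a) ^ p) := by
    intro a
    have h1 : T a ^ q = T a ^ (q - p) * T a ^ p := by
      rw [← ENNReal.rpow_add_of_nonneg _ _ (by linarith : 0 ≤ q - p) hp0.le]; congr 1; ring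
    rw [h1]
    calc T a ^ (q - p) * T a ^ p ≤ (2 * I ^ (1 / p) * x a ^ (1 - 1 / p)) ^ (q - p) * T a ^ p := by
          gcongr ?_ * _
          exact ENNReal.rpow_le_rpow (hbound a) (sub_nonneg.2 hpq)
      _ = _ := by
          have hqp : 0 ≤ q - p := by linarith
          rw [ENNReal.mul_rpow_of_nonneg _ _ hqp, ENNReal.mul_rpow_of_nonneg _ _ hqp,
            ENNReal.div_rpow_of_nonneg _ _ hp0.le, ENNReal.div_eq_inv_mul, ← ENNReal.rpow_neg,
            ← ENNReal.rpow_mul, ← ENNReal.rpow_mul]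
          have h2 : x a ^ (e + 1) = x a ^ ((1 - 1 / p) * (q - p)) * x a ^ p := by
            rw [← ENNReal.rpow_add _ _ (hx0 a) (hxt a)]
            congr 1
            rw [he]; field_simp; ring
          have h3 : x a ^ p * x a ^ (-p) = 1 := by
            rw [← ENNReal.rpow_add _ _ (hx0 a) (hxt a)]; simp
          rw [h2, one_div_mul_eq_div]
          calc _ = 2 ^ (q - p) * I ^ ((q - p) / p) * (x a ^ ((1 - 1 / p) * (q - p)) * T a ^ p) := by
                ring
            _ = 2 ^ (q - p) * I ^ ((q - p) / p) * (x a ^ ((1 - 1 / p) * (q - p)) * T a ^ p) *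
                (x a ^ p * x a ^ (-p)) := by rw [h3, mul_one]
            _ = _ := by ring
  calc ∫⁻ a, T a ^ q ∂m ≤ ∫⁻ a, (2 ^ (q - p) * I ^ ((q - p) / p)) *
        (x a ^ (e + 1) * (T a / x a) ^ p) ∂m := lintegral_mono hpoint
    _ = (2 ^ (q - p) * I ^ ((q - p) / p)) * ∫⁻ a, (T a / x a) ^ p ∂n := by
        rw [lintegral_const_mul _ (by fun_prop), lintegral_withDensity_eq_lintegral_mul _
          (by fun_prop) (by fun_prop)]
        rfl
    _ ≤ (2 ^ (q - p) * I ^ ((q - p) / p)) * (ENNReal.ofReal (p * 2 ^ p / (p - 1)) *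
          (2 ^ (e + 1) * C) * I) := by gcongr; exact hmain
    _ = _ := by
        have : I ^ (q / p) = I ^ ((q - p) / p) * I := by
          nth_rewrite 3 [← ENNReal.rpow_one I]
          rw [← ENNReal.rpow_add_of_nonneg _ _ (div_nonneg (by linarith) hp0.le) zero_le_one]
          congr 1; field_simp; ring
        rw [this]; ring

/-- The Hardy-type inequality when the size function is only controlled on a set of full measure. -/
lemma lintegral_rpow_le_of_truncation_on {X Y : Type*} [MeasurableSpace X] [MeasurableSpace Y]
    (m : Measure X) (ν : Measure Y) [SFinite ν] {x T : X → ℝ≥0∞} {ψ : Y → ℝ≥0∞} {S : Set X}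
    (hS : MeasurableSet S) (hS0 : m Sᶜ = 0)
    (hTm : Measurable T) (hxm : Measurable x) (hψ : Measurable ψ)
    {p q : ℝ} (hp : 1 < p) (hpq : p ≤ q) {C : ℝ≥0∞} (hx0 : ∀ a ∈ S, x a ≠ 0)
    (hxt : ∀ a ∈ S, x a ≠ ∞)
    (hm : ∀ y, y ≠ 0 → y ≠ ∞ → m (S ∩ {a | y < x a}) ≤ C * y ^ (-(q - q / p)))
    (hT : ∀ a ∈ S, ∀ τ, T a ≤ ∫⁻ b in {b | τ < ψ b}, ψ b ∂ν + τ * x a)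
    (hfin : ∫⁻ b, ψ b ^ p ∂ν ≠ ∞) :
    ∫⁻ a, T a ^ q ∂m ≤ 2 ^ (q - p) * (ENNReal.ofReal (p * 2 ^ p / (p - 1)) *
      (2 ^ (q - q / p + 1) * C)) * (∫⁻ b, ψ b ^ p ∂ν) ^ (q / p) := by
  classical
  have hae : ∀ᵐ a ∂m, a ∈ S := by rw [ae_iff]; exact hS0
  have h1 : ∫⁻ a, T a ^ q ∂m = ∫⁻ a, (S.piecewise T 0) a ^ q ∂m := by
    refine lintegral_congr_ae ?_
    filter_upwards [hae] with a ha
    simp [piecewise, ha]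
  rw [h1]
  -- Off S the values x = 1 and T = 0 satisfy the pointwise hypotheses trivially, and the tail bound
  -- ignores the null complement.
  refine lintegral_rpow_le_of_truncation m ν (x := S.piecewise x 1) (hTm.piecewise hS measurable_zero)
    (hxm.piecewise hS measurable_one) hψ hp hpq ?_ ?_ ?_ ?_ hfin
  · intro a
    by_cases ha : a ∈ S
    · simpa [piecewise, ha] using hx0 a ha
    · simp [piecewise, ha]
  · intro a
    by_cases ha : a ∈ S
    · simpa [piecewise, ha] using hxt a ha
    · simp [piecewise, ha]
  · intro y hy0 hyt
    refine le_trans (measure_mono_ae ?_) (hm y hy0 hyt)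
    filter_upwards [hae] with a ha h
    refine ⟨ha, ?_⟩
    have h : y < S.piecewise x 1 a := h
    simpa [piecewise, ha] using h
  · intro a τ
    by_cases ha : a ∈ S
    · simpa [piecewise, ha] using hT a ha τ
    · simp [piecewise, ha]

/-- Where ψ ≤ τ the integral is at most τ ν(A); where ψ > τ the restriction to A is dropped. Only
the measure of A survives, so the bound is uniform over all sets of a given measure and passes to
suprema over moving windows. -/
lemma lintegral_le_truncation_add {Y : Type*} [MeasurableSpace Y] (ν : Measure Y) {ψ : Y → ℝ≥0∞}
    (hψ : Measurable ψ) (A : Set Y) (τ : ℝ≥0∞) :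
    ∫⁻ b in A, ψ b ∂ν ≤ ∫⁻ b in {b | τ < ψ b}, ψ b ∂ν + τ * ν A := by
  rw [← setLIntegral_const, ← lintegral_indicator (measurableSet_lt measurable_const hψ)]
  calc ∫⁻ b in A, ψ b ∂ν ≤ ∫⁻ b in A, ({b | τ < ψ b}.indicator ψ b + τ) ∂ν := by
        refine lintegral_mono fun b => ?_
        by_cases hb : τ < ψ b
        · simp [indicator, hb]
        · rw [indicator_of_notMem (by exact hb), zero_add]
          exact not_lt.1 hb
    _ = ∫⁻ b in A, {b | τ < ψ b}.indicator ψ b ∂ν + ∫⁻ b in A, τ ∂ν := by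
        rw [lintegral_add_right _ measurable_const]
    _ ≤ _ := by
        gcongr
        exact Measure.restrict_le_self

/-- Hölder's inequality against the constant function one. -/
lemma lintegral_le_rpow_mul_measure {Y : Type*} [MeasurableSpace Y] (ν : Measure Y) {ψ : Y → ℝ≥0∞}
    (hψ : Measurable ψ) {p : ℝ} (hp : 1 ≤ p) :
    ∫⁻ b, ψ b ∂ν ≤ (∫⁻ b, ψ b ^ p ∂ν) ^ (1 / p) * ν univ ^ (1 - 1 / p) := by
  rcases hp.eq_or_lt with rfl | hp
  · simp
  have hc := (Real.HolderConjugate.conjExponent hp)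
  have h := ENNReal.lintegral_mul_le_Lp_mul_Lq ν hc hψ.aemeasurable (aemeasurable_const (b := 1))
  simp only [Pi.mul_apply, mul_one, ENNReal.one_rpow, lintegral_const, one_mul] at h
  have h2 : 1 / p.conjExponent = 1 - 1 / p := by
    rw [one_div, one_div, ← hc.symm.one_sub_inv]
    ring
  rwa [h2] at h

/-! ### Estimates near the origin and far from it -/

/-- The largest integral of `G` over an interval of radius `r` centred in `[1, 2]`. -/
noncomputable def windowSup (G : ℝ → ℝ≥0∞) (r : ℝ) : ℝ≥0∞ :=
  ⨆ t ∈ Icc (1 : ℝ) 2, ∫⁻ s in Ioo (t - r) (t + r), G s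

/-- Monotonicity provides measurability despite the uncountable supremum over t. -/
lemma windowSup_mono (G : ℝ → ℝ≥0∞) : Monotone (windowSup G) := by
  intro r r' h
  refine iSup₂_mono fun t ht => lintegral_mono_set (Ioo_subset_Ioo ?_ ?_) <;> linarith

lemma lintegral_unweighted_le (d : ℕ) {A : Set ℝ} (hA : A ⊆ Ioi (1 / 2))
    (hAm : MeasurableSet A) (H : ℝ → ℝ≥0∞) :
    ∫⁻ s in A, H s ≤ 2 ^ (d - 1) * ∫⁻ s in Ioi (0 : ℝ), ENNReal.ofReal (s ^ (d - 1)) * H s := by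
  rw [← lintegral_const_mul' _ _ (ENNReal.pow_ne_top ENNReal.ofNat_ne_top)]
  refine (setLIntegral_mono' hAm (g := fun s => 2 ^ (d - 1) * (ENNReal.ofReal (s ^ (d - 1)) * H s))
    fun s hs => ?_).trans (lintegral_mono_set (hA.trans (Ioi_subset_Ioi (by norm_num))))
  have hs' : (1 / 2 : ℝ) < s := hA hs
  rw [← mul_assoc, ENNReal.ofReal_pow (by linarith), ← mul_pow, ← ENNReal.ofReal_ofNat,
    ← ENNReal.ofReal_mul zero_le_two]
  refine le_mul_of_one_le_left zero_le (one_le_pow₀ ?_)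
  rw [ENNReal.one_le_ofReal]
  linarith

lemma lintegral_Ioc_rpow_lt_top {e b : ℝ} (he : -1 < e) :
    ∫⁻ r in Ioc (0 : ℝ) b, ENNReal.ofReal (r ^ e) < ∞ := by
  rcases le_or_gt b 0 with hb | hb
  · simp [Ioc_eq_empty (not_lt.2 hb)]
  · exact (intervalIntegral.intervalIntegrable_rpow' he (a := 0) (b := b)).1.lintegral_lt_top

/-- The maximal function near the origin. -/
lemma exists_near_bound {d : ℕ} (hd : 1 ≤ d) {p q : ℝ} (hp : 1 ≤ p) (hpq : p ≤ q) (hq : q ≤ d * p)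
    (hne : q < d * p ∨ 1 < p) :
    ∃ C : ℝ≥0∞, C ≠ ∞ ∧ ∀ G : ℝ → ℝ≥0∞, Measurable G →
      ∫⁻ s in Ioi (0 : ℝ), ENNReal.ofReal (s ^ (d - 1)) * G s ^ p ≠ ∞ →
      ∫⁻ r in Ioc (0 : ℝ) (1 / 2), ENNReal.ofReal (r ^ (d - 1)) *
        (ENNReal.ofReal r⁻¹ * windowSup G r) ^ q ≤
      C * (∫⁻ s in Ioi (0 : ℝ), ENNReal.ofReal (s ^ (d - 1)) * G s ^ p) ^ (q / p) := by
  have hp0 : 0 < p := by linarith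
  have hq0 : 0 < q := by linarith
  have hd1 : ((d - 1 : ℕ) : ℝ) = d - 1 := by rw [Nat.cast_sub hd]; simp
  have hwin : ∀ r ∈ Ioc (0 : ℝ) (1 / 2), ∀ t ∈ Icc (1 : ℝ) 2,
      Ioo (t - r) (t + r) ⊆ Ioo (1 / 2) 3 := by
    intro r hr t ht s hs
    exact ⟨by linarith [hs.1, hr.2, ht.1], by linarith [hs.2, hr.2, ht.2]⟩
  have hw : ∀ G : ℝ → ℝ≥0∞, ∫⁻ s in Ioo (1 / 2 : ℝ) 3, G s ^ p ≤
      2 ^ (d - 1) * ∫⁻ s in Ioi (0 : ℝ), ENNReal.ofReal (s ^ (d - 1)) * G s ^ p := fun G =>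
    lintegral_unweighted_le d (fun s hs => hs.1) measurableSet_Ioo _
  have hK : ((2 : ℝ≥0∞) ^ (d - 1)) ^ (q / p) ≠ ∞ :=
    ENNReal.rpow_ne_top_of_nonneg (by positivity) (ENNReal.pow_ne_top ENNReal.ofNat_ne_top)
  by_cases hlt : q < d * p
  -- Off the line q = dp Hölder's inequality is enough: the window integral is O(r^(1 - 1/p)), which
  -- leaves the power r^(d - 1 - q/p), integrable at 0.
  · have hexp : -1 < (d : ℝ) - 1 - q / p := by
      have : q / p < d := by rwa [div_lt_iff₀ hp0]
      linarith
    have hJ := lintegral_Ioc_rpow_lt_top (b := 1 / 2) hexp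
    set J := ∫⁻ r in Ioc (0 : ℝ) (1 / 2), ENNReal.ofReal (r ^ ((d : ℝ) - 1 - q / p)) with hJd
    have h2q : (2 : ℝ≥0∞) ^ ((1 - 1 / p) * q) ≠ ∞ := by
      refine ENNReal.rpow_ne_top_of_ne_zero two_ne_zero ENNReal.ofNat_ne_top
    refine ⟨J * (2 : ℝ≥0∞) ^ ((1 - 1 / p) * q) * (2 ^ (d - 1)) ^ (q / p),
      ENNReal.mul_ne_top (ENNReal.mul_ne_top hJ.ne h2q) hK, fun G hG hfin => ?_⟩
    set I := ∫⁻ s in Ioi (0 : ℝ), ENNReal.ofReal (s ^ (d - 1)) * G s ^ p with hI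
    have hpt : ∀ r ∈ Ioc (0 : ℝ) (1 / 2), ENNReal.ofReal (r ^ (d - 1)) *
        (ENNReal.ofReal r⁻¹ * windowSup G r) ^ q ≤ ENNReal.ofReal (r ^ ((d : ℝ) - 1 - q / p)) *
          ((2 : ℝ≥0∞) ^ ((1 - 1 / p) * q) * (2 ^ (d - 1)) ^ (q / p) * I ^ (q / p)) := by
      intro r hr
      have hr0 : 0 < r := hr.1
      have h1p : 0 ≤ 1 - 1 / p := by rw [sub_nonneg, div_le_one hp0]; exact hp
      have h1 : windowSup G r ≤ (2 ^ (d - 1) * I) ^ (1 / p) * ENNReal.ofReal (2 * r) ^ (1 - 1 / p) := by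
        refine iSup₂_le fun t ht => ?_
        refine (lintegral_le_rpow_mul_measure _ hG hp).trans ?_
        rw [Measure.restrict_apply_univ, Real.volume_Ioo]
        have : t + r - (t - r) = 2 * r := by ring
        rw [this]
        gcongr
        exact (lintegral_mono_set (hwin r hr t ht)).trans (hw G)
      calc _ ≤ ENNReal.ofReal (r ^ (d - 1)) * (ENNReal.ofReal r⁻¹ *
            ((2 ^ (d - 1) * I) ^ (1 / p) * ENNReal.ofReal (2 * r) ^ (1 - 1 / p))) ^ q := by gcongr
        _ = ENNReal.ofReal (r ^ (d - 1)) * (ENNReal.ofReal r⁻¹ ^ q *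
            ((2 ^ (d - 1)) ^ (q / p) * I ^ (q / p) *
              (2 ^ ((1 - 1 / p) * q) * ENNReal.ofReal r ^ ((1 - 1 / p) * q)))) := by
            rw [ENNReal.mul_rpow_of_nonneg _ _ hq0.le, ENNReal.mul_rpow_of_nonneg _ _ hq0.le,
              ← ENNReal.rpow_mul, ← ENNReal.rpow_mul, one_div_mul_eq_div,
              ENNReal.mul_rpow_of_nonneg _ _ (by positivity), ENNReal.ofReal_mul zero_le_two,
              ENNReal.ofReal_ofNat, ENNReal.mul_rpow_of_nonneg _ _ (by positivity)]
        _ = (ENNReal.ofReal (r ^ (d - 1)) * ENNReal.ofReal r⁻¹ ^ q *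
              ENNReal.ofReal r ^ ((1 - 1 / p) * q)) *
            ((2 : ℝ≥0∞) ^ ((1 - 1 / p) * q) * (2 ^ (d - 1)) ^ (q / p) * I ^ (q / p)) := by ring
        _ = _ := by
            congr 1
            rw [ENNReal.ofReal_rpow_of_pos (by positivity), ENNReal.ofReal_rpow_of_pos hr0,
              ← ENNReal.ofReal_mul (by positivity), ← ENNReal.ofReal_mul (by positivity),
              ← Real.rpow_natCast, Real.inv_rpow hr0.le, ← Real.rpow_neg hr0.le,
              ← Real.rpow_add hr0, ← Real.rpow_add hr0, hd1]
            congr 2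
            field_simp
            ring
    refine (setLIntegral_mono' measurableSet_Ioc hpt).trans (le_of_eq ?_)
    rw [lintegral_mul_const _ (by fun_prop), ← hJd]
    ring
  -- On the line q = dp that power is r^(-1), and Hölder fails by a logarithm. The Hardy inequality
  -- takes over, with x = 2r (the window length) and the measure r^(d-1-q) dr; the tail is
  -- O(y^(d-q)), the required exponent since q/p = d.
  · have hp1 : 1 < p := hne.resolve_left hlt
    have hqe : q = d * p := le_antisymm hq (not_lt.1 hlt)
    have hqp : q / p = d := by rw [hqe]; field_simp
    have hdpos : (0 : ℝ) < d := by exact_mod_cast hd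
    have hqd : 0 < q - d := by
      rw [hqe]; nlinarith
    let m : Measure ℝ := (volume.restrict (Ioc 0 (1 / 2))).withDensity
      (fun r => ENNReal.ofReal (r ^ ((d : ℝ) - 1 - q)))
    let C₀ : ℝ≥0∞ := ENNReal.ofReal ((2 : ℝ) ^ (q - d) / (q - d))
    refine ⟨2 ^ (q - p) * (ENNReal.ofReal (p * 2 ^ p / (p - 1)) *
      (2 ^ (q - q / p + 1) * C₀)) * (2 ^ (d - 1)) ^ (q / p), ?_, fun G hG hfin => ?_⟩
    · refine ENNReal.mul_ne_top (ENNReal.mul_ne_top ?_ (ENNReal.mul_ne_top ENNReal.ofReal_ne_top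
        (ENNReal.mul_ne_top ?_ ENNReal.ofReal_ne_top))) hK
      · exact ENNReal.rpow_ne_top_of_ne_zero two_ne_zero ENNReal.ofNat_ne_top
      · exact ENNReal.rpow_ne_top_of_ne_zero two_ne_zero ENNReal.ofNat_ne_top
    set I := ∫⁻ s in Ioi (0 : ℝ), ENNReal.ofReal (s ^ (d - 1)) * G s ^ p with hI
    have hΦm : Measurable (windowSup G) := (windowSup_mono G).measurable
    have hmeq : ∫⁻ r in Ioc (0 : ℝ) (1 / 2), ENNReal.ofReal (r ^ (d - 1)) *
        (ENNReal.ofReal r⁻¹ * windowSup G r) ^ q = ∫⁻ r, windowSup G r ^ q ∂m := by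
      rw [lintegral_withDensity_eq_lintegral_mul _ (by fun_prop) (by fun_prop)]
      refine setLIntegral_congr_fun measurableSet_Ioc fun r hr => ?_
      have hr0 : 0 < r := hr.1
      rw [ENNReal.mul_rpow_of_nonneg _ _ hq0.le, ← mul_assoc, Pi.mul_apply]
      congr 1
      rw [ENNReal.ofReal_rpow_of_pos (by positivity), ← ENNReal.ofReal_mul (by positivity),
        ← Real.rpow_natCast, Real.inv_rpow hr0.le, ← Real.rpow_neg hr0.le, ← Real.rpow_add hr0, hd1]
      congr 1
    rw [hmeq]
    have hbase : ∫⁻ s in Ioo (1 / 2 : ℝ) 3, G s ^ p ≠ ∞ :=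
      ((hw G).trans_lt (ENNReal.mul_lt_top (ENNReal.pow_lt_top ENNReal.ofNat_lt_top)
        hfin.lt_top)).ne
    have := lintegral_rpow_le_of_truncation_on m (volume.restrict (Ioo (1 / 2 : ℝ) 3))
      (x := fun r => ENNReal.ofReal (2 * r)) (T := windowSup G) (ψ := G) (S := Ioc 0 (1 / 2))
      (C := C₀) measurableSet_Ioc ?_ hΦm (by fun_prop) hG hp1 hpq ?_ ?_ ?_ ?_ hbase
    · refine this.trans ?_
      rw [mul_assoc _ ((2 ^ (d - 1)) ^ (q / p) : ℝ≥0∞), ← ENNReal.mul_rpow_of_nonneg _ _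
        (by positivity)]
      gcongr
      exact hw G
    · rw [withDensity_apply _ measurableSet_Ioc.compl, Measure.restrict_restrict
        measurableSet_Ioc.compl, compl_inter_self]
      simp
    · intro r hr
      simpa using hr.1
    · intro r hr
      exact ENNReal.ofReal_ne_top
    · intro y hy0 hyt
      lift y to ℝ≥0 using hyt
      have hy : (0 : ℝ) < y := by
        have : y ≠ 0 := by simpa using hy0
        exact_mod_cast pos_iff_ne_zero.2 this
      have hset : MeasurableSet (Ioc (0 : ℝ) (1 / 2) ∩ {r | (y : ℝ≥0∞) < ENNReal.ofReal (2 * r)}) :=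
        measurableSet_Ioc.inter (measurableSet_lt measurable_const (by fun_prop))
      have hsub : Ioc (0 : ℝ) (1 / 2) ∩ {r | (y : ℝ≥0∞) < ENNReal.ofReal (2 * r)} ⊆
          Ioi ((y : ℝ) / 2) := by
        rintro r ⟨hr, hr'⟩
        have hr' : (y : ℝ≥0∞) < ENNReal.ofReal (2 * r) := hr'
        rw [← ENNReal.ofReal_coe_nnreal, ENNReal.ofReal_lt_ofReal_iff'] at hr'
        rw [mem_Ioi]
        linarith [hr'.1]
      have hexp : (d : ℝ) - 1 - q < -1 := by linarith
      rw [withDensity_apply _ hset, Measure.restrict_restrict hset]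
      calc _ ≤ ∫⁻ r in Ioi ((y : ℝ) / 2), ENNReal.ofReal (r ^ ((d : ℝ) - 1 - q)) :=
            lintegral_mono_set (inter_subset_left.trans hsub)
        _ = ENNReal.ofReal (∫ r in Ioi ((y : ℝ) / 2), r ^ ((d : ℝ) - 1 - q)) := by
            rw [ofReal_integral_eq_lintegral_ofReal]
            · exact integrableOn_Ioi_rpow_of_lt hexp (by positivity)
            · filter_upwards [ae_restrict_mem measurableSet_Ioi] with r hr
              exact Real.rpow_nonneg ((half_pos hy).le.trans (le_of_lt hr)) _
        _ = C₀ * (y : ℝ≥0∞) ^ (-(q - q / p)) := by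
            rw [integral_Ioi_rpow_of_lt hexp (by positivity), hqp, ← ENNReal.ofReal_coe_nnreal,
              ENNReal.ofReal_rpow_of_pos hy, ← ENNReal.ofReal_mul (by positivity)]
            congr 1
            have : (d : ℝ) - 1 - q + 1 = -(q - d) := by ring
            rw [this, Real.div_rpow hy.le zero_le_two, Real.rpow_neg zero_le_two]
            field_simp
        _ ≤ _ := le_rfl
    · intro r hr τ
      refine iSup₂_le fun t ht => ?_
      have h1 := lintegral_le_truncation_add (volume.restrict (Ioo (1 / 2 : ℝ) 3)) hG
        (Ioo (t - r) (t + r)) τ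
      rw [Measure.restrict_restrict measurableSet_Ioo, inter_eq_left.2 (hwin r hr t ht),
        Measure.restrict_apply measurableSet_Ioo, inter_eq_left.2 (hwin r hr t ht),
        Real.volume_Ioo] at h1
      refine h1.trans (le_of_eq ?_)
      congr 3
      ring

/-- The maximal function far from the origin. -/
lemma exists_far_bound (d : ℕ) {p q : ℝ} (hp : 1 ≤ p) (hpq : p ≤ q) :
    ∃ C : ℝ≥0∞, C ≠ ∞ ∧ ∀ G : ℝ → ℝ≥0∞, Measurable G →
      ∫⁻ r in Ioi (4 : ℝ), ENNReal.ofReal (r ^ (d - 1)) *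
        (∫⁻ s in Ioo (r - 2) (r + 2), G s) ^ q ≤
      C * (∫⁻ s in Ioi (0 : ℝ), ENNReal.ofReal (s ^ (d - 1)) * G s ^ p) ^ (q / p) := by
  have hp0 : 0 < p := by linarith
  have hq0 : 0 < q := by linarith
  have hqp : 0 ≤ q / p - 1 := by
    rw [sub_nonneg, one_le_div hp0]; exact hpq
  have h1p : 0 ≤ 1 - 1 / p := by rw [sub_nonneg, div_le_one hp0]; exact hp
  let K : ℝ≥0∞ := (4 : ℝ≥0∞) ^ ((1 - 1 / p) * q) * (2 ^ (d - 1)) ^ (q / p - 1)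
  have h2 : (2 : ℝ≥0∞) ^ (d - 1) ≠ ∞ := ENNReal.pow_ne_top ENNReal.ofNat_ne_top
  have hK : K ≠ ∞ := ENNReal.mul_ne_top
    (ENNReal.rpow_ne_top_of_ne_zero (by simp) ENNReal.ofNat_ne_top)
    (ENNReal.rpow_ne_top_of_nonneg hqp h2)
  refine ⟨K * (4 * 2 ^ (d - 1)), ENNReal.mul_ne_top hK (ENNReal.mul_ne_top ENNReal.ofNat_ne_top h2),
    fun G hG => ?_⟩
  set I := ∫⁻ s in Ioi (0 : ℝ), ENNReal.ofReal (s ^ (d - 1)) * G s ^ p with hI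
  -- One factor of the local integral w is kept for Fubini, and the remaining power q/p - 1 is
  -- bounded by the global norm; this uses p ≤ q.
  have hwin : ∀ r ∈ Ioi (4 : ℝ), (∫⁻ s in Ioo (r - 2) (r + 2), G s) ^ q ≤
      K * I ^ (q / p - 1) * ∫⁻ s in Ioo (r - 2) (r + 2), G s ^ p := by
    intro r hr
    have hr : (4 : ℝ) < r := hr
    set w := ∫⁻ s in Ioo (r - 2) (r + 2), G s ^ p with hw
    have hwI : w ≤ 2 ^ (d - 1) * I := lintegral_unweighted_le d
      (fun s hs => by rw [mem_Ioi]; linarith [hs.1]) measurableSet_Ioo _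
    have h1 := lintegral_le_rpow_mul_measure (volume.restrict (Ioo (r - 2) (r + 2))) hG hp
    rw [Measure.restrict_apply_univ, Real.volume_Ioo, (by ring : r + 2 - (r - 2) = 4), ← hw,
      ENNReal.ofReal_ofNat] at h1
    calc _ ≤ (w ^ (1 / p) * 4 ^ (1 - 1 / p)) ^ q := by gcongr
      _ = 4 ^ ((1 - 1 / p) * q) * (w ^ (q / p - 1) * w) := by
          rw [ENNReal.mul_rpow_of_nonneg _ _ hq0.le, ← ENNReal.rpow_mul, ← ENNReal.rpow_mul,
            one_div_mul_eq_div, mul_comm]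
          congr 1
          nth_rewrite 3 [← ENNReal.rpow_one w]
          rw [← ENNReal.rpow_add_of_nonneg _ _ hqp zero_le_one, sub_add_cancel]
      _ ≤ 4 ^ ((1 - 1 / p) * q) * ((2 ^ (d - 1) * I) ^ (q / p - 1) * w) := by gcongr
      _ = _ := by
          rw [ENNReal.mul_rpow_of_nonneg _ _ hqp]
          simp only [K]
          ring
  have hS : MeasurableSet {z : ℝ × ℝ | z.2 ∈ Ioo (z.1 - 2) (z.1 + 2)} := by
    have h1 : MeasurableSet {z : ℝ × ℝ | z.1 - 2 < z.2} :=
      measurableSet_lt (by fun_prop) (by fun_prop)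
    have h2 : MeasurableSet {z : ℝ × ℝ | z.2 < z.1 + 2} :=
      measurableSet_lt (by fun_prop) (by fun_prop)
    exact h1.inter h2
  have hmeas : Measurable (Function.uncurry fun (r s : ℝ) =>
      {z : ℝ × ℝ | z.2 ∈ Ioo (z.1 - 2) (z.1 + 2)}.indicator
        (fun z => ENNReal.ofReal (z.1 ^ (d - 1)) * G z.2 ^ p) (r, s)) :=
    Measurable.indicator (by fun_prop) hS
  -- For r > 4 and |r - s| < 2 one has r < 2s, so the weight r^(d-1) can be moved onto s at the cost
  -- of 2^(d-1).
  have hfub : ∫⁻ r in Ioi (4 : ℝ), ENNReal.ofReal (r ^ (d - 1)) *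
      ∫⁻ s in Ioo (r - 2) (r + 2), G s ^ p ≤ 4 * 2 ^ (d - 1) * I := by
    have hin : ∀ r : ℝ, ENNReal.ofReal (r ^ (d - 1)) * ∫⁻ s in Ioo (r - 2) (r + 2), G s ^ p =
        ∫⁻ s, {z : ℝ × ℝ | z.2 ∈ Ioo (z.1 - 2) (z.1 + 2)}.indicator
        (fun z => ENNReal.ofReal (z.1 ^ (d - 1)) * G z.2 ^ p) (r, s) := by
      intro r
      rw [← lintegral_const_mul' _ _ ENNReal.ofReal_ne_top, ← lintegral_indicator measurableSet_Ioo]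
      rfl
    simp_rw [hin]
    rw [lintegral_lintegral_swap hmeas.aemeasurable, hI,
      ← lintegral_const_mul' _ _ (ENNReal.mul_ne_top ENNReal.ofNat_ne_top h2),
      ← lintegral_indicator measurableSet_Ioi]
    refine lintegral_mono fun s => ?_
    rw [← lintegral_indicator measurableSet_Ioi]
    by_cases hs : s ∈ Ioi (0 : ℝ)
    · have hs0 : (0 : ℝ) < s := hs
      rw [indicator_of_mem hs]
      calc _ ≤ ∫⁻ r, (Ioo (s - 2) (s + 2)).indicator
            (fun _ => ENNReal.ofReal ((2 * s) ^ (d - 1)) * G s ^ p) r := by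
            refine lintegral_mono fun r => ?_
            by_cases hr : r ∈ Ioi (4 : ℝ) ∧ s ∈ Ioo (r - 2) (r + 2)
            · have hr4 : (4 : ℝ) < r := hr.1
              have hr' : r ∈ Ioo (s - 2) (s + 2) :=
                ⟨by linarith [hr.2.2], by linarith [hr.2.1]⟩
              rw [indicator_of_mem hr.1, indicator_of_mem (by exact hr.2), indicator_of_mem hr']
              gcongr
              linarith [hr.2.1]
            · by_cases h4 : r ∈ Ioi (4 : ℝ)
              · rw [indicator_of_mem h4, indicator_of_notMem (show (r, s) ∉
                  {z : ℝ × ℝ | z.2 ∈ Ioo (z.1 - 2) (z.1 + 2)} from fun h => hr ⟨h4, h⟩)]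
                exact zero_le
              · rw [indicator_of_notMem h4]
                exact zero_le
        _ = _ := by
            rw [lintegral_indicator measurableSet_Ioo, setLIntegral_const, Real.volume_Ioo,
              (by ring : s + 2 - (s - 2) = 4), mul_pow, ENNReal.ofReal_mul (by positivity),
              ENNReal.ofReal_pow zero_le_two, ENNReal.ofReal_ofNat, ENNReal.ofReal_ofNat]
            ring
    · rw [indicator_of_notMem hs]
      refine le_of_eq ((lintegral_eq_zero_iff' ?_).2 ?_)
      · refine (Measurable.indicator ?_ measurableSet_Ioi).aemeasurable
        exact hmeas.comp (measurable_id.prodMk measurable_const)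
      · refine Eventually.of_forall fun r => ?_
        by_cases h4 : r ∈ Ioi (4 : ℝ)
        · rw [indicator_of_mem h4, indicator_of_notMem]
          · rfl
          · intro h
            have h4' : (4 : ℝ) < r := h4
            have h5 : r - 2 < s := h.1
            exact hs (by rw [mem_Ioi]; linarith)
        · rw [indicator_of_notMem h4]; rfl
  have hwm : Measurable fun r : ℝ => ENNReal.ofReal (r ^ (d - 1)) *
      ∫⁻ s in Ioo (r - 2) (r + 2), G s ^ p := by
    have : (fun r : ℝ => ENNReal.ofReal (r ^ (d - 1)) * ∫⁻ s in Ioo (r - 2) (r + 2), G s ^ p) =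
        fun r => ∫⁻ s, {z : ℝ × ℝ | z.2 ∈ Ioo (z.1 - 2) (z.1 + 2)}.indicator
        (fun z => ENNReal.ofReal (z.1 ^ (d - 1)) * G z.2 ^ p) (r, s) := by
      funext r
      rw [← lintegral_const_mul' _ _ ENNReal.ofReal_ne_top, ← lintegral_indicator measurableSet_Ioo]
      rfl
    rw [this]
    exact hmeas.lintegral_prod_right'
  calc _ ≤ ∫⁻ r in Ioi (4 : ℝ), K * I ^ (q / p - 1) * (ENNReal.ofReal (r ^ (d - 1)) *
        ∫⁻ s in Ioo (r - 2) (r + 2), G s ^ p) := by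
        refine setLIntegral_mono' measurableSet_Ioi fun r hr => ?_
        rw [mul_left_comm]
        gcongr
        exact hwin r hr
    _ = K * I ^ (q / p - 1) * ∫⁻ r in Ioi (4 : ℝ), (ENNReal.ofReal (r ^ (d - 1)) *
        ∫⁻ s in Ioo (r - 2) (r + 2), G s ^ p) := lintegral_const_mul _ hwm
    _ ≤ K * I ^ (q / p - 1) * (4 * 2 ^ (d - 1) * I) := by gcongr
    _ = K * (4 * 2 ^ (d - 1)) * (I ^ (q / p - 1) * I) := by ring
    _ = _ := by
        congr 1
        nth_rewrite 2 [← ENNReal.rpow_one I]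
        rw [← ENNReal.rpow_add_of_nonneg _ _ hqp zero_le_one, sub_add_cancel]

/-! ### The Hardy operator at unit distance from the origin -/

/-- The `L^p → L^q` estimate for the part of the maximal function at unit distance from the
origin. -/
def MidBound (d : ℕ) (E : Set ℝ) (p q : ℝ) : Prop :=
  ∃ C : ℝ≥0∞, C ≠ ∞ ∧ ∀ G : ℝ → ℝ≥0∞, Measurable G →
    ∫⁻ s in Ioi (0 : ℝ), ENNReal.ofReal (s ^ (d - 1)) * G s ^ p ≠ ∞ →
    ∫⁻ r in Icc (1 / 2 : ℝ) 4,
      (∫⁻ s in Ioo (Metric.infDist r E) 6, ENNReal.ofReal (s ^ (d - 2)) * G s) ^ q ≤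
    C * (∫⁻ s in Ioi (0 : ℝ), ENNReal.ofReal (s ^ (d - 1)) * G s ^ p) ^ (q / p)

/-- The measure `s ^ (d - 1 - γ) ds` on `(0, 6)`. -/
noncomputable def powMeasure (d : ℕ) (γ : ℝ) : Measure ℝ :=
  (volume.restrict (Ioo (0 : ℝ) 6)).withDensity (fun s => ENNReal.ofReal (s ^ ((d : ℝ) - 1 - γ)))

instance (d : ℕ) (γ : ℝ) : SFinite (powMeasure d γ) := by
  unfold powMeasure; infer_instance

lemma powMeasure_apply (d : ℕ) (γ : ℝ) {A : Set ℝ} (hA : MeasurableSet A) (hA6 : A ⊆ Ioo 0 6) :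
    powMeasure d γ A = ∫⁻ s in A, ENNReal.ofReal (s ^ ((d : ℝ) - 1 - γ)) := by
  rw [powMeasure, withDensity_apply _ hA, Measure.restrict_restrict hA, inter_eq_left.2 hA6]

/-- The substitution ψ = s^(γ-1) G turns the weight s^(d-2) into the measure s^(d-1-γ) ds, for every
γ. -/
lemma setLIntegral_powMeasure {d : ℕ} (hd : 2 ≤ d) (γ : ℝ) {G : ℝ → ℝ≥0∞} (hG : Measurable G)
    {A : Set ℝ} (hA : MeasurableSet A) (hA6 : A ⊆ Ioo 0 6) :
    ∫⁻ s in A, ENNReal.ofReal (s ^ (γ - 1)) * G s ∂(powMeasure d γ) =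
      ∫⁻ s in A, ENNReal.ofReal (s ^ (d - 2)) * G s := by
  rw [powMeasure, restrict_withDensity hA, Measure.restrict_restrict hA, inter_eq_left.2 hA6,
    lintegral_withDensity_eq_lintegral_mul _ (by fun_prop) (by fun_prop)]
  refine setLIntegral_congr_fun hA fun s hs => ?_
  have hs0 : 0 < s := (hA6 hs).1
  rw [Pi.mul_apply, ← mul_assoc, ← ENNReal.ofReal_mul (by positivity), ← Real.rpow_add hs0,
    ← Real.rpow_natCast, Nat.cast_sub hd]
  congr 3
  push_cast
  ring

/-- The choice γ = p' is the one that preserves the norm: the exponent (γ - 1)p + d - 1 - γ equals d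
- 1 exactly when (γ - 1)(p - 1) = 1. -/
lemma lintegral_rpow_powMeasure_le {d : ℕ} (hd : 1 ≤ d) {p γ : ℝ} (hp : 1 < p)
    (hγ : (γ - 1) * (p - 1) = 1) {G : ℝ → ℝ≥0∞} (hG : Measurable G) :
    ∫⁻ s, (ENNReal.ofReal (s ^ (γ - 1)) * G s) ^ p ∂(powMeasure d γ) ≤
      ∫⁻ s in Ioi (0 : ℝ), ENNReal.ofReal (s ^ (d - 1)) * G s ^ p := by
  rw [powMeasure, lintegral_withDensity_eq_lintegral_mul _ (by fun_prop) (by fun_prop)]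
  refine le_trans (le_of_eq (setLIntegral_congr_fun (g := fun s =>
    ENNReal.ofReal (s ^ (d - 1)) * G s ^ p) measurableSet_Ioo fun s hs => ?_))
    (lintegral_mono_set fun s hs => hs.1)
  have hs0 : 0 < s := hs.1
  rw [Pi.mul_apply, ENNReal.mul_rpow_of_nonneg _ _ (by linarith), ← mul_assoc,
    ENNReal.ofReal_rpow_of_pos (by positivity), ← ENNReal.ofReal_mul (by positivity),
    ← Real.rpow_mul hs0.le, ← Real.rpow_add hs0]
  simp only
  rw [← Real.rpow_natCast, Nat.cast_sub hd]
  congr 3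
  push_cast
  linear_combination hγ

/-- For γ < d, that is p > d/(d-1), the measure ν is finite, and Hölder's inequality bounds the
operator uniformly in r. The set E plays no role. -/
lemma midBound_of_integrable_weight {d : ℕ} (hd : 2 ≤ d) (E : Set ℝ) {p q γ : ℝ} (hp : 1 < p)
    (hq : 0 < q) (hγ : (γ - 1) * (p - 1) = 1) (hγd : γ < d) : MidBound d E p q := by
  have hfin : powMeasure d γ univ ≠ ∞ := by
    rw [powMeasure, withDensity_apply _ MeasurableSet.univ, Measure.restrict_univ]
    refine ((lintegral_mono_set Ioo_subset_Ioc_self).trans_lt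
      (lintegral_Ioc_rpow_lt_top (by linarith))).ne
  have hp0 : 0 < p := by linarith
  have h1p : 0 ≤ 1 - 1 / p := by rw [sub_nonneg, div_le_one hp0]; exact hp.le
  set K := (powMeasure d γ univ ^ (1 - 1 / p)) ^ q with hK
  have hKt : K ≠ ∞ := ENNReal.rpow_ne_top_of_nonneg hq.le (ENNReal.rpow_ne_top_of_nonneg h1p hfin)
  refine ⟨K * volume (Icc (1 / 2 : ℝ) 4), ENNReal.mul_ne_top hKt (by simp), fun G hG _ => ?_⟩
  set I := ∫⁻ s in Ioi (0 : ℝ), ENNReal.ofReal (s ^ (d - 1)) * G s ^ p with hI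
  calc _ ≤ ∫⁻ r in Icc (1 / 2 : ℝ) 4, K * I ^ (q / p) := by
        refine lintegral_mono fun r => ?_
        have h1 := setLIntegral_powMeasure hd γ hG (A := Ioo (Metric.infDist r E) 6)
          measurableSet_Ioo (Ioo_subset_Ioo_left Metric.infDist_nonneg)
        rw [← h1]
        have h2 := (setLIntegral_le_lintegral (μ := powMeasure d γ) (Ioo (Metric.infDist r E) 6)
          (fun s => ENNReal.ofReal (s ^ (γ - 1)) * G s)).trans
          (lintegral_le_rpow_mul_measure (powMeasure d γ) (by fun_prop) hp.le)
        calc _ ≤ (I ^ (1 / p) * powMeasure d γ univ ^ (1 - 1 / p)) ^ q := by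
              refine ENNReal.rpow_le_rpow (h2.trans ?_) hq.le
              gcongr
              exact lintegral_rpow_powMeasure_le (by omega) hp hγ hG
          _ = _ := by
              rw [ENNReal.mul_rpow_of_nonneg _ _ hq.le, ← ENNReal.rpow_mul, one_div_mul_eq_div,
                mul_comm]
    _ = _ := by
        rw [setLIntegral_const]; ring

/-- The Hardy inequality with x(r) = ν(dist(r, E), 6). This quantity may be infinite where dist(r,
E) = 0, so those r are required to form a null set; elsewhere it is finite, and it is positive
because dist(r, E) ≤ 3 < 6. -/
lemma midBound_of_tail {d : ℕ} (hd : 2 ≤ d) {E : Set ℝ} (hE : E ⊆ Icc 1 2) (hne : E.Nonempty)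
    {p q γ : ℝ} (hp : 1 < p)
    (hpq : p ≤ q) (hγ : (γ - 1) * (p - 1) = 1) {C : ℝ≥0∞} (hC : C ≠ ∞)
    (hnull : volume (Icc (1 / 2 : ℝ) 4 ∩ {r | Metric.infDist r E = 0}) = 0)
    (htail : ∀ y : ℝ, 0 < y → volume (Icc (1 / 2 : ℝ) 4 ∩ {r | 0 < Metric.infDist r E ∧
      ENNReal.ofReal y < powMeasure d γ (Ioo (Metric.infDist r E) 6)}) ≤
        C * ENNReal.ofReal (y ^ (-(q - q / p)))) :
    MidBound d E p q := by
  have hp0 : 0 < p := by linarith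
  have h2t : ∀ a : ℝ, (2 : ℝ≥0∞) ^ a ≠ ∞ := fun a =>
    ENNReal.rpow_ne_top_of_ne_zero two_ne_zero ENNReal.ofNat_ne_top
  refine ⟨2 ^ (q - p) * (ENNReal.ofReal (p * 2 ^ p / (p - 1)) * (2 ^ (q - q / p + 1) * C)),
    ENNReal.mul_ne_top (h2t _) (ENNReal.mul_ne_top ENNReal.ofReal_ne_top
      (ENNReal.mul_ne_top (h2t _) hC)), fun G hG hfin => ?_⟩
  set I := ∫⁻ s in Ioi (0 : ℝ), ENNReal.ofReal (s ^ (d - 1)) * G s ^ p with hI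
  have hI' := lintegral_rpow_powMeasure_le (by omega : 1 ≤ d) hp hγ hG
  have hDm : Measurable fun r : ℝ => Metric.infDist r E := (Metric.continuous_infDist_pt E).measurable
  have hTm : Measurable fun r : ℝ => ∫⁻ s in Ioo (Metric.infDist r E) 6,
      ENNReal.ofReal (s ^ (d - 2)) * G s := by
    have : Antitone fun ρ : ℝ => ∫⁻ s in Ioo ρ 6, ENNReal.ofReal (s ^ (d - 2)) * G s :=
      fun a b hab => lintegral_mono_set (Ioo_subset_Ioo_left hab)
    exact this.measurable.comp hDm
  have hxm : Measurable fun r : ℝ => powMeasure d γ (Ioo (Metric.infDist r E) 6) := by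
    have : Antitone fun ρ : ℝ => powMeasure d γ (Ioo ρ 6) :=
      fun a b hab => measure_mono (Ioo_subset_Ioo_left hab)
    exact this.measurable.comp hDm
  have hS : MeasurableSet (Icc (1 / 2 : ℝ) 4 ∩ {r | 0 < Metric.infDist r E}) :=
    measurableSet_Icc.inter (measurableSet_lt measurable_const hDm)
  have hD3 : ∀ r ∈ Icc (1 / 2 : ℝ) 4, Metric.infDist r E ≤ 3 := by
    intro r hr
    obtain ⟨t, ht⟩ := hne
    refine (Metric.infDist_le_dist_of_mem ht).trans ?_
    have := hE ht
    rw [Real.dist_eq, abs_le]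
    constructor <;> linarith [hr.1, hr.2, this.1, this.2]
  have key := lintegral_rpow_le_of_truncation_on (volume.restrict (Icc (1 / 2 : ℝ) 4))
    (powMeasure d γ) (S := Icc (1 / 2 : ℝ) 4 ∩ {r | 0 < Metric.infDist r E})
    (x := fun r => powMeasure d γ (Ioo (Metric.infDist r E) 6))
    (T := fun r => ∫⁻ s in Ioo (Metric.infDist r E) 6, ENNReal.ofReal (s ^ (d - 2)) * G s)
    (ψ := fun s => ENNReal.ofReal (s ^ (γ - 1)) * G s) (C := C)
    hS ?_ hTm hxm (by fun_prop) hp hpq ?_ ?_ ?_ ?_ (hI'.trans_lt hfin.lt_top).ne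
  · refine key.trans ?_
    gcongr
    exact div_nonneg (by linarith) hp0.le
  · rw [Measure.restrict_apply hS.compl]
    refine measure_mono_null ?_ hnull
    rintro r ⟨h1, h2⟩
    refine ⟨h2, ?_⟩
    by_contra h0
    exact h1 ⟨h2, lt_of_le_of_ne Metric.infDist_nonneg (Ne.symm h0)⟩
  · rintro r ⟨hr, hr0⟩
    have h3 := hD3 r hr
    rw [powMeasure_apply _ _ measurableSet_Ioo (Ioo_subset_Ioo_left Metric.infDist_nonneg)]
    rw [Ne, setLIntegral_eq_zero_iff measurableSet_Ioo (by fun_prop)]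
    intro h0
    have h4 : volume (Ioo (Metric.infDist r E) 6) = 0 := by
      refine measure_mono_null ?_ (ae_iff.1 h0)
      intro s hs h
      have hs0 : 0 < s := lt_of_le_of_lt Metric.infDist_nonneg hs.1
      have := h hs
      rw [ENNReal.ofReal_eq_zero] at this
      exact absurd this (not_le.2 (by positivity))
    rw [Real.volume_Ioo, ENNReal.ofReal_eq_zero] at h4
    linarith
  · rintro r ⟨hr, hr0⟩
    have hr0 : 0 < Metric.infDist r E := hr0
    rw [powMeasure_apply _ _ measurableSet_Ioo (Ioo_subset_Ioo_left Metric.infDist_nonneg)]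
    have hc : ContinuousOn (fun s : ℝ => s ^ ((d : ℝ) - 1 - γ)) (Icc (Metric.infDist r E) 6) :=
      fun s hs => (Real.continuousAt_rpow_const _ _
        (Or.inl (lt_of_lt_of_le hr0 hs.1).ne')).continuousWithinAt
    exact (hc.integrableOn_Icc.mono_set Ioo_subset_Icc_self).lintegral_lt_top.ne
  · intro y hy0 hyt
    lift y to ℝ≥0 using hyt
    have hy : (0 : ℝ) < y := by
      have : y ≠ 0 := by simpa using hy0
      exact_mod_cast pos_iff_ne_zero.2 this
    have h1 := htail y hy
    rw [← ENNReal.ofReal_rpow_of_pos hy, ENNReal.ofReal_coe_nnreal] at h1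
    refine le_trans (measure_mono ?_) ((Measure.restrict_apply_le _ _).trans h1)
    rintro r ⟨⟨h1, h2⟩, h3⟩
    exact ⟨h1, h2, h3⟩
  · rintro r ⟨hr, hr0⟩ τ
    rw [← setLIntegral_powMeasure hd γ hG measurableSet_Ioo
      (Ioo_subset_Ioo_left Metric.infDist_nonneg)]
    exact lintegral_le_truncation_add _ (by fun_prop) _ _

lemma volume_inter_infDist_eq_zero_le (E : Set ℝ) {ρ : ℝ} (hρ : 0 < ρ) :
    volume (Icc (1 / 2 : ℝ) 4 ∩ {r | Metric.infDist r E = 0}) ≤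
      volume (Icc (1 / 2 : ℝ) 4 ∩ {r | Metric.infDist r E < ρ}) := by
  refine measure_mono (inter_subset_inter_right _ fun r hr => ?_)
  have hr : Metric.infDist r E = 0 := hr
  rw [mem_ofPred_eq, hr]
  exact hρ

lemma volume_inter_le (A : Set ℝ) : volume (Icc (1 / 2 : ℝ) 4 ∩ A) ≤ ENNReal.ofReal 4 := by
  refine (measure_mono inter_subset_left).trans ?_
  rw [Real.volume_Icc]
  exact ENNReal.ofReal_le_ofReal (by norm_num)

/-- Power-type neighbourhood bounds give the estimate at unit distance. -/
lemma midBound_of_pow {d : ℕ} (hd : 2 ≤ d) {E : Set ℝ} (hE : E ⊆ Icc 1 2) (hne : E.Nonempty)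
    {p q : ℝ} (hp : 1 < p) (hpq : p ≤ q) (hκ : 0 < q * (d / p - (d - 1)))
    {C : ℝ} (hC : 0 ≤ C)
    (hM : ∀ ρ : ℝ, 0 < ρ → volume (Icc (1 / 2 : ℝ) 4 ∩ {r | Metric.infDist r E < ρ}) ≤
      ENNReal.ofReal (C * ρ ^ (q * (d / p - (d - 1))))) :
    MidBound d E p q := by
  have hp0 : 0 < p := by linarith
  have hp1 : 0 < p - 1 := by linarith
  have hq0 : 0 < q := by linarith
  set κ := q * (d / p - (d - 1)) with hκd
  set γ := p / (p - 1) with hγd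
  have hγ : (γ - 1) * (p - 1) = 1 := by rw [hγd]; field_simp; ring
  have hpg : p = (p - 1) * γ := by rw [hγd]; field_simp
  -- ν(ρ, 6) is O(ρ^(-(γ-d))), so a tail O(y^(-q/p')) in y is a bound O(ρ^κ) in ρ.
  have hκγ : κ = (q - q / p) * (γ - d) := by
    rw [hκd, hγd]; field_simp; ring
  have hqp : 0 < q - q / p := by
    have : q / p < q := div_lt_self hq0 hp
    linarith
  have hγpos : 0 < γ - d := by
    rw [hκγ] at hκ
    exact (pos_iff_pos_of_mul_pos hκ).1 hqp
  refine midBound_of_tail hd hE hne hp hpq hγ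
    (C := ENNReal.ofReal (C * (γ - d) ^ (-(q - q / p)))) ENNReal.ofReal_ne_top ?_ ?_
  · refine le_antisymm (le_of_forall_pos_le_add fun ε hε => ?_) zero_le
    have hlim : Tendsto (fun ρ : ℝ => ENNReal.ofReal (C * ρ ^ κ)) (𝓝[>] 0) (𝓝 0) := by
      have h1 : Tendsto (fun ρ : ℝ => C * ρ ^ κ) (𝓝[>] 0) (𝓝 (C * 0 ^ κ)) :=
        (((Real.continuousAt_rpow_const 0 κ (Or.inr hκ.le)).tendsto).const_mul C).mono_left
          nhdsWithin_le_nhds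
      have h2 := ENNReal.tendsto_ofReal h1
      rwa [Real.zero_rpow hκ.ne', mul_zero, ENNReal.ofReal_zero] at h2
    obtain ⟨ρ, h1, h2⟩ := ((hlim.eventually_lt_const hε).and self_mem_nhdsWithin).exists
    rw [zero_add]
    exact (volume_inter_infDist_eq_zero_le E h2).trans ((hM ρ h2).trans h1.le)
  · intro y hy
    -- This ρ solves ρ^(-(γ-d))/(γ-d) = y, whence x(r) > y forces dist(r, E) < ρ.
    set ρ := (y * (γ - d)) ^ (-(1 / (γ - d))) with hρ
    have hyg : 0 < y * (γ - d) := mul_pos hy hγpos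
    have hρ0 : 0 < ρ := Real.rpow_pos_of_pos hyg _
    refine (measure_mono (inter_subset_inter_right _ ?_)).trans ((hM ρ hρ0).trans (le_of_eq ?_))
    · rintro r ⟨hr0, hr⟩
      set D := Metric.infDist r E with hD
      rw [powMeasure_apply _ _ measurableSet_Ioo (Ioo_subset_Ioo_left Metric.infDist_nonneg)] at hr
      have hexp : (d : ℝ) - 1 - γ < -1 := by linarith
      have h1 : ∫⁻ s in Ioo D 6, ENNReal.ofReal (s ^ ((d : ℝ) - 1 - γ)) ≤
          ENNReal.ofReal (D ^ (-(γ - d)) / (γ - d)) := by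
        calc _ ≤ ∫⁻ s in Ioi D, ENNReal.ofReal (s ^ ((d : ℝ) - 1 - γ)) :=
              lintegral_mono_set fun s hs => hs.1
          _ = ENNReal.ofReal (∫ s in Ioi D, s ^ ((d : ℝ) - 1 - γ)) := by
              rw [ofReal_integral_eq_lintegral_ofReal (integrableOn_Ioi_rpow_of_lt hexp hr0)]
              filter_upwards [ae_restrict_mem measurableSet_Ioi] with s hs
              exact Real.rpow_nonneg (hr0.le.trans (le_of_lt hs)) _
          _ = _ := by
              rw [integral_Ioi_rpow_of_lt hexp hr0]
              congr 1
              have : (d : ℝ) - 1 - γ + 1 = -(γ - d) := by ring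
              rw [this, neg_div_neg_eq]
      have h2 := hr.trans_le h1
      rw [ENNReal.ofReal_lt_ofReal_iff (by positivity), lt_div_iff₀ hγpos,
        Real.rpow_neg hr0.le] at h2
      have h3 : D ^ (γ - d) < (y * (γ - d))⁻¹ := by
        rw [lt_inv_comm₀ (Real.rpow_pos_of_pos hr0 _) hyg]; exact h2
      have h4 := Real.rpow_lt_rpow (Real.rpow_nonneg hr0.le _) h3 (one_div_pos.2 hγpos)
      rw [← Real.rpow_mul hr0.le, mul_one_div_cancel hγpos.ne', Real.rpow_one,
        Real.inv_rpow hyg.le, ← Real.rpow_neg hyg.le] at h4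
      exact h4
    · rw [← ENNReal.ofReal_mul (by positivity), hρ, ← Real.rpow_mul hyg.le]
      congr 1
      have : -(1 / (γ - d)) * κ = -(q - q / p) := by
        rw [hκγ]; field_simp
      rw [this, Real.mul_rpow hy.le hγpos.le]
      ring

/-- Logarithmic neighbourhood bounds give the estimate at unit distance when
`p = d / (d - 1)`. -/
lemma midBound_of_log {d : ℕ} (hd : 2 ≤ d) {E : Set ℝ} (hE : E ⊆ Icc 1 2) (hne : E.Nonempty)
    {p q : ℝ} (hp : p = d / (d - 1)) (hpq : p ≤ q) {C : ℝ} (hC : 0 ≤ C)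
    (hM : ∀ ρ ∈ Ioo (0 : ℝ) (1 / 2),
      volume (Icc (1 / 2 : ℝ) 4 ∩ {r | Metric.infDist r E < ρ}) ≤
      ENNReal.ofReal (C * Real.log (1 / ρ) ^ (-(q / d)))) :
    MidBound d E p q := by
  have hd2 : (2 : ℝ) ≤ d := by exact_mod_cast hd
  have hd1 : (0 : ℝ) < d - 1 := by linarith
  have hp1 : 1 < p := by rw [hp, one_lt_div hd1]; linarith
  have hp0 : 0 < p := by linarith
  have hq0 : 0 < q := by linarith
  have hγ : ((d : ℝ) - 1) * (p - 1) = 1 := by rw [hp]; field_simp; ring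
  have hqp : q - q / p = q / d := by
    rw [hp]; field_simp; ring
  have hqd : 0 < q / d := by positivity
  set L := Real.log 216 with hL
  have hL0 : 0 < L := Real.log_pos (by norm_num)
  -- The second entry makes the claim trivial for y ≤ L, where the measure is at most 4. The first
  -- pays for replacing log(1/ρ) by y/2 when y > L.
  let K := max (C * (1 / 2) ^ (-(q / d))) (4 * L ^ (q / d))
  refine midBound_of_tail hd hE hne hp1 hpq (γ := d) hγ (C := ENNReal.ofReal K)
    ENNReal.ofReal_ne_top ?_ ?_
  · refine le_antisymm (le_of_forall_pos_le_add fun ε hε => ?_) zero_le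
    have hlim : Tendsto (fun ρ : ℝ => ENNReal.ofReal (C * Real.log (1 / ρ) ^ (-(q / d))))
        (𝓝[>] 0) (𝓝 0) := by
      have h0 : Tendsto (fun ρ : ℝ => Real.log (1 / ρ)) (𝓝[>] 0) atTop := by
        simp only [one_div]
        exact Real.tendsto_log_atTop.comp tendsto_inv_nhdsGT_zero
      have h1 := ((tendsto_rpow_neg_atTop hqd).comp h0).const_mul C
      have h2 := ENNReal.tendsto_ofReal h1
      rwa [mul_zero, ENNReal.ofReal_zero] at h2
    have hmem : ∀ᶠ ρ : ℝ in 𝓝[>] 0, ρ ∈ Ioo (0 : ℝ) (1 / 2) := Ioo_mem_nhdsGT (by norm_num)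
    obtain ⟨ρ, h1, h2⟩ := ((hlim.eventually_lt_const hε).and hmem).exists
    rw [zero_add]
    exact (volume_inter_infDist_eq_zero_le E h2.1).trans ((hM ρ h2).trans h1.le)
  · intro y hy
    rw [hqp, ← ENNReal.ofReal_mul (le_max_of_le_right (by positivity))]
    rcases le_or_gt y L with hyL | hyL
    · refine (volume_inter_le _).trans (ENNReal.ofReal_le_ofReal ?_)
      calc (4 : ℝ) = 4 * L ^ (q / d) * L ^ (-(q / d)) := by
            rw [mul_assoc, ← Real.rpow_add hL0, add_neg_cancel, Real.rpow_zero, mul_one]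
        _ ≤ K * y ^ (-(q / d)) := by
            refine mul_le_mul (le_max_right _ _) ?_ (by positivity)
              (le_max_of_le_right (by positivity))
            exact Real.rpow_le_rpow_of_nonpos hy hyL (by linarith)
    -- Here log(6/ρ) = y. Since y > log 216 = 3 log 6, it follows that ρ < 1/36 and log(1/ρ) = y -
    -- log 6 ≥ y/2.
    · set ρ := 6 * Real.exp (-y) with hρ
      have hρ0 : 0 < ρ := by positivity
      have hρ36 : ρ < 1 / 36 := by
        have : Real.exp (-y) < 1 / 216 := by
          rw [← Real.lt_log_iff_exp_lt (by norm_num), one_div, Real.log_inv]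
          linarith
        linarith
      have hlog : Real.log (1 / ρ) = y - Real.log 6 := by
        rw [one_div, Real.log_inv, hρ, Real.log_mul (by norm_num) (Real.exp_ne_zero _),
          Real.log_exp]
        ring
      have h6 : L = 3 * Real.log 6 := by
        rw [hL, (by norm_num : (216 : ℝ) = 6 ^ 3), Real.log_pow]; norm_num
      have hlog2 : 1 / 2 * y ≤ Real.log (1 / ρ) := by rw [hlog]; linarith
      refine (measure_mono (inter_subset_inter_right _ ?_)).trans
        ((hM ρ ⟨hρ0, by linarith⟩).trans (ENNReal.ofReal_le_ofReal ?_))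
      · rintro r ⟨hr0, hr⟩
        set D := Metric.infDist r E with hD
        rw [mem_ofPred_eq]
        rw [powMeasure_apply _ _ measurableSet_Ioo (Ioo_subset_Ioo_left Metric.infDist_nonneg)] at hr
        rcases le_or_gt 6 D with h6D | h6D
        · rw [← hD, Ioo_eq_empty (not_lt.2 h6D)] at hr
          simp at hr
        have hexp : (d : ℝ) - 1 - d = -1 := by ring
        have h1 : ∫⁻ s in Ioo D 6, ENNReal.ofReal (s ^ ((d : ℝ) - 1 - d)) =
            ENNReal.ofReal (Real.log (6 / D)) := by
          rw [← integral_one_div_of_pos hr0 (by norm_num : (0 : ℝ) < 6),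
            intervalIntegral.integral_of_le h6D.le, ofReal_integral_eq_lintegral_ofReal,
            setLIntegral_congr Ioo_ae_eq_Ioc]
          · refine setLIntegral_congr_fun measurableSet_Ioc fun s hs => ?_
            have hs0 : 0 < s := hr0.trans hs.1
            rw [hexp, Real.rpow_neg_one, one_div]
          · have hc : ContinuousOn (fun s : ℝ => 1 / s) (Icc D 6) := by
              refine continuousOn_const.div continuousOn_id fun s hs => ?_
              exact (lt_of_lt_of_le hr0 hs.1).ne'
            exact hc.integrableOn_Icc.mono_set Ioc_subset_Icc_self
          · filter_upwards [ae_restrict_mem measurableSet_Ioc] with s hs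
            have hs0 : 0 < s := hr0.trans hs.1
            change 0 ≤ 1 / s
            positivity
        rw [h1, ENNReal.ofReal_lt_ofReal_iff'] at hr
        have h2 := hr.1
        rw [Real.lt_log_iff_exp_lt (by positivity), lt_div_iff₀ hr0] at h2
        rw [hρ, Real.exp_neg, ← div_eq_mul_inv, lt_div_iff₀ (Real.exp_pos y)]
        linarith
      · calc C * Real.log (1 / ρ) ^ (-(q / d)) ≤ C * (1 / 2 * y) ^ (-(q / d)) := by
              refine mul_le_mul_of_nonneg_left ?_ hC
              exact Real.rpow_le_rpow_of_nonpos (by positivity) hlog2 (by linarith)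
          _ = C * (1 / 2) ^ (-(q / d)) * y ^ (-(q / d)) := by
              rw [Real.mul_rpow (by norm_num) hy.le]; ring
          _ ≤ K * y ^ (-(q / d)) := by
              gcongr
              exact le_max_left _ _

/-- The Hardy inequality is unavailable at p = 1. Fubini replaces it: the set of r with dist(r, E) <
s has measure at most Cs, and this factor s raises s^(d-2) to s^(d-1). -/
lemma midBound_one {d : ℕ} (hd : 2 ≤ d) {E : Set ℝ} {C : ℝ} (hC : 0 ≤ C)
    (hM : ∀ ρ : ℝ, 0 < ρ → volume (Icc (1 / 2 : ℝ) 4 ∩ {r | Metric.infDist r E < ρ}) ≤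
      ENNReal.ofReal (C * ρ)) :
    MidBound d E 1 1 := by
  refine ⟨ENNReal.ofReal C, ENNReal.ofReal_ne_top, fun G hG _ => ?_⟩
  simp only [ENNReal.rpow_one, div_one]
  have hDm : Measurable fun r : ℝ => Metric.infDist r E := (Metric.continuous_infDist_pt E).measurable
  have hS : MeasurableSet {z : ℝ × ℝ | Metric.infDist z.1 E < z.2} :=
    measurableSet_lt (hDm.comp measurable_fst) measurable_snd
  have hmeas : Measurable (Function.uncurry fun (r s : ℝ) =>
      {z : ℝ × ℝ | Metric.infDist z.1 E < z.2}.indicator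
        (fun z => ENNReal.ofReal (z.2 ^ (d - 2)) * G z.2) (r, s)) :=
    Measurable.indicator (by fun_prop) hS
  calc _ ≤ ∫⁻ r in Icc (1 / 2 : ℝ) 4, ∫⁻ s in Ioi (0 : ℝ),
        {z : ℝ × ℝ | Metric.infDist z.1 E < z.2}.indicator
        (fun z => ENNReal.ofReal (z.2 ^ (d - 2)) * G z.2) (r, s) := by
        refine lintegral_mono fun r => ?_
        rw [← lintegral_indicator measurableSet_Ioo, ← lintegral_indicator measurableSet_Ioi]
        refine lintegral_mono fun s => ?_
        by_cases hs : s ∈ Ioo (Metric.infDist r E) 6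
        · have hs0 : s ∈ Ioi (0 : ℝ) := lt_of_le_of_lt Metric.infDist_nonneg hs.1
          rw [indicator_of_mem hs, indicator_of_mem hs0, indicator_of_mem (show (r, s) ∈
            {z : ℝ × ℝ | Metric.infDist z.1 E < z.2} from hs.1)]
        · rw [indicator_of_notMem hs]; exact zero_le
    _ = ∫⁻ s in Ioi (0 : ℝ), ∫⁻ r in Icc (1 / 2 : ℝ) 4,
        {z : ℝ × ℝ | Metric.infDist z.1 E < z.2}.indicator
        (fun z => ENNReal.ofReal (z.2 ^ (d - 2)) * G z.2) (r, s) :=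
        lintegral_lintegral_swap hmeas.aemeasurable
    _ ≤ ∫⁻ s in Ioi (0 : ℝ), ENNReal.ofReal C * (ENNReal.ofReal (s ^ (d - 1)) * G s) := by
        refine setLIntegral_mono' measurableSet_Ioi fun s hs => ?_
        have hs0 : (0 : ℝ) < s := hs
        have hset : MeasurableSet {r : ℝ | Metric.infDist r E < s} :=
          measurableSet_lt hDm measurable_const
        have h1 : ∀ r : ℝ, {z : ℝ × ℝ | Metric.infDist z.1 E < z.2}.indicator
            (fun z => ENNReal.ofReal (z.2 ^ (d - 2)) * G z.2) (r, s) =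
            {r : ℝ | Metric.infDist r E < s}.indicator
              (fun _ => ENNReal.ofReal (s ^ (d - 2)) * G s) r := fun r => rfl
        simp_rw [h1]
        rw [lintegral_indicator hset, setLIntegral_const, Measure.restrict_apply hset, inter_comm]
        calc _ ≤ ENNReal.ofReal (s ^ (d - 2)) * G s * ENNReal.ofReal (C * s) := by
              gcongr; exact hM s hs0
          _ = _ := by
              have : s ^ (d - 1) = s ^ (d - 2) * s := by
                rw [← pow_succ]; congr 1; omega
              rw [this, ENNReal.ofReal_mul hC, ENNReal.ofReal_mul (by positivity)]
              ring
    _ = _ := lintegral_const_mul' _ _ ENNReal.ofReal_ne_top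

/-! ### Continuity in r and measurability of the maximal function -/

lemma continuousAt_kern {d : ℕ} {r₀ t s : ℝ} (hr : 0 < r₀) (ht : 0 < t) (h1 : s ≠ |r₀ - t|)
    (h2 : s ≠ r₀ + t) : ContinuousAt (fun r => kern d r t s) r₀ := by
  have hc1 : ContinuousAt (fun r : ℝ => |r - t|) r₀ := by fun_prop
  have hc2 : ContinuousAt (fun r : ℝ => r + t) r₀ := by fun_prop
  by_cases hs : s ∈ Ioo |r₀ - t| (r₀ + t)
  · have hev : ∀ᶠ r in 𝓝 r₀, s ∈ Ioo |r - t| (r + t) :=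
      (hc1.eventually_lt_const hs.1).and (hc2.eventually_const_lt hs.2)
    have hcf : ContinuousAt (fun r => kernConst d *
        (s / (r * t) * √(1 - ((r ^ 2 + t ^ 2 - s ^ 2) / (2 * r * t)) ^ 2) ^ (d - 3))) r₀ := by
      have hn1 : r₀ * t ≠ 0 := by positivity
      have hn2 : 2 * r₀ * t ≠ 0 := by positivity
      fun_prop (disch := assumption)
    refine hcf.congr ?_
    filter_upwards [hev] with r hr
    rw [kern_of_mem hr]
  · have hev : ∀ᶠ r in 𝓝 r₀, s ∉ Ioo |r - t| (r + t) := by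
      rcases lt_or_gt_of_ne h1 with h | h
      · filter_upwards [hc1.eventually_const_lt h] with r hr hm
        exact absurd hm.1 (not_lt.2 hr.le)
      · have h3 : r₀ + t < s := by
          rcases lt_or_gt_of_ne h2 with h' | h'
          · exact absurd ⟨h, h'⟩ hs
          · exact h'
        filter_upwards [hc2.eventually_lt_const h3] with r hr hm
        exact absurd hm.2 (not_lt.2 hr.le)
    refine (continuousAt_const (y := (0 : ℝ))).congr ?_
    filter_upwards [hev] with r hr
    rw [kern_of_notMem hr]

/-- Dominated convergence with the majorant from `kern_le_pow`: the kernel can be discontinuous in r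
only when s is |r - t| or r + t, two null values of s. The number a bounds from below the s that are
seen for r near r₀, so integrability of g near 0 is needed only when a = 0. -/
lemma continuousAt_integral_kern {d : ℕ} (hd : 3 ≤ d) {g : ℝ → ℂ} (hg : StronglyMeasurable g)
    {r₀ t a : ℝ} (hr : 0 < r₀) (ht : 1 ≤ t) (ha0 : 0 ≤ a) (ha : ∀ᶠ r in 𝓝 r₀, a ≤ |r - t|)
    (hfin : ∫⁻ s in Ioo a (r₀ + t + 1), ENNReal.ofReal (s ^ (d - 2)) * ‖g s‖ₑ < ∞) :
    ContinuousAt (fun r => ∫ s, kern d r t s • g s) r₀ := by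
  have hc := kernConst_pos d
  have ht0 : 0 < t := by linarith
  let B : ℝ → ℝ := (Ioo a (r₀ + t + 1)).indicator
    (fun s => 2 * kernConst d / r₀ * (s ^ (d - 2) * ‖g s‖))
  refine continuousAt_of_dominated (bound := B) ?_ ?_ ?_ ?_
  · exact Eventually.of_forall fun r =>
      ((measurable_kern d r t).stronglyMeasurable.smul hg).aestronglyMeasurable
  · filter_upwards [ha, Ioo_mem_nhds (half_lt_self hr) (lt_add_one r₀)] with r hra hr1
    refine Eventually.of_forall fun s => ?_
    have hrpos : 0 < r := (half_pos hr).trans hr1.1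
    by_cases hs : s ∈ Ioo |r - t| (r + t)
    · have hs0 : 0 < s := lt_of_le_of_lt (abs_nonneg _) hs.1
      have hs' : s ∈ Ioo a (r₀ + t + 1) := ⟨lt_of_le_of_lt hra hs.1, by linarith [hs.2, hr1.2]⟩
      have hk := kern_le_pow hd hrpos ht s
      rw [indicator_of_mem hs] at hk
      simp only [B]
      rw [indicator_of_mem hs', norm_smul, Real.norm_of_nonneg (kern_nonneg hrpos ht0 s),
        ← mul_assoc]
      refine mul_le_mul_of_nonneg_right (hk.trans ?_) (norm_nonneg _)
      refine mul_le_mul_of_nonneg_right ?_ (by positivity)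
      rw [div_le_div_iff₀ hrpos hr]
      nlinarith [hr1.1]
    · rw [kern_of_notMem hs, zero_smul, norm_zero]
      refine indicator_nonneg (fun s hs' => ?_) s
      have hs0 : 0 < s := lt_of_le_of_lt ha0 hs'.1
      positivity
  · refine (integrable_indicator_iff measurableSet_Ioo).2 (Integrable.const_mul ⟨?_, ?_⟩ _)
    · exact (((measurable_id.pow_const _).stronglyMeasurable.mul
        hg.norm)).aestronglyMeasurable
    · refine lt_of_le_of_lt (le_of_eq (setLIntegral_congr_fun measurableSet_Ioo fun s hs => ?_)) hfin
      have hs0 : 0 < s := lt_of_le_of_lt ha0 hs.1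
      simp only
      rw [enorm_mul, enorm_norm, Real.enorm_of_nonneg (by positivity)]
  · have h1 : ∀ᵐ s : ℝ, s ≠ |r₀ - t| := by simp [ae_iff, measure_singleton]
    have h2 : ∀ᵐ s : ℝ, s ≠ r₀ + t := by simp [ae_iff, measure_singleton]
    filter_upwards [h1, h2] with s hs1 hs2
    exact (continuousAt_kern hr ht0 hs1 hs2).smul continuousAt_const

/-- The one-dimensional maximal function that represents `M_E f` for radial `f`. -/
noncomputable def profileMax (d : ℕ) (E : Set ℝ) (g : ℝ → ℂ) (r : ℝ) : ℝ≥0∞ :=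
  ⨆ t ∈ E, ‖∫ s, kern d r t s • g s‖ₑ

/-- A supremum of continuous functions over any index set has open superlevel sets, so E may be
uncountable. -/
lemma measurable_indicator_profileMax {d : ℕ} {E : Set ℝ} {g : ℝ → ℂ} {U : Set ℝ} (hU : IsOpen U)
    (hc : ∀ r ∈ U, ∀ t ∈ E, ContinuousAt (fun r => ∫ s, kern d r t s • g s) r) :
    Measurable (U.indicator (profileMax d E g)) := by
  refine measurable_of_Ioi fun c => ?_
  have : U.indicator (profileMax d E g) ⁻¹' Ioi c =
      ⋃ t ∈ E, U ∩ {r | c < ‖∫ s, kern d r t s • g s‖ₑ} := by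
    ext r
    by_cases hr : r ∈ U
    · simp [hr, profileMax, lt_iSup_iff]
    · simp [hr]
  rw [this]
  refine IsOpen.measurableSet (isOpen_biUnion fun t ht => ?_)
  rw [isOpen_iff_mem_nhds]
  rintro r ⟨hr, hcr⟩
  refine inter_mem (hU.mem_nhds hr) ?_
  exact (hc r hr t ht).enorm.eventually_const_lt hcr

/-- In the first alternative the averages are continuous at every r > 0. In the second they are
known to be continuous only off the closure of E, which is then null. -/
lemma aemeasurable_profileMax {d : ℕ} (hd : 3 ≤ d) {E : Set ℝ} (hE : E ⊆ Icc 1 2) {g : ℝ → ℂ}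
    (hg : StronglyMeasurable g)
    (hloc : ∀ a b : ℝ, 0 < a → ∫⁻ s in Ioo a b, ENNReal.ofReal (s ^ (d - 2)) * ‖g s‖ₑ < ∞)
    (hor : (∃ b, 0 < b ∧ ∫⁻ s in Ioo 0 b, ENNReal.ofReal (s ^ (d - 2)) * ‖g s‖ₑ < ∞) ∨
      volume {r | Metric.infDist r E = 0} = 0) :
    AEMeasurable (profileMax d E g) (volume.restrict (Ioi 0)) := by
  rcases hor with ⟨b, hb0, hb⟩ | h0
  · have hall : ∀ c, ∫⁻ s in Ioo 0 c, ENNReal.ofReal (s ^ (d - 2)) * ‖g s‖ₑ < ∞ := by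
      intro c
      have hsub : Ioo 0 c ⊆ Ioo 0 b ∪ Ioo (b / 2) c := by
        intro s hs
        rcases lt_or_ge s b with h | h
        · exact Or.inl ⟨hs.1, h⟩
        · exact Or.inr ⟨by linarith, hs.2⟩
      exact ((lintegral_mono_set hsub).trans (lintegral_union_le _ _ _)).trans_lt
        (ENNReal.add_lt_top.2 ⟨hb, hloc _ _ (half_pos hb0)⟩)
    have hm := measurable_indicator_profileMax (d := d) (E := E) (g := g) isOpen_Ioi
      (U := Ioi 0) (fun r hr t ht => continuousAt_integral_kern hd hg hr (hE ht).1 le_rfl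
        (Eventually.of_forall fun _ => abs_nonneg _) (hall _))
    refine ⟨_, hm, ?_⟩
    filter_upwards [ae_restrict_mem measurableSet_Ioi] with r hr
    rw [indicator_of_mem hr]
  · have hDc : Continuous fun r : ℝ => Metric.infDist r E := Metric.continuous_infDist_pt E
    have hm := measurable_indicator_profileMax (d := d) (E := E) (g := g)
      (U := Ioi 0 ∩ {r | 0 < Metric.infDist r E})
      (isOpen_Ioi.inter (isOpen_lt continuous_const hDc)) (fun r hr t ht => by
        have hr2 : 0 < Metric.infDist r E := hr.2
        refine continuousAt_integral_kern hd hg (a := Metric.infDist r E / 2) hr.1 (hE ht).1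
          (by positivity) ?_ (hloc _ _ (by positivity))
        filter_upwards [hDc.continuousAt.eventually_const_lt (half_lt_self hr2)] with r' hr'
        refine hr'.le.trans ?_
        rw [← Real.dist_eq]
        exact Metric.infDist_le_dist_of_mem ht)
    refine ⟨_, hm, ?_⟩
    have hae : ∀ᵐ r : ℝ, Metric.infDist r E ≠ 0 := by
      rw [ae_iff]; simpa using h0
    filter_upwards [ae_restrict_mem measurableSet_Ioi, ae_restrict_of_ae hae] with r hr hr'
    rw [indicator_of_mem (show r ∈ Ioi 0 ∩ {r | 0 < Metric.infDist r E} from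
      ⟨hr, lt_of_le_of_ne Metric.infDist_nonneg hr'.symm⟩)]

/-! ### Assembling the upper bound -/

/-- The maximal function associated with the one-dimensional kernels. -/
noncomputable def kernMax (d : ℕ) (E : Set ℝ) (G : ℝ → ℝ≥0∞) (r : ℝ) : ℝ≥0∞ :=
  ⨆ t ∈ E, ∫⁻ s, ENNReal.ofReal (kern d r t s) * G s

lemma lintegral_kern_mul_le {d : ℕ} {r t : ℝ} {A : Set ℝ} (hA : MeasurableSet A) {k : ℝ → ℝ}
    (h : ∀ s, kern d r t s ≤ A.indicator k s) (G : ℝ → ℝ≥0∞) :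
    ∫⁻ s, ENNReal.ofReal (kern d r t s) * G s ≤ ∫⁻ s in A, ENNReal.ofReal (k s) * G s := by
  rw [← lintegral_indicator hA]
  refine lintegral_mono fun s => ?_
  have hs := h s
  by_cases hsA : s ∈ A
  · rw [indicator_of_mem hsA] at hs ⊢
    gcongr
  · rw [indicator_of_notMem hsA] at hs ⊢
    rw [ENNReal.ofReal_of_nonpos hs, zero_mul]

lemma kernMax_le_near {d : ℕ} {E : Set ℝ} (hE : E ⊆ Icc 1 2) (G : ℝ → ℝ≥0∞)
    {r : ℝ} (hr : 0 < r) (hr' : r ≤ 1 / 2) :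
    kernMax d E G r ≤ ENNReal.ofReal (kernConst d * 3) * (ENNReal.ofReal r⁻¹ * windowSup G r) := by
  have hc := kernConst_pos d
  refine iSup₂_le fun t ht => ?_
  refine (lintegral_kern_mul_le measurableSet_Ioo (kern_le_near hr hr' (hE ht)) G).trans ?_
  rw [lintegral_const_mul' _ _ ENNReal.ofReal_ne_top, div_eq_mul_inv, ← mul_assoc,
    ENNReal.ofReal_mul (by positivity), mul_assoc]
  gcongr
  exact le_iSup₂ (f := fun (t : ℝ) (_ : t ∈ Icc (1 : ℝ) 2) => ∫⁻ s in Ioo (t - r) (t + r), G s)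
    t (hE ht)

/-- The majorant of `kern_le_mid` depends on t only through its support, and |r - t| ≥ dist(r, E)
while r + t ≤ 6. The supremum over t therefore disappears. -/
lemma kernMax_le_mid {d : ℕ} (hd : 3 ≤ d) {E : Set ℝ} (hE : E ⊆ Icc 1 2) (G : ℝ → ℝ≥0∞)
    {r : ℝ} (hr : 1 / 2 ≤ r) (hr' : r ≤ 4) :
    kernMax d E G r ≤ ENNReal.ofReal (kernConst d * 2) *
      ∫⁻ s in Ioo (Metric.infDist r E) 6, ENNReal.ofReal (s ^ (d - 2)) * G s := by
  have hc := kernConst_pos d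
  refine iSup₂_le fun t ht => ?_
  refine (lintegral_kern_mul_le measurableSet_Ioo (kern_le_mid hd hr (hE ht).1) G).trans ?_
  simp_rw [ENNReal.ofReal_mul (by positivity : 0 ≤ kernConst d * 2), mul_assoc]
  rw [lintegral_const_mul' _ _ ENNReal.ofReal_ne_top]
  gcongr
  · rw [← Real.dist_eq]
    exact Metric.infDist_le_dist_of_mem ht
  · linarith [(hE ht).2]

lemma kernMax_le_far {d : ℕ} {E : Set ℝ} (hE : E ⊆ Icc 1 2) (G : ℝ → ℝ≥0∞)
    {r : ℝ} (hr : 4 ≤ r) :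
    kernMax d E G r ≤ ENNReal.ofReal (kernConst d * 2) * ∫⁻ s in Ioo (r - 2) (r + 2), G s := by
  refine iSup₂_le fun t ht => ?_
  refine (lintegral_kern_mul_le measurableSet_Ioo (kern_le_far hr (hE ht)) G).trans ?_
  rw [lintegral_const_mul' _ _ ENNReal.ofReal_ne_top]

lemma measurable_lintegral_window {G : ℝ → ℝ≥0∞} (hG : Measurable G) :
    Measurable fun r : ℝ => ∫⁻ s in Ioo (r - 2) (r + 2), G s := by
  have hS : MeasurableSet {z : ℝ × ℝ | z.2 ∈ Ioo (z.1 - 2) (z.1 + 2)} := by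
    have h1 : MeasurableSet {z : ℝ × ℝ | z.1 - 2 < z.2} :=
      measurableSet_lt (by fun_prop) (by fun_prop)
    have h2 : MeasurableSet {z : ℝ × ℝ | z.2 < z.1 + 2} :=
      measurableSet_lt (by fun_prop) (by fun_prop)
    exact h1.inter h2
  have hm : Measurable ({z : ℝ × ℝ | z.2 ∈ Ioo (z.1 - 2) (z.1 + 2)}.indicator fun z => G z.2) :=
    Measurable.indicator (by fun_prop) hS
  have : (fun r : ℝ => ∫⁻ s in Ioo (r - 2) (r + 2), G s) = fun r => ∫⁻ s,
      {z : ℝ × ℝ | z.2 ∈ Ioo (z.1 - 2) (z.1 + 2)}.indicator (fun z => G z.2) (r, s) := by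
    funext r
    rw [← lintegral_indicator measurableSet_Ioo]
    rfl
  rw [this]
  exact hm.lintegral_prod_right'

lemma measurable_lintegral_infDist (d : ℕ) (E : Set ℝ) (G : ℝ → ℝ≥0∞) :
    Measurable fun r : ℝ => ∫⁻ s in Ioo (Metric.infDist r E) 6,
      ENNReal.ofReal (s ^ (d - 2)) * G s := by
  have : Antitone fun ρ : ℝ => ∫⁻ s in Ioo ρ 6, ENNReal.ofReal (s ^ (d - 2)) * G s :=
    fun a b hab => lintegral_mono_set (Ioo_subset_Ioo_left hab)
  exact this.measurable.comp (Metric.continuous_infDist_pt E).measurable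

/-- The full one-dimensional estimate. -/
lemma exists_majorant {d : ℕ} (hd : 3 ≤ d) {E : Set ℝ} (hE : E ⊆ Icc 1 2) {p q : ℝ} (hp : 1 ≤ p)
    (hpq : p ≤ q) (hq : q ≤ d * p) (hne : q < d * p ∨ 1 < p) (hmid : MidBound d E p q) :
    ∃ C : ℝ≥0∞, C ≠ ∞ ∧ ∀ G : ℝ → ℝ≥0∞, Measurable G →
      ∫⁻ s in Ioi (0 : ℝ), ENNReal.ofReal (s ^ (d - 1)) * G s ^ p ≠ ∞ →
      ∃ U : ℝ → ℝ≥0∞, Measurable U ∧ (∀ r, 0 < r → kernMax d E G r ≤ U r) ∧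
        ∫⁻ r in Ioi (0 : ℝ), ENNReal.ofReal (r ^ (d - 1)) * U r ^ q ≤
        C * (∫⁻ s in Ioi (0 : ℝ), ENNReal.ofReal (s ^ (d - 1)) * G s ^ p) ^ (q / p) := by
  have hq0 : 0 < q := by linarith
  obtain ⟨C₁, hC₁, h₁⟩ := exists_near_bound (by omega : 1 ≤ d) hp hpq hq hne
  obtain ⟨C₂, hC₂, h₂⟩ := hmid
  obtain ⟨C₃, hC₃, h₃⟩ := exists_far_bound d hp hpq
  set k₁ := ENNReal.ofReal (kernConst d * 3) with hk₁
  set k₂ := ENNReal.ofReal (kernConst d * 2) with hk₂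
  have hk₁q : k₁ ^ q ≠ ∞ := ENNReal.rpow_ne_top_of_nonneg hq0.le ENNReal.ofReal_ne_top
  have hk₂q : k₂ ^ q ≠ ∞ := ENNReal.rpow_ne_top_of_nonneg hq0.le ENNReal.ofReal_ne_top
  refine ⟨k₁ ^ q * C₁ + ENNReal.ofReal (4 ^ (d - 1)) * k₂ ^ q * C₂ + k₂ ^ q * C₃, ?_,
    fun G hG hfin => ?_⟩
  · exact ENNReal.add_ne_top.2 ⟨ENNReal.add_ne_top.2 ⟨ENNReal.mul_ne_top hk₁q hC₁,
      ENNReal.mul_ne_top (ENNReal.mul_ne_top ENNReal.ofReal_ne_top hk₂q) hC₂⟩,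
      ENNReal.mul_ne_top hk₂q hC₃⟩
  have g₁ := h₁ G hG hfin
  have g₂ := h₂ G hG hfin
  have g₃ := h₃ G hG
  set I := ∫⁻ s in Ioi (0 : ℝ), ENNReal.ofReal (s ^ (d - 1)) * G s ^ p with hI
  let U₁ : ℝ → ℝ≥0∞ := fun r => k₁ * (ENNReal.ofReal r⁻¹ * windowSup G r)
  let U₂ : ℝ → ℝ≥0∞ := fun r => k₂ *
    ∫⁻ s in Ioo (Metric.infDist r E) 6, ENNReal.ofReal (s ^ (d - 2)) * G s
  let U₃ : ℝ → ℝ≥0∞ := fun r => k₂ * ∫⁻ s in Ioo (r - 2) (r + 2), G s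
  have hΦm : Measurable (windowSup G) := (windowSup_mono G).measurable
  have hU₁ : Measurable U₁ := by fun_prop
  have hU₂ : Measurable U₂ := (measurable_lintegral_infDist d E G).const_mul _
  have hU₃ : Measurable U₃ := (measurable_lintegral_window hG).const_mul _
  -- The three majorants are glued into one measurable function, so that measurability of `kernMax`
  -- itself is never needed.
  refine ⟨(Iic (1 / 2)).piecewise U₁ ((Iic 4).piecewise U₂ U₃),
    hU₁.piecewise measurableSet_Iic (hU₂.piecewise measurableSet_Iic hU₃), fun r hr => ?_, ?_⟩
  · by_cases h1 : r ≤ 1 / 2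
    · rw [piecewise_eq_of_mem _ _ _ (show r ∈ Iic (1 / 2) from h1)]
      exact kernMax_le_near hE G hr h1
    · rw [piecewise_eq_of_notMem _ _ _ (show r ∉ Iic (1 / 2) from h1)]
      by_cases h4 : r ≤ 4
      · rw [piecewise_eq_of_mem _ _ _ (show r ∈ Iic 4 from h4)]
        exact kernMax_le_mid hd hE G (not_le.1 h1).le h4
      · rw [piecewise_eq_of_notMem _ _ _ (show r ∉ Iic 4 from h4)]
        exact kernMax_le_far hE G (not_le.1 h4).le
  set U := (Iic (1 / 2)).piecewise U₁ ((Iic 4).piecewise U₂ U₃) with hU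
  have hsub : Ioi (0 : ℝ) ⊆ (Ioc 0 (1 / 2) ∪ Ioc (1 / 2) 4) ∪ Ioi 4 := by
    intro r hr
    rcases le_or_gt r (1 / 2) with h | h
    · exact Or.inl (Or.inl ⟨hr, h⟩)
    · rcases le_or_gt r 4 with h' | h'
      · exact Or.inl (Or.inr ⟨h, h'⟩)
      · exact Or.inr h'
  refine (lintegral_mono_set hsub).trans ((lintegral_union_le _ _ _).trans ?_)
  rw [add_mul, add_mul]
  refine add_le_add ((lintegral_union_le _ _ _).trans (add_le_add ?_ ?_)) ?_
  · rw [mul_assoc]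
    refine le_trans (le_of_eq ?_) (mul_le_mul_right g₁ _)
    rw [← lintegral_const_mul' _ _ hk₁q]
    refine setLIntegral_congr_fun measurableSet_Ioc fun r hr => ?_
    simp only [hU]
    rw [piecewise_eq_of_mem _ _ _ (show r ∈ Iic (1 / 2) from hr.2)]
    simp only [U₁]
    rw [ENNReal.mul_rpow_of_nonneg k₁ _ hq0.le]
    ring
  · rw [mul_assoc]
    refine le_trans ?_ (mul_le_mul_right g₂ _)
    rw [← lintegral_const_mul' _ _ (ENNReal.mul_ne_top ENNReal.ofReal_ne_top hk₂q)]
    refine (setLIntegral_mono' measurableSet_Ioc fun r hr => ?_).trans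
      (lintegral_mono_set Ioc_subset_Icc_self)
    have hr0 : (0 : ℝ) < r := by linarith [hr.1]
    rw [hU, piecewise_eq_of_notMem _ _ _ (show r ∉ Iic (1 / 2) from not_le.2 hr.1),
      piecewise_eq_of_mem _ _ _ (show r ∈ Iic 4 from hr.2)]
    simp only [U₂]
    rw [ENNReal.mul_rpow_of_nonneg k₂ _ hq0.le, mul_assoc]
    gcongr
    exact hr.2
  · rw [mul_assoc]
    refine le_trans (le_of_eq ?_) (mul_le_mul_right g₃ _)
    rw [← lintegral_const_mul' _ _ hk₂q]
    refine setLIntegral_congr_fun measurableSet_Ioi fun r hr => ?_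
    have hr4 : (4 : ℝ) < r := hr
    simp only [hU]
    rw [piecewise_eq_of_notMem _ _ _ (show r ∉ Iic (1 / 2) from
      not_le.2 (lt_trans (by norm_num) hr4)),
      piecewise_eq_of_notMem _ _ _ (show r ∉ Iic 4 from not_le.2 hr4)]
    simp only [U₃]
    rw [ENNReal.mul_rpow_of_nonneg k₂ _ hq0.le]
    ring

lemma profileMax_le_kernMax {d : ℕ} {E : Set ℝ} (hE : E ⊆ Icc 1 2) (g : ℝ → ℂ) {r : ℝ}
    (hr : 0 < r) : profileMax d E g r ≤ kernMax d E (fun s => ‖g s‖ₑ) r := by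
  refine iSup₂_mono fun t ht => (enorm_integral_le_lintegral_enorm _).trans (le_of_eq ?_)
  refine lintegral_congr fun s => ?_
  rw [enorm_smul, Real.enorm_of_nonneg (kern_nonneg hr (by linarith [(hE ht).1]) s)]

lemma sphericalMax_eq_profileMax {d : ℕ} {E : Set ℝ} (hE : E ⊆ Icc 1 2)
    {f : EuclideanSpace ℝ (Fin d) → ℂ} {g : ℝ → ℂ} {x : EuclideanSpace ℝ (Fin d)}
    (h : ∀ t : ℝ, 0 < t → sphericalAvg t f x = ∫ s, kern d ‖x‖ t s • g s) :
    sphericalMax E f x = profileMax d E g ‖x‖ := by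
  refine iSup_congr fun t => iSup_congr fun ht => ?_
  rw [h t (by linarith [(hE ht).1])]

lemma ae_ne_zero {d : ℕ} (hd : 1 ≤ d) : ∀ᵐ x : EuclideanSpace ℝ (Fin d), x ≠ 0 := by
  have h := ae_norm_of_ae hd (P := fun r => 0 < r) (ae_restrict_mem measurableSet_Ioi)
  filter_upwards [h] with x hx
  exact norm_pos_iff.1 hx

lemma aestronglyMeasurable_sphericalMax {d : ℕ} (hd : 3 ≤ d) {E : Set ℝ} (hE : E ⊆ Icc 1 2)
    {f : EuclideanSpace ℝ (Fin d) → ℂ} {g : ℝ → ℂ} (hg : StronglyMeasurable g)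
    (h : ∀ x : EuclideanSpace ℝ (Fin d), x ≠ 0 → ∀ t : ℝ, 0 < t →
      sphericalAvg t f x = ∫ s, kern d ‖x‖ t s • g s)
    (hloc : ∀ a b : ℝ, 0 < a → ∫⁻ s in Ioo a b, ENNReal.ofReal (s ^ (d - 2)) * ‖g s‖ₑ < ∞)
    (hor : (∃ b, 0 < b ∧ ∫⁻ s in Ioo 0 b, ENNReal.ofReal (s ^ (d - 2)) * ‖g s‖ₑ < ∞) ∨
      volume {r | Metric.infDist r E = 0} = 0) :
    AEStronglyMeasurable (sphericalMax E f) volume := by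
  obtain ⟨m, hm, hae⟩ := aemeasurable_profileMax hd hE hg hloc hor
  refine AEMeasurable.aestronglyMeasurable ⟨fun x => m ‖x‖, hm.comp measurable_norm, ?_⟩
  filter_upwards [ae_norm_of_ae (by omega) hae, ae_ne_zero (d := d) (by omega)] with x hx hx0
  rw [sphericalMax_eq_profileMax hE (h x hx0), hx]

/-- Sufficiency: the estimate at unit distance implies boundedness of the spherical maximal
function on radial functions. -/
lemma boundedRadial_of_midBound {d : ℕ} (hd : 3 ≤ d) {E : Set ℝ} (hE : E ⊆ Icc 1 2)
    (hEne : E.Nonempty) {p q : ℝ} (hp : 1 ≤ p)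
    (hpq : p ≤ q) (hq : q ≤ d * p) (hne : q < d * p ∨ 1 < p) (hmid : MidBound d E p q) :
    BoundedRadial d E (ENNReal.ofReal p) (ENNReal.ofReal q) := by
  have hp0 : 0 < p := by linarith
  have hq0 : 0 < q := by linarith
  have hfr : Module.finrank ℝ (EuclideanSpace ℝ (Fin d)) = d := by simp
  have : Nontrivial (EuclideanSpace ℝ (Fin d)) :=
    Module.nontrivial_of_finrank_pos (R := ℝ) (by omega)
  obtain ⟨C, hC, hmaj⟩ := exists_majorant hd hE hp hpq hq hne hmid
  set σ := (volume : Measure (EuclideanSpace ℝ (Fin d))).toSphere univ with hσ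
  have hσ0 : σ ≠ 0 := by
    rw [hσ, Ne, Measure.measure_univ_eq_zero]; exact Measure.toSphere_ne_zero _
  have hσt : σ ≠ ∞ := measure_ne_top _ _
  -- Polar coordinates contribute the surface measure σ to the power 1/q on the left and 1/p on the
  -- right; K collects both.
  set K := (σ * C) ^ (1 / q) * (σ ^ (1 / p))⁻¹ with hK
  have hσp0 : σ ^ (1 / p) ≠ 0 := (ENNReal.rpow_pos (pos_iff_ne_zero.2 hσ0) hσt).ne'
  have hσpt : σ ^ (1 / p) ≠ ∞ := ENNReal.rpow_ne_top_of_nonneg (by positivity) hσt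
  have hKt : K ≠ ∞ := ENNReal.mul_ne_top
    (ENNReal.rpow_ne_top_of_nonneg (by positivity) (ENNReal.mul_ne_top hσt hC))
    (ENNReal.inv_ne_top.2 hσp0)
  refine ⟨K.toNNReal, fun f hrad hf => ?_⟩
  rw [ENNReal.coe_toNNReal hKt]
  obtain ⟨g, hg, hfg, hrep⟩ := exists_radial_profile hd hrad hf.1
  have hGm : Measurable fun s => ‖g s‖ₑ := hg.enorm
  have hP0 : ENNReal.ofReal p ≠ 0 := by simpa using hp0
  have hQ0 : ENNReal.ofReal q ≠ 0 := by simpa using hq0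
  set I := ∫⁻ s in Ioi (0 : ℝ), ENNReal.ofReal (s ^ (d - 1)) * ‖g s‖ₑ ^ p with hI
  have hfnorm : eLpNorm f (ENNReal.ofReal p) volume = (σ * I) ^ (1 / p) := by
    rw [eLpNorm_congr_ae hfg, eLpNorm_eq_lintegral_rpow_enorm_toReal hP0 ENNReal.ofReal_ne_top,
      ENNReal.toReal_ofReal hp0.le, lintegral_fun_norm (volume : Measure (EuclideanSpace ℝ (Fin d)))
      (h := fun r => ‖g r‖ₑ ^ p) (by fun_prop), hfr]
  have hIt : I ≠ ∞ := by
    intro h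
    have h1 := hf.2
    rw [hfnorm, h, ENNReal.mul_top hσ0, ENNReal.top_rpow_of_pos (by positivity)] at h1
    exact lt_irrefl _ h1
  obtain ⟨U, hUm, hUle, hUint⟩ := hmaj _ hGm hIt
  have hUnorm : ∫⁻ x : EuclideanSpace ℝ (Fin d), U ‖x‖ ^ q ≤ σ * (C * I ^ (q / p)) := by
    rw [lintegral_fun_norm (volume : Measure (EuclideanSpace ℝ (Fin d)))
      (h := fun r => U r ^ q) (by fun_prop), hfr]
    gcongr
  have hUfin : ∫⁻ x : EuclideanSpace ℝ (Fin d), U ‖x‖ ^ q ≠ ∞ :=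
    (hUnorm.trans_lt (ENNReal.mul_lt_top hσt.lt_top (ENNReal.mul_lt_top hC.lt_top
      (ENNReal.rpow_lt_top_of_nonneg (div_nonneg hq0.le hp0.le) hIt)))).ne
  have hUae := ae_lt_top (by fun_prop) hUfin
  have hne0 := ae_ne_zero (d := d) (by omega)
  have hle : ∀ᵐ x : EuclideanSpace ℝ (Fin d), sphericalMax E f x ≤ U ‖x‖ := by
    filter_upwards [hne0] with x hx
    rw [sphericalMax_eq_profileMax hE fun t ht => (hrep x hx t ht).2]
    exact (profileMax_le_kernMax hE g (norm_pos_iff.2 hx)).trans (hUle _ (norm_pos_iff.2 hx))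
  have hloc : ∀ a b : ℝ, 0 < a →
      ∫⁻ s in Ioo a b, ENNReal.ofReal (s ^ (d - 2)) * ‖g s‖ₑ < ∞ := by
    intro a b ha
    calc _ ≤ ∫⁻ s in Ioo a b, (ENNReal.ofReal (b ^ (d - 2)) +
          ENNReal.ofReal a⁻¹ * (ENNReal.ofReal (s ^ (d - 1)) * ‖g s‖ₑ ^ p)) := by
          refine setLIntegral_mono' measurableSet_Ioo fun s hs => ?_
          have hs0 : 0 < s := ha.trans hs.1
          rcases le_total ‖g s‖ₑ 1 with h1 | h1
          · refine le_add_right ?_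
            calc _ ≤ ENNReal.ofReal (b ^ (d - 2)) * 1 := by
                  gcongr
                  exact hs.2.le
              _ = _ := mul_one _
          · refine le_add_left ?_
            rw [← mul_assoc, ← ENNReal.ofReal_mul (by positivity)]
            refine mul_le_mul (ENNReal.ofReal_le_ofReal ?_) ?_ zero_le zero_le
            · have : s ^ (d - 1) = s * s ^ (d - 2) := by
                rw [← pow_succ']; congr 1; omega
              rw [this, ← mul_assoc]
              refine le_mul_of_one_le_left (by positivity) ?_
              rw [inv_mul_eq_div, one_le_div ha]
              exact hs.1.le
            · calc ‖g s‖ₑ = ‖g s‖ₑ ^ (1 : ℝ) := (ENNReal.rpow_one _).symm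
                _ ≤ ‖g s‖ₑ ^ p := ENNReal.rpow_le_rpow_of_exponent_le h1 hp
      _ = ENNReal.ofReal (b ^ (d - 2)) * volume (Ioo a b) + ENNReal.ofReal a⁻¹ *
          ∫⁻ s in Ioo a b, (ENNReal.ofReal (s ^ (d - 1)) * ‖g s‖ₑ ^ p) := by
          rw [lintegral_add_left measurable_const, setLIntegral_const,
            lintegral_const_mul' _ _ ENNReal.ofReal_ne_top]
      _ < ∞ := by
          refine ENNReal.add_lt_top.2 ⟨ENNReal.mul_lt_top ENNReal.ofReal_lt_top (by simp),
            ENNReal.mul_lt_top ENNReal.ofReal_lt_top (lt_of_le_of_lt ?_ hIt.lt_top)⟩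
          exact lintegral_mono_set fun s hs => ha.trans hs.1
  -- If the closure of E has positive measure, finiteness of the Hardy operator at almost every r
  -- includes some r with dist(r, E) = 0. At such r it says that s^(d-2) ‖g‖ is integrable near 0.
  have hor : (∃ b, 0 < b ∧ ∫⁻ s in Ioo 0 b, ENNReal.ofReal (s ^ (d - 2)) * ‖g s‖ₑ < ∞) ∨
      volume {r | Metric.infDist r E = 0} = 0 := by
    refine or_iff_not_imp_right.2 fun hvol => ?_
    obtain ⟨C₂, hC₂, h₂⟩ := hmid
    have g₂ := (h₂ _ hGm hIt).trans_lt (ENNReal.mul_lt_top hC₂.lt_top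
      (ENNReal.rpow_lt_top_of_nonneg (div_nonneg hq0.le hp0.le) hIt))
    have hmeas := measurable_lintegral_infDist d E (fun s => ‖g s‖ₑ)
    have hae := ae_lt_top (by fun_prop) g₂.ne
    have hnot : ¬ ∀ᵐ r : ℝ, ¬ Metric.infDist r E = 0 := by
      rw [ae_iff]
      simpa using hvol
    have hfreq : ∃ᶠ r in ae (volume : Measure ℝ), Metric.infDist r E = 0 := hnot
    rw [ae_restrict_iff' measurableSet_Icc] at hae
    obtain ⟨r, hr0, hr⟩ := (hfreq.and_eventually hae).exists
    have hcl : r ∈ Icc (1 : ℝ) 2 := by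
      have : r ∈ closure E := (Metric.mem_closure_iff_infDist_zero hEne).2 hr0
      exact (closure_minimal hE isClosed_Icc) this
    have h3 := hr ⟨by linarith [hcl.1], by linarith [hcl.2]⟩
    rw [hr0] at h3
    refine ⟨6, by norm_num, ?_⟩
    by_contra htop
    rw [not_lt, top_le_iff] at htop
    rw [htop, ENNReal.top_rpow_of_pos hq0] at h3
    exact lt_irrefl _ h3
  have hmeas := aestronglyMeasurable_sphericalMax hd hE hg (fun x hx t ht => (hrep x hx t ht).2)
    hloc hor
  have hbound : eLpNorm (sphericalMax E f) (ENNReal.ofReal q) volume ≤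
      K * eLpNorm f (ENNReal.ofReal p) volume := by
    rw [eLpNorm_eq_lintegral_rpow_enorm_toReal hQ0 ENNReal.ofReal_ne_top,
      ENNReal.toReal_ofReal hq0.le, hfnorm]
    calc _ ≤ (σ * (C * I ^ (q / p))) ^ (1 / q) := by
          refine ENNReal.rpow_le_rpow (le_trans (lintegral_mono_ae ?_) hUnorm) (by positivity)
          filter_upwards [hle] with x hx
          rw [enorm_eq_self]
          exact ENNReal.rpow_le_rpow hx hq0.le
      _ = (σ * C) ^ (1 / q) * I ^ (1 / p) := by
          rw [← mul_assoc, ENNReal.mul_rpow_of_nonneg _ _ (by positivity), ← ENNReal.rpow_mul]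
          congr 2
          field_simp
      _ = _ := by
          rw [hK, ENNReal.mul_rpow_of_nonneg σ I (by positivity : (0 : ℝ) ≤ 1 / p), mul_assoc,
            ← mul_assoc (_)⁻¹, ENNReal.inv_mul_cancel hσp0 hσpt, one_mul]
  refine ⟨?_, ⟨hmeas, hbound.trans_lt (ENNReal.mul_lt_top hKt.lt_top hf.2)⟩, hbound⟩
  filter_upwards [hUae, hne0] with x hxU hx t ht
  have hxpos := norm_pos_iff.2 hx
  rw [(hrep x hx t (by linarith [(hE ht).1])).1]
  have h1 : kernMax d E (fun s => ‖g s‖ₑ) ‖x‖ ≤ U ‖x‖ := hUle _ hxpos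
  have h2 : U ‖x‖ < ∞ := by
    by_contra htop
    rw [not_lt, top_le_iff] at htop
    rw [htop, ENNReal.top_rpow_of_pos hq0] at hxU
    exact lt_irrefl _ hxU
  refine lt_of_le_of_lt ?_ (h1.trans_lt h2)
  exact le_iSup₂ (f := fun (t : ℝ) (_ : t ∈ E) =>
    ∫⁻ s, ENNReal.ofReal (kern d ‖x‖ t s) * ‖g s‖ₑ) t ht

lemma lintegral_kern_eq_one {d : ℕ} (hd : 3 ≤ d) {r t : ℝ} (hr : 0 < r) (ht : 0 < t) :
    ∫⁻ s, ENNReal.ofReal (kern d r t s) = 1 := by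
  have hfr : Module.finrank ℝ (EuclideanSpace ℝ (Fin d)) = d := by simp
  have : Nontrivial (EuclideanSpace ℝ (Fin d)) :=
    Module.nontrivial_of_finrank_pos (R := ℝ) (by omega)
  obtain ⟨x, hx⟩ := exists_norm_eq (EuclideanSpace ℝ (Fin d)) hr.le
  have hx0 : x ≠ 0 := by rintro rfl; simp at hx; linarith
  have h := congrArg (fun μ : Measure ℝ => μ univ) (map_norm_sub_smul_sphereProb hd hx0 ht)
  simp only [withDensity_apply _ MeasurableSet.univ, Measure.restrict_univ, hx] at h
  rw [← h, Measure.map_apply (by fun_prop) MeasurableSet.univ, preimage_univ, Measure.smul_apply,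
    smul_eq_mul]
  refine ENNReal.inv_mul_cancel ?_ (measure_ne_top _ _)
  rw [Ne, Measure.measure_univ_eq_zero]
  exact Measure.toSphere_ne_zero _

/-- Averages contract L^∞ because the kernel has integral one. This is the vertex P_1, separate from
the rest of the sufficiency argument, where p and q are finite. -/
lemma boundedRadial_top {d : ℕ} (hd : 3 ≤ d) {E : Set ℝ} (hE : E ⊆ Icc 1 2) :
    BoundedRadial d E ∞ ∞ := by
  refine ⟨1, fun f hrad hf => ?_⟩
  rw [ENNReal.coe_one, one_mul]
  obtain ⟨g, hg, hfg, hrep⟩ := exists_radial_profile hd hrad hf.1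
  set M := eLpNorm f ∞ volume with hM
  have hMt : M < ∞ := hf.2
  have hgM : ∀ᵐ r ∂(volume.restrict (Ioi (0 : ℝ))), ‖g r‖ₑ ≤ M := by
    have h1 : ∀ᵐ x, ‖f x‖ₑ ≤ M := by
      rw [hM, eLpNorm_exponent_top]
      exact enorm_ae_le_eLpNormEssSup f volume
    have h2 : ∀ᵐ x : EuclideanSpace ℝ (Fin d), ‖g ‖x‖‖ₑ ≤ M := by
      filter_upwards [h1, hfg] with x hx hx'
      rwa [← hx']
    obtain ⟨y, hy, h3⟩ := ae_radial_of_ae (by omega) h2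
    filter_upwards [h3, ae_restrict_mem measurableSet_Ioi] with r hr hr0
    rwa [norm_smul, hy, mul_one, Real.norm_of_nonneg (le_of_lt hr0)] at hr
  have hker : ∀ r t : ℝ, 0 < r → 0 < t →
      ∫⁻ s, ENNReal.ofReal (kern d r t s) * ‖g s‖ₑ ≤ M := by
    intro r t hr ht
    calc _ ≤ ∫⁻ s, ENNReal.ofReal (kern d r t s) * M := by
          refine lintegral_mono_ae ?_
          rw [ae_restrict_iff' measurableSet_Ioi] at hgM
          filter_upwards [hgM] with s hs
          by_cases hs0 : s ∈ Ioi (0 : ℝ)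
          · gcongr
            exact hs hs0
          · rw [kern_of_notMem fun h => hs0 (lt_of_le_of_lt (abs_nonneg _) h.1)]
            simp
      _ = M := by
          rw [lintegral_mul_const' _ _ hMt.ne, lintegral_kern_eq_one hd hr ht, one_mul]
  have hfin : ∀ b, ∫⁻ s in Ioo 0 b, ENNReal.ofReal (s ^ (d - 2)) * ‖g s‖ₑ < ∞ := by
    intro b
    calc _ ≤ ∫⁻ s in Ioo 0 b, ENNReal.ofReal (b ^ (d - 2)) * M := by
          refine lintegral_mono_ae ?_
          filter_upwards [ae_restrict_mem measurableSet_Ioo, ae_restrict_of_ae_restrict_of_subset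
            (fun s hs => hs.1 : Ioo 0 b ⊆ Ioi (0 : ℝ)) hgM] with s hs hsM
          have := hs.1
          gcongr
          exact hs.2.le
      _ < ∞ := by
          rw [setLIntegral_const]
          exact ENNReal.mul_lt_top (ENNReal.mul_lt_top ENNReal.ofReal_lt_top hMt) (by simp)
  have hmeas := aestronglyMeasurable_sphericalMax hd hE hg (fun x hx t ht => (hrep x hx t ht).2)
    (fun a b ha => (lintegral_mono_set (Ioo_subset_Ioo_left ha.le)).trans_lt (hfin b))
    (Or.inl ⟨1, one_pos, hfin 1⟩)
  have hne0 := ae_ne_zero (d := d) (by omega)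
  have hbound : eLpNorm (sphericalMax E f) ∞ volume ≤ M := by
    rw [eLpNorm_exponent_top]
    refine essSup_le_of_ae_le _ ?_
    filter_upwards [hne0] with x hx
    rw [enorm_eq_self, sphericalMax_eq_profileMax hE fun t ht => (hrep x hx t ht).2]
    refine (profileMax_le_kernMax hE g (norm_pos_iff.2 hx)).trans (iSup₂_le fun t ht => ?_)
    exact hker _ _ (norm_pos_iff.2 hx) (by linarith [(hE ht).1])
  refine ⟨?_, ⟨hmeas, hbound.trans_lt hMt⟩, hbound⟩
  filter_upwards [hne0] with x hx t ht
  rw [(hrep x hx t (by linarith [(hE ht).1])).1]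
  exact (hker _ _ (norm_pos_iff.2 hx) (by linarith [(hE ht).1])).trans_lt hMt

/-! ### Testing on balls and shells -/

/-- The total surface measure of the unit sphere. -/
noncomputable abbrev sphereVol (d : ℕ) : ℝ≥0∞ :=
  (volume : Measure (EuclideanSpace ℝ (Fin d))).toSphere univ

lemma sphereVol_ne_zero {d : ℕ} (hd : 1 ≤ d) : sphereVol d ≠ 0 := by
  have hfr : Module.finrank ℝ (EuclideanSpace ℝ (Fin d)) = d := by simp
  have : Nontrivial (EuclideanSpace ℝ (Fin d)) :=
    Module.nontrivial_of_finrank_pos (R := ℝ) (by omega)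
  rw [Ne, Measure.measure_univ_eq_zero]
  exact Measure.toSphere_ne_zero _

lemma volume_norm_preimage {d : ℕ} (hd : 1 ≤ d) {B : Set ℝ} (hB : MeasurableSet B) :
    volume {x : EuclideanSpace ℝ (Fin d) | ‖x‖ ∈ B} =
      sphereVol d * ∫⁻ r in Ioi (0 : ℝ) ∩ B, ENNReal.ofReal (r ^ (d - 1)) := by
  have hfr : Module.finrank ℝ (EuclideanSpace ℝ (Fin d)) = d := by simp
  have : Nontrivial (EuclideanSpace ℝ (Fin d)) :=
    Module.nontrivial_of_finrank_pos (R := ℝ) (by omega)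
  have h := lintegral_fun_norm (volume : Measure (EuclideanSpace ℝ (Fin d)))
    (h := B.indicator 1) (measurable_one.indicator hB)
  have hS : MeasurableSet {x : EuclideanSpace ℝ (Fin d) | ‖x‖ ∈ B} := measurable_norm hB
  rw [← lintegral_indicator_one hS]
  have h2 : ∀ x : EuclideanSpace ℝ (Fin d),
      {x : EuclideanSpace ℝ (Fin d) | ‖x‖ ∈ B}.indicator (1 : EuclideanSpace ℝ (Fin d) → ℝ≥0∞) x =
        B.indicator 1 ‖x‖ := fun x => rfl
  simp_rw [h2]
  rw [h, hfr, inter_comm, ← setLIntegral_indicator hB]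
  congr 1
  refine lintegral_congr fun r => ?_
  by_cases hr : r ∈ B <;> simp [hr]

lemma ofReal_inv_ne_zero (x : ℝ) : (ENNReal.ofReal x)⁻¹ ≠ 0 :=
  ENNReal.inv_ne_zero.2 ENNReal.ofReal_ne_top

/-- The identity includes x = 0: the exponent is then ∞, and both `ENNReal.toReal ∞` and 1/0 are 0.
Infinite exponents thus need no separate treatment in the tests on indicator functions. -/
lemma one_div_toReal_ofReal_inv {x : ℝ} (hx : 0 ≤ x) : 1 / ((ENNReal.ofReal x)⁻¹).toReal = x := by
  rw [ENNReal.toReal_inv, ENNReal.toReal_ofReal hx, one_div, inv_inv]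

/-- Testing a bound on a function whose maximal function is large on a set. -/
lemma le_of_boundedRadial {d : ℕ} {E : Set ℝ} {P : ℝ≥0∞} {y : ℝ} (hy : 0 ≤ y) {C : ℝ≥0}
    (h : ∀ f : EuclideanSpace ℝ (Fin d) → ℂ, IsRadial f → MemLp f P volume →
      eLpNorm (sphericalMax E f) (ENNReal.ofReal y)⁻¹ volume ≤ (C : ℝ≥0∞) * eLpNorm f P volume)
    {f : EuclideanSpace ℝ (Fin d) → ℂ} (hrad : IsRadial f) (hf : MemLp f P volume)
    {A : Set (EuclideanSpace ℝ (Fin d))} (hA : MeasurableSet A) (hA0 : volume A ≠ 0) {c : ℝ≥0∞}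
    (hc : ∀ x ∈ A, c ≤ sphericalMax E f x) :
    c * volume A ^ y ≤ C * eLpNorm f P volume := by
  refine le_trans ?_ (h f hrad hf)
  have h1 : eLpNorm (A.indicator fun _ => c) (ENNReal.ofReal y)⁻¹ volume = c * volume A ^ y := by
    rw [eLpNorm_indicator_const' hA hA0 (ofReal_inv_ne_zero y), one_div_toReal_ofReal_inv hy,
      enorm_eq_self]
  rw [← h1]
  refine eLpNorm_mono_enorm fun x => ?_
  simp only [enorm_eq_self]
  by_cases hx : x ∈ A
  · simpa [hx] using hc x hx
  · simp [hx]

lemma memLp_indicator_one {d : ℕ} {S : Set (EuclideanSpace ℝ (Fin d))} (hS : MeasurableSet S)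
    (hSt : volume S ≠ ∞) (P : ℝ≥0∞) :
    MemLp (S.indicator fun _ => (1 : ℂ)) P volume :=
  memLp_indicator_const P hS 1 (Or.inr hSt)

lemma eLpNorm_indicator_one {d : ℕ} {S : Set (EuclideanSpace ℝ (Fin d))} (hS : MeasurableSet S)
    (hS0 : volume S ≠ 0) {x : ℝ} (hx : 0 ≤ x) :
    eLpNorm (S.indicator fun _ => (1 : ℂ)) (ENNReal.ofReal x)⁻¹ volume = volume S ^ x := by
  rw [eLpNorm_indicator_const' hS hS0 (ofReal_inv_ne_zero x), one_div_toReal_ofReal_inv hx,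
    enorm_one, one_mul]

lemma isRadial_indicator {d : ℕ} (B : Set ℝ) (F : ℝ → ℂ) :
    IsRadial ({x : EuclideanSpace ℝ (Fin d) | ‖x‖ ∈ B}.indicator fun x => F ‖x‖) :=
  ⟨B.indicator F, fun _ => rfl⟩

/-- If the whole sphere lies in `S`, the average of the indicator function of `S` is one. -/
lemma sphericalAvg_indicator_eq_one {d : ℕ} (hd : 1 ≤ d) {S : Set (EuclideanSpace ℝ (Fin d))}
    {t : ℝ} {x : EuclideanSpace ℝ (Fin d)}
    (h : ∀ y : EuclideanSpace ℝ (Fin d), ‖y‖ = 1 → x - t • y ∈ S) :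
    sphericalAvg t (S.indicator fun _ => (1 : ℂ)) x = 1 := by
  have hfr : Module.finrank ℝ (EuclideanSpace ℝ (Fin d)) = d := by simp
  have : Nontrivial (EuclideanSpace ℝ (Fin d)) :=
    Module.nontrivial_of_finrank_pos (R := ℝ) (by omega)
  have h1 : ∀ y : Metric.sphere (0 : EuclideanSpace ℝ (Fin d)) 1,
      (S.indicator fun _ => (1 : ℂ)) (x - t • (y : EuclideanSpace ℝ (Fin d))) = 1 := by
    intro y
    rw [indicator_of_mem (h y (by simp))]
  unfold sphericalAvg
  simp_rw [h1]
  have h2 : NeZero ((volume : Measure (EuclideanSpace ℝ (Fin d))).toSphere) :=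
    ⟨Measure.toSphere_ne_zero _⟩
  exact average_const _ _

lemma le_sphericalMax {d : ℕ} {E : Set ℝ} {f : EuclideanSpace ℝ (Fin d) → ℂ}
    {x : EuclideanSpace ℝ (Fin d)} {t : ℝ} (ht : t ∈ E) :
    ‖sphericalAvg t f x‖ₑ ≤ sphericalMax E f x :=
  le_iSup₂ (f := fun (t : ℝ) (_ : t ∈ E) => ‖sphericalAvg t f x‖ₑ) t ht

/-- Large balls: `q ≥ p` is necessary. -/
lemma le_of_boundedRadial_ball {d : ℕ} (hd : 1 ≤ d) {E : Set ℝ} (hE : E ⊆ Icc 1 2)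
    (hne : E.Nonempty) {x y : ℝ} (hx : 0 ≤ x) (hy : 0 ≤ y)
    (h : BoundedRadial d E (ENNReal.ofReal x)⁻¹ (ENNReal.ofReal y)⁻¹) : y ≤ x := by
  obtain ⟨C, hC⟩ := h
  obtain ⟨t, ht⟩ := hne
  have htE := hE ht
  have hfr : Module.finrank ℝ (EuclideanSpace ℝ (Fin d)) = d := by simp
  set v := volume (Metric.ball (0 : EuclideanSpace ℝ (Fin d)) 1) with hv
  have hv0 : v ≠ 0 := (Metric.measure_ball_pos volume _ one_pos).ne'
  have hvt : v ≠ ∞ := measure_ball_lt_top.ne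
  have hvol : ∀ R : ℝ, 0 < R →
      volume (Metric.ball (0 : EuclideanSpace ℝ (Fin d)) R) = ENNReal.ofReal (R ^ d) * v := by
    intro R hR
    rw [Measure.addHaar_ball_of_pos _ _ hR, hfr]
  by_contra hlt
  rw [not_le] at hlt
  -- For the indicator of the ball of radius R the average is 1 on the ball of radius R - 2, and R -
  -- 2 ≥ R/3 once R ≥ 3.
  have key : ∀ R : ℝ, 3 ≤ R → ENNReal.ofReal (((R / 3) ^ d) ^ y) * v ^ y ≤
      C * (ENNReal.ofReal ((R ^ d) ^ x) * v ^ x) := by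
    intro R hR
    have hR0 : 0 < R := by linarith
    let S : Set (EuclideanSpace ℝ (Fin d)) := {x | ‖x‖ ∈ Iio R}
    have hSb : S = Metric.ball 0 R := by ext z; simp [S]
    have hSm : MeasurableSet S := by rw [hSb]; exact measurableSet_ball
    have hS0 : volume S ≠ 0 := by rw [hSb]; exact (Metric.measure_ball_pos volume _ hR0).ne'
    have hSt : volume S ≠ ∞ := by rw [hSb]; exact measure_ball_lt_top.ne
    have h1 := le_of_boundedRadial hy (fun f hr hf => (hC f hr hf).2.2)
      (isRadial_indicator (Iio R) fun _ => 1) (memLp_indicator_one hSm hSt _)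
      (A := Metric.ball 0 (R - 2)) (c := 1) measurableSet_ball
      (Metric.measure_ball_pos volume _ (by linarith)).ne' (fun z hz => by
        refine le_trans (le_of_eq ?_) (le_sphericalMax ht)
        rw [sphericalAvg_indicator_eq_one hd, enorm_one]
        intro w hw
        have hz' : ‖z‖ < R - 2 := by simpa using hz
        have : ‖z - t • w‖ < R := by
          refine (norm_sub_le _ _).trans_lt ?_
          rw [norm_smul, hw, mul_one, Real.norm_of_nonneg (by linarith [htE.1])]
          linarith [htE.2]
        exact this)
    rw [eLpNorm_indicator_one hSm hS0 hx, one_mul, hSb, hvol R hR0, hvol _ (by linarith),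
      ENNReal.mul_rpow_of_nonneg _ _ hx, ENNReal.mul_rpow_of_nonneg _ _ hy,
      ENNReal.ofReal_rpow_of_nonneg (by positivity) hx,
      ENNReal.ofReal_rpow_of_nonneg (pow_nonneg (by linarith) _) hy] at h1
    refine le_trans ?_ h1
    gcongr
    linarith
  have hvy : 0 < (v ^ y).toReal := ENNReal.toReal_pos
    (ENNReal.rpow_pos (pos_iff_ne_zero.2 hv0) hvt).ne' (ENNReal.rpow_ne_top_of_nonneg hy hvt)
  have key2 : ∀ R : ℝ, 3 ≤ R → R ^ (d * (y - x)) ≤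
      C * (v ^ x).toReal * 3 ^ (d * y) / (v ^ y).toReal := by
    intro R hR
    have hR0 : 0 < R := by linarith
    have h1 := ENNReal.toReal_mono (ENNReal.mul_ne_top ENNReal.coe_ne_top (ENNReal.mul_ne_top
      ENNReal.ofReal_ne_top (ENNReal.rpow_ne_top_of_nonneg hx hvt))) (key R hR)
    rw [ENNReal.toReal_mul, ENNReal.toReal_mul, ENNReal.toReal_mul,
      ENNReal.toReal_ofReal (by positivity), ENNReal.toReal_ofReal (by positivity),
      ENNReal.coe_toReal, ← Real.rpow_natCast, ← Real.rpow_natCast, ← Real.rpow_mul (by positivity),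
      ← Real.rpow_mul hR0.le, Real.div_rpow hR0.le (by norm_num)] at h1
    rw [le_div_iff₀ hvy, mul_sub, Real.rpow_sub hR0]
    have hRx : 0 < R ^ ((d : ℝ) * x) := Real.rpow_pos_of_pos hR0 _
    have h3 : (0 : ℝ) < 3 ^ ((d : ℝ) * y) := by positivity
    rw [div_mul_eq_mul_div, div_le_iff₀ hRx]
    rw [div_mul_eq_mul_div, div_le_iff₀ h3] at h1
    linarith
  have hlim : Tendsto (fun R : ℝ => R ^ (d * (y - x))) atTop atTop :=
    tendsto_rpow_atTop (mul_pos (by exact_mod_cast hd) (by linarith))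
  obtain ⟨R, h1, h2⟩ := ((hlim.eventually_gt_atTop
    (C * (v ^ x).toReal * 3 ^ (d * y) / (v ^ y).toReal)).and (eventually_ge_atTop 3)).exists
  exact absurd (key2 R h2) (not_le.2 h1)

/-- Thin shells: `q ≤ d p` is necessary. -/
lemma le_of_boundedRadial_shell {d : ℕ} (hd : 1 ≤ d) {E : Set ℝ} (hE : E ⊆ Icc 1 2)
    (hne : E.Nonempty) {x y : ℝ} (hx : 0 ≤ x) (hy : 0 ≤ y)
    (h : BoundedRadial d E (ENNReal.ofReal x)⁻¹ (ENNReal.ofReal y)⁻¹) : x ≤ d * y := by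
  obtain ⟨C, hC⟩ := h
  obtain ⟨t, ht⟩ := hne
  have htE := hE ht
  have hfr : Module.finrank ℝ (EuclideanSpace ℝ (Fin d)) = d := by simp
  set v := volume (Metric.ball (0 : EuclideanSpace ℝ (Fin d)) 1) with hv
  have hv0 : v ≠ 0 := (Metric.measure_ball_pos volume _ one_pos).ne'
  have hvt : v ≠ ∞ := measure_ball_lt_top.ne
  have hσ0 := sphereVol_ne_zero hd
  have hσt : sphereVol d ≠ ∞ := measure_ne_top _ _
  set K : ℝ≥0∞ := sphereVol d * ENNReal.ofReal (3 ^ (d - 1) * 2) with hK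
  have hKt : K ≠ ∞ := ENNReal.mul_ne_top hσt ENNReal.ofReal_ne_top
  by_contra hlt
  rw [not_le] at hlt
  -- The shell of width 2δ about radius t has volume O(δ), while its average is 1 on the whole ball
  -- of radius δ, of volume comparable to δ^d.
  have key : ∀ δ ∈ Ioo (0 : ℝ) 1, ENNReal.ofReal ((δ ^ d) ^ y) * v ^ y ≤
      C * (K ^ x * ENNReal.ofReal (δ ^ x)) := by
    intro δ hδ
    let S : Set (EuclideanSpace ℝ (Fin d)) := {x | ‖x‖ ∈ Ioo (t - δ) (t + δ)}
    have hSm : MeasurableSet S := measurable_norm measurableSet_Ioo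
    have hsub : Ioi (0 : ℝ) ∩ Ioo (t - δ) (t + δ) = Ioo (t - δ) (t + δ) := by
      refine inter_eq_right.2 fun s hs => ?_
      have := hs.1
      rw [mem_Ioi]
      linarith [htE.1, hδ.2]
    have hSle : volume S ≤ K * ENNReal.ofReal δ := by
      rw [volume_norm_preimage hd measurableSet_Ioo, hsub, hK, mul_assoc]
      gcongr
      calc _ ≤ ∫⁻ s in Ioo (t - δ) (t + δ), ENNReal.ofReal (3 ^ (d - 1)) := by
            refine setLIntegral_mono' measurableSet_Ioo fun s hs => ENNReal.ofReal_le_ofReal ?_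
            have h1 : 0 ≤ s := by linarith [htE.1, hδ.2, hs.1]
            exact pow_le_pow_left₀ h1 (by linarith [htE.2, hδ.2, hs.2]) _
        _ = _ := by
            rw [setLIntegral_const, Real.volume_Ioo, ← ENNReal.ofReal_mul (by positivity),
              ← ENNReal.ofReal_mul (by positivity)]
            congr 1; ring
    have hS0 : volume S ≠ 0 := by
      have hopen : IsOpen S := isOpen_Ioo.preimage continuous_norm
      have : Nontrivial (EuclideanSpace ℝ (Fin d)) :=
        Module.nontrivial_of_finrank_pos (R := ℝ) (by omega)
      obtain ⟨z, hz⟩ := exists_norm_eq (EuclideanSpace ℝ (Fin d)) (by linarith [htE.1] : 0 ≤ t)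
      refine (hopen.measure_pos volume ⟨z, ?_⟩).ne'
      change ‖z‖ ∈ Ioo (t - δ) (t + δ)
      rw [hz]
      exact ⟨by linarith [hδ.1], by linarith [hδ.1]⟩
    have hSt : volume S ≠ ∞ := (hSle.trans_lt (ENNReal.mul_lt_top hKt.lt_top
      ENNReal.ofReal_lt_top)).ne
    have h1 := le_of_boundedRadial hy (fun f hr hf => (hC f hr hf).2.2)
      (isRadial_indicator (Ioo (t - δ) (t + δ)) fun _ => 1) (memLp_indicator_one hSm hSt _)
      (A := Metric.ball 0 δ) (c := 1) measurableSet_ball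
      (Metric.measure_ball_pos volume _ hδ.1).ne' (fun z hz => by
        refine le_trans (le_of_eq ?_) (le_sphericalMax ht)
        rw [sphericalAvg_indicator_eq_one hd, enorm_one]
        intro w hw
        have hz' : ‖z‖ < δ := by simpa using hz
        have htw : ‖t • w‖ = t := by
          rw [norm_smul, hw, mul_one, Real.norm_of_nonneg (by linarith [htE.1])]
        have h2 : |‖z - t • w‖ - ‖t • w‖| ≤ ‖z‖ := by
          rw [norm_sub_rev]
          refine (abs_norm_sub_norm_le _ _).trans ?_
          simp
        rw [htw] at h2
        have h3 := abs_le.1 h2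
        exact ⟨by linarith [h3.1], by linarith [h3.2]⟩)
    rw [eLpNorm_indicator_one hSm hS0 hx, one_mul, Measure.addHaar_ball_of_pos _ _ hδ.1, hfr,
      ENNReal.mul_rpow_of_nonneg _ _ hy,
      ENNReal.ofReal_rpow_of_nonneg (pow_nonneg hδ.1.le _) hy] at h1
    refine h1.trans ?_
    gcongr
    rw [← ENNReal.ofReal_rpow_of_pos hδ.1, ← ENNReal.mul_rpow_of_nonneg _ _ hx]
    gcongr
  have hvy : 0 < (v ^ y).toReal := ENNReal.toReal_pos
    (ENNReal.rpow_pos (pos_iff_ne_zero.2 hv0) hvt).ne' (ENNReal.rpow_ne_top_of_nonneg hy hvt)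
  have hKx := ENNReal.rpow_ne_top_of_nonneg hx hKt
  have key2 : ∀ δ ∈ Ioo (0 : ℝ) 1, (v ^ y).toReal ≤ C * (K ^ x).toReal * δ ^ (x - d * y) := by
    intro δ hδ
    have h1 := ENNReal.toReal_mono (ENNReal.mul_ne_top ENNReal.coe_ne_top (ENNReal.mul_ne_top
      hKx ENNReal.ofReal_ne_top)) (key δ hδ)
    have hδ0 := hδ.1
    rw [ENNReal.toReal_mul, ENNReal.toReal_mul, ENNReal.toReal_mul,
      ENNReal.toReal_ofReal (by positivity), ENNReal.toReal_ofReal (by positivity),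
      ENNReal.coe_toReal, ← Real.rpow_natCast, ← Real.rpow_mul hδ0.le] at h1
    have h2 : 0 < δ ^ ((d : ℝ) * y) := Real.rpow_pos_of_pos hδ0 _
    rw [Real.rpow_sub hδ0, mul_div_assoc', le_div_iff₀ h2]
    linarith
  have hlim : Tendsto (fun δ : ℝ => C * (K ^ x).toReal * δ ^ (x - d * y)) (𝓝[>] 0) (𝓝 0) := by
    have h1 : Tendsto (fun δ : ℝ => C * (K ^ x).toReal * δ ^ (x - d * y)) (𝓝[>] 0)
        (𝓝 (C * (K ^ x).toReal * 0 ^ (x - d * y))) :=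
      (((Real.continuousAt_rpow_const 0 _ (Or.inr (by linarith))).tendsto).const_mul _).mono_left
        nhdsWithin_le_nhds
    rwa [Real.zero_rpow (by linarith), mul_zero] at h1
  have hmem : ∀ᶠ δ : ℝ in 𝓝[>] 0, δ ∈ Ioo (0 : ℝ) 1 := Ioo_mem_nhdsGT one_pos
  obtain ⟨δ, h1, h2⟩ := ((hlim.eventually_lt_const hvy).and hmem).exists
  exact absurd (key2 δ h2) (not_le.2 h1)

/-! ### Covering numbers and volumes of neighbourhoods -/

lemma exists_cover_of_finset {E : Set ℝ} {δ : ℝ} (F : Finset ℤ) (a : ℤ → ℝ)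
    (h : ∀ e ∈ E, ∃ k ∈ F, e ∈ Icc (a k) (a k + δ)) :
    ∃ b : Fin F.card → ℝ, E ⊆ ⋃ i, Icc (b i) (b i + δ) := by
  refine ⟨fun i => a (F.equivFin.symm i), fun e he => ?_⟩
  obtain ⟨k, hk, hek⟩ := h e he
  rw [mem_iUnion]
  exact ⟨F.equivFin ⟨k, hk⟩, by simpa using hek⟩

/-- The indices of the grid cells of length `η` that meet `E`. -/
noncomputable def gridCells (E : Set ℝ) (η : ℝ) : Set ℤ := (fun e => ⌊e / η⌋) '' E

lemma gridCells_finite {E : Set ℝ} (hE : E ⊆ Icc 1 2) {η : ℝ} (hη : 0 < η) :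
    (gridCells E η).Finite := by
  refine (Set.finite_Icc (⌊1 / η⌋) (⌊2 / η⌋)).subset ?_
  rintro _ ⟨e, he, rfl⟩
  have := hE he
  exact ⟨Int.floor_le_floor (by gcongr; exact this.1), Int.floor_le_floor (by gcongr; exact this.2)⟩

lemma mem_gridCell {η : ℝ} (hη : 0 < η) (e : ℝ) :
    e ∈ Ico (⌊e / η⌋ * η) (⌊e / η⌋ * η + η) := by
  have h1 := Int.floor_le (e / η)
  have h2 := Int.lt_floor_add_one (e / η)
  rw [le_div_iff₀ hη] at h1
  rw [div_lt_iff₀ hη] at h2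
  exact ⟨h1, by linarith⟩

lemma gridCells_cover {E : Set ℝ} (hE : E ⊆ Icc 1 2) {η δ : ℝ} (hη : 0 < η) (hδ : η ≤ δ) :
    ∃ b : Fin (gridCells_finite hE hη).toFinset.card → ℝ, E ⊆ ⋃ i, Icc (b i) (b i + δ) := by
  refine exists_cover_of_finset _ (fun k => k * η) fun e he => ⟨⌊e / η⌋, ?_, ?_⟩
  · rw [Set.Finite.mem_toFinset]
    exact ⟨e, he, rfl⟩
  · have := mem_gridCell hη e
    exact ⟨this.1, by linarith [this.2]⟩

lemma exists_coverNum_cover {E : Set ℝ} (hE : E ⊆ Icc 1 2) {δ : ℝ} (hδ : 0 < δ) :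
    ∃ a : Fin (coverNum E δ) → ℝ, E ⊆ ⋃ i, Icc (a i) (a i + δ) :=
  Nat.sInf_mem (s := {n : ℕ | ∃ a : Fin n → ℝ, E ⊆ ⋃ i, Icc (a i) (a i + δ)})
    ⟨_, gridCells_cover hE hδ le_rfl⟩

lemma one_le_coverNum {E : Set ℝ} (hE : E ⊆ Icc 1 2) (hne : E.Nonempty) {δ : ℝ} (hδ : 0 < δ) :
    1 ≤ coverNum E δ := by
  obtain ⟨a, ha⟩ := exists_coverNum_cover hE hδ
  obtain ⟨e, he⟩ := hne
  obtain ⟨i, -⟩ := mem_iUnion.1 (ha he)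
  exact Nat.one_le_iff_ne_zero.2 fun h => (Fin.cast h i).elim0

lemma coverNum_le {E : Set ℝ} (hE : E ⊆ Icc 1 2) {δ : ℝ} (hδ : 0 < δ) :
    (coverNum E δ : ℝ) ≤ 1 / δ + 2 := by
  have h1 : coverNum E δ ≤ (gridCells_finite hE hδ).toFinset.card :=
    Nat.sInf_le (gridCells_cover hE hδ le_rfl)
  have h2 : (gridCells_finite hE hδ).toFinset ⊆ Finset.Icc (⌊1 / δ⌋) (⌊2 / δ⌋) := by
    intro k hk
    rw [Set.Finite.mem_toFinset] at hk
    obtain ⟨e, he, rfl⟩ := hk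
    have := hE he
    exact Finset.mem_Icc.2 ⟨Int.floor_le_floor (by gcongr; exact this.1),
      Int.floor_le_floor (by gcongr; exact this.2)⟩
  have h3 := h1.trans (Finset.card_le_card h2)
  rw [Int.card_Icc] at h3
  have h4 : (⌊1 / δ⌋ : ℝ) ≤ ⌊2 / δ⌋ := by
    exact_mod_cast Int.floor_le_floor (by gcongr; norm_num)
  have h5 : ((⌊2 / δ⌋ + 1 - ⌊1 / δ⌋).toNat : ℝ) = ⌊2 / δ⌋ + 1 - ⌊1 / δ⌋ := by
    have : ((⌊2 / δ⌋ + 1 - ⌊1 / δ⌋).toNat : ℤ) = ⌊2 / δ⌋ + 1 - ⌊1 / δ⌋ := by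
      refine Int.toNat_of_nonneg ?_
      have : ⌊1 / δ⌋ ≤ ⌊2 / δ⌋ := by exact_mod_cast h4
      omega
    exact_mod_cast this
  have h6 : (coverNum E δ : ℝ) ≤ ⌊2 / δ⌋ + 1 - ⌊1 / δ⌋ := by
    rw [← h5]; exact_mod_cast h3
  have h7 := Int.floor_le (2 / δ)
  have h8 := Int.lt_floor_add_one (1 / δ)
  have h9 : 2 / δ = 1 / δ + 1 / δ := by ring
  linarith

/-- Each covering interval, enlarged by ρ on both sides, has length 3ρ. -/
lemma volume_infDist_lt_le {E : Set ℝ} (hE : E ⊆ Icc 1 2) (hne : E.Nonempty) {ρ : ℝ} (hρ : 0 < ρ) :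
    volume {r : ℝ | Metric.infDist r E < ρ} ≤ ENNReal.ofReal (3 * ρ * coverNum E ρ) := by
  obtain ⟨a, ha⟩ := exists_coverNum_cover hE hρ
  have hsub : {r : ℝ | Metric.infDist r E < ρ} ⊆ ⋃ i, Icc (a i - ρ) (a i + 2 * ρ) := by
    intro r hr
    obtain ⟨e, he, hre⟩ := (Metric.infDist_lt_iff hne).1 hr
    obtain ⟨i, hi⟩ := mem_iUnion.1 (ha he)
    rw [Real.dist_eq, abs_lt] at hre
    exact mem_iUnion.2 ⟨i, by linarith [hi.1, hre.1], by linarith [hi.2, hre.2]⟩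
  refine (measure_mono hsub).trans ((measure_iUnion_le _).trans ?_)
  simp only [Real.volume_Icc, tsum_fintype]
  have h : ∀ i, ENNReal.ofReal (a i + 2 * ρ - (a i - ρ)) = ENNReal.ofReal (3 * ρ) := fun i => by
    congr 1; ring
  simp only [h, Finset.sum_const, Finset.card_univ, Fintype.card_fin, nsmul_eq_mul]
  rw [← ENNReal.ofReal_natCast, ← ENNReal.ofReal_mul (by positivity), mul_comm]

/-- The grid cells of length δ/8 that meet E provide a cover, so there are at least N(E, δ) of them.
They are disjoint and lie within δ/4 of E. The radius δ/4 is chosen so that `le_kern` applies for s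
> δ/2. -/
lemma le_volume_infDist_lt {E : Set ℝ} (hE : E ⊆ Icc 1 2) {δ : ℝ} (hδ : 0 < δ) :
    ENNReal.ofReal (δ * coverNum E δ / 8) ≤ volume {r : ℝ | Metric.infDist r E < δ / 4} := by
  have hη : 0 < δ / 8 := by positivity
  set S := (gridCells_finite hE hη).toFinset with hS
  have h1 : coverNum E δ ≤ S.card := Nat.sInf_le (gridCells_cover hE hη (by linarith))
  have hsub : ⋃ k ∈ S, Ico (k * (δ / 8)) (k * (δ / 8) + δ / 8) ⊆
      {r : ℝ | Metric.infDist r E < δ / 4} := by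
    intro r hr
    simp only [mem_iUnion] at hr
    obtain ⟨k, hk, hr⟩ := hr
    rw [hS, Set.Finite.mem_toFinset] at hk
    obtain ⟨e, he, rfl⟩ := hk
    have h2 := mem_gridCell hη e
    refine (Metric.infDist_le_dist_of_mem he).trans_lt ?_
    rw [Real.dist_eq, abs_lt]
    exact ⟨by linarith [hr.1, h2.2], by linarith [hr.2, h2.1]⟩
  have hdisj : (S : Set ℤ).PairwiseDisjoint
      fun k : ℤ => Ico (k * (δ / 8)) (k * (δ / 8) + δ / 8) := by
    have h : ∀ j k : ℤ, j < k → Disjoint (Ico (j * (δ / 8)) (j * (δ / 8) + δ / 8))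
        (Ico (k * (δ / 8)) (k * (δ / 8) + δ / 8)) := by
      intro j k hjk
      have h3 : (j : ℝ) + 1 ≤ k := by exact_mod_cast hjk
      rw [Set.disjoint_left]
      intro r hr hr'
      have h4 : ((j : ℝ) + 1) * (δ / 8) ≤ k * (δ / 8) := by gcongr
      linarith [hr.2, hr'.1]
    intro j _ k _ hjk
    rcases lt_or_gt_of_ne hjk with h' | h'
    · exact h j k h'
    · exact (h k j h').symm
  refine le_trans ?_ (measure_mono hsub)
  rw [measure_biUnion_finset hdisj fun k _ => measurableSet_Ico]
  simp only [Real.volume_Ico, add_sub_cancel_left, Finset.sum_const, nsmul_eq_mul]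
  rw [← ENNReal.ofReal_natCast, ← ENNReal.ofReal_mul (by positivity)]
  refine ENNReal.ofReal_le_ofReal ?_
  have h5 : (coverNum E δ : ℝ) ≤ S.card := by exact_mod_cast h1
  nlinarith

/-! ### The Minkowski dimension -/

lemma log_coverNum_div_le {E : Set ℝ} (hE : E ⊆ Icc 1 2) (hne : E.Nonempty) {δ : ℝ}
    (hδ : δ ∈ Ioo (0 : ℝ) (1 / 3)) :
    Real.log (coverNum E δ) / Real.log (1 / δ) ∈ Icc (0 : ℝ) (1 + Real.log 2 / Real.log (1 / δ)) := by
  have hδ0 := hδ.1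
  have hL : 0 < Real.log (1 / δ) := Real.log_pos (by rw [lt_div_iff₀ hδ0]; linarith [hδ.2])
  have h1 : (1 : ℝ) ≤ coverNum E δ := by exact_mod_cast one_le_coverNum hE hne hδ0
  refine ⟨div_nonneg (Real.log_nonneg h1) hL.le, ?_⟩
  rw [div_le_iff₀ hL, add_mul, div_mul_cancel₀ _ hL.ne', one_mul,
    ← Real.log_mul (by positivity) (by norm_num)]
  refine Real.log_le_log (by linarith) ((coverNum_le hE hδ0).trans ?_)
  have : 2 ≤ 1 / δ := by rw [le_div_iff₀ hδ0]; linarith [hδ.2]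
  linarith

lemma tendsto_log_one_div : Tendsto (fun δ : ℝ => Real.log (1 / δ)) (𝓝[>] 0) atTop := by
  simp only [one_div]
  exact Real.tendsto_log_atTop.comp tendsto_inv_nhdsGT_zero

lemma eventually_log_coverNum {E : Set ℝ} (hE : E ⊆ Icc 1 2) (hne : E.Nonempty) {c : ℝ}
    (hc : 1 < c) : ∀ᶠ δ : ℝ in 𝓝[>] 0,
      Real.log (coverNum E δ) / Real.log (1 / δ) ∈ Icc (0 : ℝ) c := by
  have h1 : Tendsto (fun δ : ℝ => 1 + Real.log 2 / Real.log (1 / δ)) (𝓝[>] 0) (𝓝 (1 + 0)) :=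
    (tendsto_log_one_div.const_div_atTop _).const_add _
  rw [add_zero] at h1
  filter_upwards [h1.eventually_le_const hc, Ioo_mem_nhdsGT (by norm_num : (0 : ℝ) < 1 / 3)]
    with δ h2 h3
  have h4 := log_coverNum_div_le hE hne h3
  exact ⟨h4.1, h4.2.trans h2⟩

/-- A real-valued `limsup` is meaningful only for a function bounded above and cobounded. The bounds
1 ≤ N(E, δ) ≤ 1/δ + 2 supply this lemma and the next one. -/
lemma isBoundedUnder_log_coverNum {E : Set ℝ} (hE : E ⊆ Icc 1 2) (hne : E.Nonempty) :
    IsBoundedUnder (· ≤ ·) (𝓝[>] 0)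
      fun δ : ℝ => Real.log (coverNum E δ) / Real.log (1 / δ) :=
  ⟨2, (eventually_log_coverNum hE hne one_lt_two).mono fun _ h => h.2⟩

lemma isCoboundedUnder_log_coverNum {E : Set ℝ} (hE : E ⊆ Icc 1 2) (hne : E.Nonempty) :
    IsCoboundedUnder (· ≤ ·) (𝓝[>] 0)
      fun δ : ℝ => Real.log (coverNum E δ) / Real.log (1 / δ) :=
  IsBoundedUnder.isCoboundedUnder_le
    ⟨0, (eventually_log_coverNum hE hne one_lt_two).mono fun _ h => h.1⟩

lemma upperMinkowskiDim_nonneg {E : Set ℝ} (hE : E ⊆ Icc 1 2) (hne : E.Nonempty) :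
    0 ≤ upperMinkowskiDim E :=
  le_limsup_of_frequently_le
    ((eventually_log_coverNum hE hne one_lt_two).mono fun _ h => h.1).frequently
    (isBoundedUnder_log_coverNum hE hne)

lemma upperMinkowskiDim_le_one {E : Set ℝ} (hE : E ⊆ Icc 1 2) (hne : E.Nonempty) :
    upperMinkowskiDim E ≤ 1 :=
  le_of_forall_gt_imp_ge_of_dense fun _ hc => limsup_le_of_le (isCoboundedUnder_log_coverNum hE hne)
    ((eventually_log_coverNum hE hne hc).mono fun _ h => h.2)

lemma upperMinkowskiDim_le {E : Set ℝ} (hE : E ⊆ Icc 1 2) (hne : E.Nonempty) {C b : ℝ}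
    (h : ∀ δ ∈ Ioo (0 : ℝ) 1, (coverNum E δ : ℝ) ≤ C * δ ^ (-b)) : upperMinkowskiDim E ≤ b := by
  refine le_of_forall_gt_imp_ge_of_dense fun c hc =>
    limsup_le_of_le (isCoboundedUnder_log_coverNum hE hne) ?_
  have h1 : Tendsto (fun δ : ℝ => Real.log C / Real.log (1 / δ) + b) (𝓝[>] 0) (𝓝 (0 + b)) :=
    (tendsto_log_one_div.const_div_atTop _).add_const _
  rw [zero_add] at h1
  filter_upwards [h1.eventually_le_const hc, Ioo_mem_nhdsGT (one_pos : (0 : ℝ) < 1)] with δ h2 h3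
  have hδ0 := h3.1
  have hL : 0 < Real.log (1 / δ) := Real.log_pos (by rw [lt_div_iff₀ hδ0]; linarith [h3.2])
  have h4 : (1 : ℝ) ≤ coverNum E δ := by exact_mod_cast one_le_coverNum hE hne hδ0
  have h5 := h δ h3
  have hp : 0 < δ ^ (-b) := Real.rpow_pos_of_pos hδ0 _
  have hC : 0 < C := by
    by_contra hC
    have := mul_nonpos_of_nonpos_of_nonneg (not_lt.1 hC) hp.le
    linarith
  refine le_trans ?_ h2
  rw [div_le_iff₀ hL, add_mul, div_mul_cancel₀ _ hL.ne']
  calc Real.log (coverNum E δ) ≤ Real.log (C * δ ^ (-b)) := Real.log_le_log (by linarith) h5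
    _ = _ := by
      rw [Real.log_mul hC.ne' hp.ne', Real.log_rpow hδ0, one_div, Real.log_inv]
      ring

lemma coverNum_le_rpow {E : Set ℝ} (hE : E ⊆ Icc 1 2) (hne : E.Nonempty) {b : ℝ}
    (hb : upperMinkowskiDim E < b) :
    ∃ C, ∀ δ ∈ Ioo (0 : ℝ) 1, (coverNum E δ : ℝ) ≤ C * δ ^ (-b) := by
  have hb0 : 0 < b := (upperMinkowskiDim_nonneg hE hne).trans_lt hb
  have h1 := eventually_lt_of_limsup_lt hb (isBoundedUnder_log_coverNum hE hne)
  obtain ⟨η, hη, h2⟩ := mem_nhdsGT_iff_exists_Ioo_subset.1 h1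
  -- The dimension controls N only for δ < η; for larger δ the trivial bound N ≤ 1/δ + 2 is at most
  -- 1/η + 2.
  refine ⟨max 1 (1 / η + 2), fun δ hδ => ?_⟩
  have hδ0 := hδ.1
  have hL : 0 < Real.log (1 / δ) := Real.log_pos (by rw [lt_div_iff₀ hδ0]; linarith [hδ.2])
  have h4 : (1 : ℝ) ≤ coverNum E δ := by exact_mod_cast one_le_coverNum hE hne hδ0
  have hp : 0 < δ ^ (-b) := Real.rpow_pos_of_pos hδ0 _
  rcases lt_or_ge δ η with h | h
  · have h3 : Real.log (coverNum E δ) / Real.log (1 / δ) < b := h2 ⟨hδ0, h⟩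
    rw [div_lt_iff₀ hL, one_div, Real.log_inv, mul_neg, ← neg_mul, ← Real.log_rpow hδ0] at h3
    have h5 := (Real.log_lt_log_iff (by linarith) hp).1 h3
    calc (coverNum E δ : ℝ) ≤ 1 * δ ^ (-b) := by linarith
      _ ≤ _ := by gcongr; exact le_max_left _ _
  · have hη0 : (0 : ℝ) < η := hη
    have h3 : 1 ≤ δ ^ (-b) :=
      Real.one_le_rpow_of_pos_of_le_one_of_nonpos hδ0 hδ.2.le (by linarith)
    have h5 : 1 / δ ≤ 1 / η := by gcongr
    calc (coverNum E δ : ℝ) ≤ (1 / η + 2) * 1 := by linarith [coverNum_le hE hδ0]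
      _ ≤ _ := mul_le_mul (le_max_right _ _) h3 zero_le_one (by positivity)

/-! ### Testing on functions concentrated near the origin -/

lemma sphericalAvg_comp_norm {d : ℕ} (hd : 3 ≤ d) {F : ℝ → ℂ} (hF : StronglyMeasurable F)
    {x : EuclideanSpace ℝ (Fin d)} (hx : x ≠ 0) {t : ℝ} (ht : 0 < t) :
    sphericalAvg t (fun x : EuclideanSpace ℝ (Fin d) => F ‖x‖) x =
      ∫ s, kern d ‖x‖ t s • F s := by
  have hmap := map_norm_sub_smul_sphereProb hd hx ht
  have hr : 0 < ‖x‖ := norm_pos_iff.2 hx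
  have hkm := measurable_kern d ‖x‖ t
  have hφm : Measurable fun y : Metric.sphere (0 : EuclideanSpace ℝ (Fin d)) 1 =>
    ‖x - t • (y : EuclideanSpace ℝ (Fin d))‖ := by fun_prop
  rw [sphericalAvg, average]
  have h1 := integral_map (μ := sphereProb d) hφm.aemeasurable (f := F) hF.aestronglyMeasurable
  rw [← h1, hmap]
  have h2 := integral_withDensity_eq_integral_smul (μ := volume)
    (f := fun s => Real.toNNReal (kern d ‖x‖ t s)) (by fun_prop) F
  refine h2.trans (integral_congr_ae (Eventually.of_forall fun s => ?_))
  simp only [NNReal.smul_def, Real.coe_toNNReal _ (kern_nonneg hr ht s)]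

/-- The test function is nonnegative, so there is no cancellation, and its support a < s ≤ b ≤ 1
with 2||x| - t| ≤ a keeps s in the range where `le_kern` holds. -/
lemma lintegral_le_enorm_sphericalAvg {d : ℕ} (hd : 3 ≤ d) {a b : ℝ} (ha : 0 < a) (hb : b ≤ 1)
    {φ : ℝ → ℝ} (hφ : Measurable φ) {M : ℝ} (hφM : ∀ s ∈ Ioc a b, φ s ∈ Icc 0 M)
    {x : EuclideanSpace ℝ (Fin d)} (hx : ‖x‖ ∈ Icc (3 / 4 : ℝ) (9 / 4)) {t : ℝ}
    (ht : t ∈ Icc (1 : ℝ) 2) (hxt : 2 * |‖x‖ - t| ≤ a) :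
    ∫⁻ s in Ioc a b, ENNReal.ofReal (kernConst d * (s / 8) ^ (d - 2) * φ s) ≤
      ‖sphericalAvg t ({x : EuclideanSpace ℝ (Fin d) | ‖x‖ ∈ Ioc a b}.indicator
        fun x => (φ ‖x‖ : ℂ)) x‖ₑ := by
  have hr : 0 < ‖x‖ := by linarith [hx.1]
  have ht0 : 0 < t := by linarith [ht.1]
  set G : ℝ → ℝ := (Ioc a b).indicator φ with hG
  have hGm : Measurable G := hφ.indicator measurableSet_Ioc
  have hG0 : ∀ s, 0 ≤ G s := indicator_nonneg fun s hs => (hφM s hs).1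
  have hfun : ({x : EuclideanSpace ℝ (Fin d) | ‖x‖ ∈ Ioc a b}.indicator fun x => (φ ‖x‖ : ℂ)) =
      fun x => ((G ‖x‖ : ℝ) : ℂ) := by
    funext z
    by_cases hz : ‖z‖ ∈ Ioc a b
    · rw [hG, indicator_of_mem hz, indicator_of_mem (by exact hz)]
    · rw [hG, indicator_of_notMem hz, indicator_of_notMem (by exact hz), Complex.ofReal_zero]
  rw [hfun, sphericalAvg_comp_norm hd (F := fun s => ((G s : ℝ) : ℂ))
    (Complex.measurable_ofReal.comp hGm).stronglyMeasurable (norm_pos_iff.1 hr) ht0]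
  have h1 : ∀ s, kern d ‖x‖ t s • ((G s : ℝ) : ℂ) = ((kern d ‖x‖ t s * G s : ℝ) : ℂ) := by
    intro s; rw [Complex.real_smul, Complex.ofReal_mul]
  simp_rw [h1]
  have hki : Integrable (kern d ‖x‖ t) := by
    refine ⟨(measurable_kern d _ t).aestronglyMeasurable, ?_⟩
    rw [hasFiniteIntegral_iff_ofReal (Eventually.of_forall (kern_nonneg hr ht0)),
      lintegral_kern_eq_one hd hr ht0]
    exact ENNReal.one_lt_top
  have hint : Integrable fun s => kern d ‖x‖ t s * G s := by
    refine hki.mul_bdd (c := max M 0) hGm.aestronglyMeasurable (Eventually.of_forall fun s => ?_)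
    rw [Real.norm_of_nonneg (hG0 s)]
    by_cases hs : s ∈ Ioc a b
    · rw [hG, indicator_of_mem hs]; exact (hφM s hs).2.trans (le_max_left _ _)
    · rw [hG, indicator_of_notMem hs]; exact le_max_right _ _
  have h0 : ∀ s, 0 ≤ kern d ‖x‖ t s * G s := fun s => mul_nonneg (kern_nonneg hr ht0 s) (hG0 s)
  rw [integral_complex_ofReal, ← ofReal_norm, Complex.norm_real,
    Real.norm_of_nonneg (integral_nonneg h0),
    ofReal_integral_eq_lintegral_ofReal hint (Eventually.of_forall h0)]
  refine le_trans (setLIntegral_mono' measurableSet_Ioc fun s hs => ?_)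
    (setLIntegral_le_lintegral (Ioc a b) _)
  refine ENNReal.ofReal_le_ofReal ?_
  rw [hG, indicator_of_mem hs]
  exact mul_le_mul_of_nonneg_right
    (le_kern hd hx ht (ha.trans hs.1) (hxt.trans hs.1.le) (hs.2.trans hb)) (hφM s hs).1

/-- The set of points whose distance to the sphere system `E` is small has large volume. -/
lemma le_volume_norm_infDist_lt {d : ℕ} (hd : 1 ≤ d) {E : Set ℝ} (hE : E ⊆ Icc 1 2)
    (hne : E.Nonempty) {δ : ℝ} (hδ : δ ∈ Ioo (0 : ℝ) 1) :
    sphereVol d * ENNReal.ofReal ((3 / 4) ^ (d - 1) / 8 * (δ * coverNum E δ)) ≤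
      volume {x : EuclideanSpace ℝ (Fin d) | ‖x‖ ∈ {r : ℝ | Metric.infDist r E < δ / 4}} := by
  have hm : MeasurableSet {r : ℝ | Metric.infDist r E < δ / 4} :=
    measurableSet_lt (Metric.continuous_infDist_pt E).measurable measurable_const
  have hpos : ∀ r ∈ {r : ℝ | Metric.infDist r E < δ / 4}, 3 / 4 ≤ r := by
    intro r hr
    obtain ⟨e, he, hre⟩ := (Metric.infDist_lt_iff hne).1 hr
    rw [Real.dist_eq, abs_lt] at hre
    linarith [(hE he).1, hδ.2, hre.1]
  rw [volume_norm_preimage hd hm, inter_eq_right.2 fun r hr => by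
    rw [mem_Ioi]; linarith [hpos r hr]]
  gcongr
  calc ENNReal.ofReal ((3 / 4) ^ (d - 1) / 8 * (δ * coverNum E δ))
      = ENNReal.ofReal ((3 / 4) ^ (d - 1)) * ENNReal.ofReal (δ * coverNum E δ / 8) := by
        rw [← ENNReal.ofReal_mul (by positivity)]; congr 1; ring
    _ ≤ ENNReal.ofReal ((3 / 4) ^ (d - 1)) * volume {r : ℝ | Metric.infDist r E < δ / 4} := by
        gcongr; exact le_volume_infDist_lt hE hδ.1
    _ = ∫⁻ r in {r : ℝ | Metric.infDist r E < δ / 4}, ENNReal.ofReal ((3 / 4) ^ (d - 1)) := by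
        rw [setLIntegral_const]
    _ ≤ _ := setLIntegral_mono' hm fun r hr => ENNReal.ofReal_le_ofReal
        (pow_le_pow_left₀ (by norm_num) (hpos r hr) _)

/-- The common part of the two tests on functions concentrated near the origin. -/
lemma le_of_boundedRadial_near {d : ℕ} (hd : 3 ≤ d) {E : Set ℝ} (hE : E ⊆ Icc 1 2)
    (hne : E.Nonempty) {x y : ℝ} (hy : 0 ≤ y) {C : ℝ≥0}
    (h : ∀ f : EuclideanSpace ℝ (Fin d) → ℂ, IsRadial f → MemLp f (ENNReal.ofReal x)⁻¹ volume →
      eLpNorm (sphericalMax E f) (ENNReal.ofReal y)⁻¹ volume ≤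
        (C : ℝ≥0∞) * eLpNorm f (ENNReal.ofReal x)⁻¹ volume)
    {δ a b : ℝ} (hδ : δ ∈ Ioo (0 : ℝ) 1) (ha : δ / 2 ≤ a) (hb : b ≤ 1) {φ : ℝ → ℝ}
    (hφ : Measurable φ) {M : ℝ} (hφM : ∀ s ∈ Ioc a b, φ s ∈ Icc 0 M) :
    (∫⁻ s in Ioc a b, ENNReal.ofReal (kernConst d * (s / 8) ^ (d - 2) * φ s)) *
      (sphereVol d * ENNReal.ofReal ((3 / 4) ^ (d - 1) / 8 * (δ * coverNum E δ))) ^ y ≤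
      C * eLpNorm ({x : EuclideanSpace ℝ (Fin d) | ‖x‖ ∈ Ioc a b}.indicator
        fun x => (φ ‖x‖ : ℂ)) (ENNReal.ofReal x)⁻¹ volume := by
  have hm : MeasurableSet {r : ℝ | Metric.infDist r E < δ / 4} :=
    measurableSet_lt (Metric.continuous_infDist_pt E).measurable measurable_const
  have hvol := le_volume_norm_infDist_lt (by omega : 1 ≤ d) hE hne hδ
  have hN : (1 : ℝ) ≤ coverNum E δ := by exact_mod_cast one_le_coverNum hE hne hδ.1
  have hδ0 := hδ.1
  have ha0 : 0 < a := by linarith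
  have hpos : 0 < sphereVol d * ENNReal.ofReal ((3 / 4) ^ (d - 1) / 8 * (δ * coverNum E δ)) := by
    refine ENNReal.mul_pos (sphereVol_ne_zero (by omega)) (ENNReal.ofReal_pos.2 ?_).ne'
    positivity
  have hS : MeasurableSet {x : EuclideanSpace ℝ (Fin d) | ‖x‖ ∈ Ioc a b} :=
    measurable_norm measurableSet_Ioc
  have hSt : volume {x : EuclideanSpace ℝ (Fin d) | ‖x‖ ∈ Ioc a b} ≠ ∞ := by
    refine ((measure_mono fun z hz => ?_).trans_lt
      (measure_closedBall_lt_top (x := (0 : EuclideanSpace ℝ (Fin d))) (r := b))).ne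
    simpa using hz.2
  have hmem : MemLp ({x : EuclideanSpace ℝ (Fin d) | ‖x‖ ∈ Ioc a b}.indicator
      fun x => (φ ‖x‖ : ℂ)) (ENNReal.ofReal x)⁻¹ volume := by
    refine (memLp_indicator_const (ENNReal.ofReal x)⁻¹ hS M (Or.inr hSt)).mono ?_ ?_
    · exact (((Complex.measurable_ofReal.comp (hφ.comp measurable_norm))).indicator
        hS).aestronglyMeasurable
    · refine Eventually.of_forall fun z => ?_
      by_cases hz : ‖z‖ ∈ Ioc a b
      · have := hφM _ hz
        rw [indicator_of_mem (by exact hz), indicator_of_mem (by exact hz), Complex.norm_real]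
        exact abs_le_abs_of_nonneg this.1 this.2
      · rw [indicator_of_notMem (by exact hz), norm_zero]
        exact norm_nonneg _
  refine le_trans ?_ (le_of_boundedRadial hy h (isRadial_indicator (Ioc a b) fun s => (φ s : ℂ))
    hmem (measurable_norm hm) (hpos.trans_le hvol).ne'
    (c := ∫⁻ s in Ioc a b, ENNReal.ofReal (kernConst d * (s / 8) ^ (d - 2) * φ s))
    (fun z hz => ?_))
  · gcongr
    exact hvol
  · obtain ⟨e, he, hze⟩ := (Metric.infDist_lt_iff hne).1 hz
    have heE := hE he
    rw [Real.dist_eq] at hze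
    have h2 := abs_lt.1 hze
    refine le_trans ?_ (le_sphericalMax he)
    exact lintegral_le_enorm_sphericalAvg hd ha0 hb hφ hφM
      ⟨by linarith [heE.1, hδ.2], by linarith [heE.2, hδ.2]⟩ heE (by linarith)

lemma toReal_mul_rpow {v : ℝ≥0∞} {c : ℝ} (hc : 0 ≤ c) (y : ℝ) :
    ((v * ENNReal.ofReal c) ^ y).toReal = v.toReal ^ y * c ^ y := by
  rw [← ENNReal.toReal_rpow, ENNReal.toReal_mul, ENNReal.toReal_ofReal hc,
    Real.mul_rpow ENNReal.toReal_nonneg hc]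

/-- Testing on indicator functions of small balls. -/
lemma coverNum_bound_of_boundedRadial {d : ℕ} (hd : 3 ≤ d) {E : Set ℝ} (hE : E ⊆ Icc 1 2)
    (hne : E.Nonempty) {x y : ℝ} (hx : 0 ≤ x) (hy : 0 ≤ y)
    (h : BoundedRadial d E (ENNReal.ofReal x)⁻¹ (ENNReal.ofReal y)⁻¹) :
    ∃ C, ∀ δ ∈ Ioo (0 : ℝ) 1, (δ * coverNum E δ) ^ y * δ ^ (d - 1) ≤ C * δ ^ (d * x) := by
  obtain ⟨C, hC⟩ := h
  have hσ : 0 < (sphereVol d).toReal :=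
    ENNReal.toReal_pos (sphereVol_ne_zero (by omega)) (measure_ne_top _ _)
  have hk := kernConst_pos d
  set A : ℝ := kernConst d * (1 / 16) ^ (d - 2) / 2 * (sphereVol d).toReal ^ y *
    ((3 / 4) ^ (d - 1) / 8) ^ y with hA
  have hA0 : 0 < A := by positivity
  refine ⟨C * (sphereVol d).toReal ^ x / A, fun δ hδ => ?_⟩
  have hδ0 := hδ.1
  have hN : (1 : ℝ) ≤ coverNum E δ := by exact_mod_cast one_le_coverNum hE hne hδ0
  -- The annulus δ/2 < |x| ≤ δ stands in for the ball. On it s > δ/2 = 2 · δ/4, as the lower bound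
  -- for the kernel requires on the δ/4-neighbourhood of E.
  have key := le_of_boundedRadial_near hd hE hne (x := x) hy (fun f hr hf => (hC f hr hf).2.2) hδ
    (a := δ / 2) (b := δ) le_rfl hδ.2.le (φ := fun _ => 1) measurable_const (M := 1)
    (fun s _ => ⟨zero_le_one, le_rfl⟩)
  have hlow : ENNReal.ofReal (kernConst d * (1 / 16) ^ (d - 2) / 2 * δ ^ (d - 1)) ≤
      ∫⁻ s in Ioc (δ / 2) δ, ENNReal.ofReal (kernConst d * (s / 8) ^ (d - 2) * 1) := by
    calc _ = ∫⁻ s in Ioc (δ / 2) δ, ENNReal.ofReal (kernConst d * (δ / 16) ^ (d - 2)) := by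
          rw [setLIntegral_const, Real.volume_Ioc, ← ENNReal.ofReal_mul (by positivity)]
          congr 1
          rw [show d - 1 = (d - 2) + 1 by omega, pow_succ, div_pow, div_pow]
          ring
      _ ≤ _ := setLIntegral_mono' measurableSet_Ioc fun s hs => ENNReal.ofReal_le_ofReal (by
          rw [mul_one]
          gcongr ?_ * ?_ ^ _
          linarith [hs.1])
  have hup : eLpNorm ({x : EuclideanSpace ℝ (Fin d) | ‖x‖ ∈ Ioc (δ / 2) δ}.indicator
      fun _ => ((1 : ℝ) : ℂ)) (ENNReal.ofReal x)⁻¹ volume ≤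
      (sphereVol d * ENNReal.ofReal (δ ^ d)) ^ x := by
    have hS : MeasurableSet {x : EuclideanSpace ℝ (Fin d) | ‖x‖ ∈ Ioc (δ / 2) δ} :=
      measurable_norm measurableSet_Ioc
    refine (eLpNorm_indicator_const_le _ _).trans ?_
    rw [one_div_toReal_ofReal_inv hx, Complex.ofReal_one, enorm_one, one_mul]
    gcongr
    rw [volume_norm_preimage (by omega) measurableSet_Ioc]
    gcongr
    calc _ ≤ ∫⁻ r in Ioc 0 δ, ENNReal.ofReal (δ ^ (d - 1)) := by
          refine (lintegral_mono_set (t := Ioc 0 δ) fun r hr => ⟨hr.1, hr.2.2⟩).trans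
            (setLIntegral_mono' measurableSet_Ioc fun r hr => ENNReal.ofReal_le_ofReal ?_)
          exact pow_le_pow_left₀ hr.1.le hr.2 _
      _ = _ := by
          rw [setLIntegral_const, Real.volume_Ioc, ← ENNReal.ofReal_mul (by positivity), sub_zero,
            ← pow_succ, show d - 1 + 1 = d by omega]
  have hfin : (sphereVol d * ENNReal.ofReal (δ ^ d)) ^ x ≠ ∞ :=
    ENNReal.rpow_ne_top_of_nonneg hx (ENNReal.mul_ne_top (measure_ne_top _ _) ENNReal.ofReal_ne_top)
  have h1 := ENNReal.toReal_mono (ENNReal.mul_ne_top ENNReal.coe_ne_top hfin)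
    (((mul_le_mul_left hlow _).trans key).trans (mul_le_mul_right hup (C : ℝ≥0∞)))
  rw [ENNReal.toReal_mul, ENNReal.toReal_mul, ENNReal.toReal_ofReal (by positivity),
    toReal_mul_rpow (by positivity), toReal_mul_rpow (by positivity), ENNReal.coe_toReal,
    Real.mul_rpow (by positivity) (by positivity)] at h1
  rw [Real.rpow_mul hδ0.le, Real.rpow_natCast, div_mul_eq_mul_div, le_div_iff₀ hA0, hA]
  linarith

lemma lintegral_Ioc_inv {δ c : ℝ} (hδ : δ ∈ Ioo (0 : ℝ) 1) (hc : 0 ≤ c) :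
    ∫⁻ s in Ioc δ 1, ENNReal.ofReal (c * s⁻¹) = ENNReal.ofReal (c * Real.log (1 / δ)) := by
  have hδ0 := hδ.1
  have hint : IntegrableOn (fun s : ℝ => c * s⁻¹) (Ioc δ 1) := by
    refine (ContinuousOn.integrableOn_Icc ?_).mono_set Ioc_subset_Icc_self
    exact continuousOn_const.mul (continuousOn_id.inv₀ fun s hs => (hδ0.trans_le hs.1).ne')
  rw [← ofReal_integral_eq_lintegral_ofReal hint, integral_const_mul,
    ← intervalIntegral.integral_of_le hδ.2.le, integral_inv_of_pos hδ0 one_pos]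
  filter_upwards [ae_restrict_mem measurableSet_Ioc] with s hs
  have : 0 < s := hδ0.trans hs.1
  simp only [Pi.zero_apply]
  positivity

/-- At `x = (d - 1) / d`, testing on a truncation of `|x| ^ (1 - d)`. -/
lemma log_bound_of_boundedRadial {d : ℕ} (hd : 3 ≤ d) {E : Set ℝ} (hE : E ⊆ Icc 1 2)
    (hne : E.Nonempty) {x y : ℝ} (hx : x = ((d : ℝ) - 1) / d) (hy : 0 ≤ y)
    (h : BoundedRadial d E (ENNReal.ofReal x)⁻¹ (ENNReal.ofReal y)⁻¹) :
    ∃ C, ∀ δ ∈ Ioo (0 : ℝ) 1,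
      (δ * coverNum E δ) ^ y * Real.log (1 / δ) ≤ C * Real.log (1 / δ) ^ x := by
  obtain ⟨C, hC⟩ := h
  have hσ : 0 < (sphereVol d).toReal :=
    ENNReal.toReal_pos (sphereVol_ne_zero (by omega)) (measure_ne_top _ _)
  have hk := kernConst_pos d
  have hd' : (3 : ℝ) ≤ d := by exact_mod_cast hd
  have hx0 : 0 < x := by rw [hx]; exact div_pos (by linarith) (by linarith)
  set B : ℝ := kernConst d * (1 / 8) ^ (d - 2) with hB
  set A : ℝ := B * (sphereVol d).toReal ^ y * ((3 / 4) ^ (d - 1) / 8) ^ y with hA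
  have hB0 : 0 < B := by positivity
  have hA0 : 0 < A := by positivity
  refine ⟨C * (sphereVol d).toReal ^ x / A, fun δ hδ => ?_⟩
  have hδ0 := hδ.1
  have hL : 0 < Real.log (1 / δ) := Real.log_pos (by rw [lt_div_iff₀ hδ0]; linarith [hδ.2])
  have hN : (1 : ℝ) ≤ coverNum E δ := by exact_mod_cast one_le_coverNum hE hne hδ0
  have key := le_of_boundedRadial_near hd hE hne (x := x) hy (fun f hr hf => (hC f hr hf).2.2) hδ
    (a := δ) (b := 1) (by linarith) le_rfl (φ := fun s => (s ^ (d - 1))⁻¹) (by fun_prop)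
    (M := (δ ^ (d - 1))⁻¹) (fun s hs => by
      have hs0 : 0 < s := hδ0.trans hs.1
      refine ⟨by positivity, ?_⟩
      gcongr
      exact hs.1.le)
  -- The kernel s^(d-2) against s^(1-d) leaves 1/s, so the average grows like log(1/δ).
  have hlow : ∫⁻ s in Ioc δ 1, ENNReal.ofReal (kernConst d * (s / 8) ^ (d - 2) * (s ^ (d - 1))⁻¹) =
      ENNReal.ofReal (B * Real.log (1 / δ)) := by
    rw [← lintegral_Ioc_inv hδ hB0.le]
    refine setLIntegral_congr_fun measurableSet_Ioc fun s hs => ?_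
    have hs0 : 0 < s := hδ0.trans hs.1
    congr 1
    rw [show d - 1 = (d - 2) + 1 by omega, pow_succ, hB, div_pow, div_pow, one_pow]
    field_simp
  have hup : eLpNorm ({x : EuclideanSpace ℝ (Fin d) | ‖x‖ ∈ Ioc δ 1}.indicator
      fun x => (((‖x‖ ^ (d - 1))⁻¹ : ℝ) : ℂ)) (ENNReal.ofReal x)⁻¹ volume =
      (sphereVol d * ENNReal.ofReal (Real.log (1 / δ))) ^ x := by
    have hfr : Module.finrank ℝ (EuclideanSpace ℝ (Fin d)) = d := by simp
    have : Nontrivial (EuclideanSpace ℝ (Fin d)) :=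
      Module.nontrivial_of_finrank_pos (R := ℝ) (by omega)
    rw [eLpNorm_eq_lintegral_rpow_enorm_toReal (ofReal_inv_ne_zero x)
      (ENNReal.inv_ne_top.2 (ENNReal.ofReal_pos.2 hx0).ne'), one_div_toReal_ofReal_inv hx0.le,
      ENNReal.toReal_inv, ENNReal.toReal_ofReal hx0.le]
    congr 1
    have h2 := lintegral_fun_norm (volume : Measure (EuclideanSpace ℝ (Fin d)))
      (h := (Ioc δ 1).indicator fun s => ENNReal.ofReal ((s ^ (d - 1))⁻¹ ^ x⁻¹))
      (Measurable.indicator (by fun_prop) measurableSet_Ioc)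
    have h3 : ∀ z : EuclideanSpace ℝ (Fin d),
        ‖({x : EuclideanSpace ℝ (Fin d) | ‖x‖ ∈ Ioc δ 1}.indicator
          fun x => (((‖x‖ ^ (d - 1))⁻¹ : ℝ) : ℂ)) z‖ₑ ^ x⁻¹ =
        (Ioc δ 1).indicator (fun s => ENNReal.ofReal ((s ^ (d - 1))⁻¹ ^ x⁻¹)) ‖z‖ := by
      intro z
      by_cases hz : ‖z‖ ∈ Ioc δ 1
      · rw [indicator_of_mem (by exact hz), indicator_of_mem hz, ← ofReal_norm, Complex.norm_real,
          Real.norm_of_nonneg (by positivity),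
          ENNReal.ofReal_rpow_of_nonneg (by positivity) (by positivity)]
      · rw [indicator_of_notMem (by exact hz), indicator_of_notMem hz, enorm_zero,
          ENNReal.zero_rpow_of_pos (by positivity)]
    rw [lintegral_congr h3, h2, hfr]
    congr 1
    have h4 := lintegral_Ioc_inv hδ zero_le_one
    rw [one_mul] at h4
    rw [← h4, ← lintegral_indicator measurableSet_Ioc, ← lintegral_indicator measurableSet_Ioi]
    refine lintegral_congr fun s => ?_
    by_cases hs : s ∈ Ioc δ 1
    · have hs0 : 0 < s := hδ0.trans hs.1
      rw [indicator_of_mem hs, indicator_of_mem (by exact hs0), indicator_of_mem hs,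
        ← ENNReal.ofReal_mul (by positivity)]
      congr 1
      -- For 1/p = (d-1)/d the p-th power of s^(1-d) is s^(-d). With the weight s^(d-1) it again
      -- leaves 1/s, so the norm grows only like log(1/δ)^(1/p).
      have h5 : ((s ^ (d - 1))⁻¹) ^ x⁻¹ = (s ^ d)⁻¹ := by
        rw [← Real.rpow_natCast, ← Real.rpow_neg hs0.le, ← Real.rpow_mul hs0.le,
          ← Real.rpow_natCast, ← Real.rpow_neg hs0.le]
        congr 1
        rw [Nat.cast_sub (by omega), Nat.cast_one, hx]
        have : (d : ℝ) - 1 ≠ 0 := by linarith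
        field_simp
      rw [h5, one_mul, ← pow_sub_one_mul (by omega : d ≠ 0) s]
      field_simp
    · rw [indicator_of_notMem hs]
      by_cases hs0 : s ∈ Ioi (0 : ℝ)
      · rw [indicator_of_mem hs0, indicator_of_notMem hs, mul_zero]
      · rw [indicator_of_notMem hs0]
  have hfin : (sphereVol d * ENNReal.ofReal (Real.log (1 / δ))) ^ x ≠ ∞ :=
    ENNReal.rpow_ne_top_of_nonneg hx0.le
      (ENNReal.mul_ne_top (measure_ne_top _ _) ENNReal.ofReal_ne_top)
  rw [hlow, hup] at key
  have h1 := ENNReal.toReal_mono (ENNReal.mul_ne_top ENNReal.coe_ne_top hfin) key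
  rw [ENNReal.toReal_mul, ENNReal.toReal_mul, ENNReal.toReal_ofReal (by positivity),
    toReal_mul_rpow (by positivity), toReal_mul_rpow hL.le, ENNReal.coe_toReal,
    Real.mul_rpow (by positivity) (by positivity)] at h1
  rw [div_mul_eq_mul_div, le_div_iff₀ hA0, hA]
  linarith

/-! ### The triangle described by linear inequalities -/

lemma mem_segment_vertices {d : ℕ} (hd : 3 ≤ d) {β : ℝ} (hβ0 : 0 ≤ β) {z : ℝ × ℝ} :
    z ∈ segment ℝ (vertexTwo d β) (vertexThree d β) ↔
      z.2 ≤ z.1 ∧ z.1 ≤ d * z.2 ∧ (d : ℝ) - 1 - d * z.1 + (1 - β) * z.2 = 0 := by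
  have hd' : (3 : ℝ) ≤ d := by exact_mod_cast hd
  have h2 : 0 < (d : ℝ) - 1 + β := by linarith
  have h3 : 0 < (d : ℝ) ^ 2 - 1 + β := by nlinarith
  have h1 : 0 < (d : ℝ) - 1 := by linarith
  set u := ((d : ℝ) - 1) / ((d : ℝ) - 1 + β) with hu
  set v := ((d : ℝ) - 1) / ((d : ℝ) ^ 2 - 1 + β) with hv
  have hu0 : 0 < u := div_pos h1 h2
  have hv0 : 0 < v := div_pos h1 h3
  have hu1 : u * ((d : ℝ) - 1 + β) = d - 1 := div_mul_cancel₀ _ h2.ne'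
  have hv1 : v * ((d : ℝ) ^ 2 - 1 + β) = d - 1 := div_mul_cancel₀ _ h3.ne'
  have hV2 : vertexTwo d β = (u, u) := rfl
  have hV3 : vertexThree d β = (d * v, v) := by
    rw [vertexThree, mul_div_assoc]
  rw [hV2, hV3]
  obtain ⟨x, y⟩ := z
  simp only
  constructor
  · rintro ⟨a, b, ha, hb, hab, h⟩
    simp only [Prod.smul_mk, smul_eq_mul, Prod.mk_add_mk, Prod.mk.injEq] at h
    obtain ⟨rfl, rfl⟩ := h
    have hau : 0 ≤ a * u := by positivity
    have hbv : 0 ≤ b * v := by positivity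
    refine ⟨by nlinarith, by nlinarith, ?_⟩
    linear_combination (-a) * hu1 - b * hv1 - (d - 1) * hab
  · rintro ⟨hyx, hxy, hL⟩
    -- The vertices are u(1, 1) and v(d, 1), and these weights solve the two coordinate equations.
    -- The first two conditions make them nonnegative, the third makes their sum 1.
    refine ⟨(d * y - x) / ((d - 1) * u), (x - y) / ((d - 1) * v), div_nonneg (by linarith)
      (by positivity), div_nonneg (by linarith) (by positivity), ?_, ?_⟩
    · have e1 : ((d - 1) * u)⁻¹ = ((d : ℝ) - 1 + β) / (d - 1) ^ 2 := by
        rw [hu]; field_simp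
      have e2 : ((d - 1) * v)⁻¹ = ((d : ℝ) ^ 2 - 1 + β) / (d - 1) ^ 2 := by
        rw [hv]; field_simp
      rw [div_eq_mul_inv, div_eq_mul_inv, e1, e2]
      field_simp
      linear_combination (-((d : ℝ) - 1)) * hL
    · simp only [Prod.smul_mk, smul_eq_mul, Prod.mk_add_mk, Prod.mk.injEq]
      constructor
      · field_simp
        ring
      · field_simp
        ring

/-- With P_1 at the origin, the triangle is the union of the segments from 0 to the opposite edge.
The two sides through the origin are homogeneous conditions, so scaling reduces membership to
`mem_segment_vertices`. -/
lemma mem_triangle {d : ℕ} (hd : 3 ≤ d) {β : ℝ} (hβ0 : 0 ≤ β) {z : ℝ × ℝ} :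
    z ∈ triangle d β ↔
      z.2 ≤ z.1 ∧ z.1 ≤ d * z.2 ∧ 0 ≤ (d : ℝ) - 1 - d * z.1 + (1 - β) * z.2 := by
  have hd' : (3 : ℝ) ≤ d := by exact_mod_cast hd
  rw [triangle, convexHull_insert (insert_nonempty _ _), convexHull_pair, mem_convexJoin]
  simp only [mem_singleton_iff, exists_eq_left]
  constructor
  · rintro ⟨w, hw, a, b, ha, hb, hab, rfl⟩
    obtain ⟨h1, h2, h3⟩ := (mem_segment_vertices hd hβ0).1 hw
    simp only [Prod.fst_add, Prod.snd_add, Prod.smul_fst, Prod.smul_snd, smul_eq_mul, mul_zero,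
      zero_add]
    refine ⟨by gcongr, by nlinarith, ?_⟩
    have hb1 : b ≤ 1 := by linarith
    have : (d : ℝ) - 1 - d * (b * w.1) + (1 - β) * (b * w.2) = (1 - b) * (d - 1) := by
      linear_combination b * h3
    rw [this]
    exact mul_nonneg (by linarith) (by linarith)
  · obtain ⟨x, y⟩ := z
    simp only
    rintro ⟨h1, h2, h3⟩
    have hy : 0 ≤ y := by nlinarith
    have hx : 0 ≤ x := hy.trans h1
    rcases hx.eq_or_lt with rfl | hx
    · obtain rfl : y = 0 := le_antisymm h1 hy
      refine ⟨vertexTwo d β, left_mem_segment _ _ _, left_mem_segment _ _ _⟩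
    -- The linear form D equals 1 on the edge opposite to the origin, so (x, y)/D is the point where
    -- the ray through (x, y) meets that edge.
    · set D := (d * x - (1 - β) * y) / (d - 1) with hD
      have h4 : 0 < (d : ℝ) - 1 := by linarith
      have hD0 : 0 < D := div_pos (by nlinarith) h4
      have hD1 : D ≤ 1 := by rw [hD, div_le_one h4]; linarith
      have hD2 : D * (d - 1) = d * x - (1 - β) * y := div_mul_cancel₀ _ h4.ne'
      refine ⟨(x / D, y / D), (mem_segment_vertices hd hβ0).2 ⟨?_, ?_, ?_⟩,
        1 - D, D, by linarith, hD0.le, by ring, ?_⟩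
      · simp only; gcongr
      · simp only; rw [mul_div_assoc']; gcongr
      · simp only
        field_simp
        linear_combination hD2
      · simp only [Prod.smul_mk, smul_eq_mul, Prod.mk_add_mk, Prod.mk.injEq, mul_zero, zero_add]
        constructor <;> field_simp

lemma isClosed_triangle {d : ℕ} (β : ℝ) : IsClosed (triangle d β) :=
  ((Set.toFinite _).isCompact_convexHull ℝ).isClosed

/-- The triangle with the edge opposite to the origin removed is dense in it. -/
lemma triangle_subset_closure {d : ℕ} (hd : 3 ≤ d) {β : ℝ} (hβ0 : 0 ≤ β) :
    triangle d β ⊆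
      closure {z ∈ triangle d β | 0 < (d : ℝ) - 1 - d * z.1 + (1 - β) * z.2} := by
  have hd' : (3 : ℝ) ≤ d := by exact_mod_cast hd
  intro z hz
  have hlim : Tendsto (fun l : ℝ => l • z) (𝓝[<] 1) (𝓝 z) := by
    have : Tendsto (fun l : ℝ => l • z) (𝓝 1) (𝓝 ((1 : ℝ) • z)) :=
      (continuous_id.smul continuous_const).tendsto 1
    rw [one_smul] at this
    exact this.mono_left nhdsWithin_le_nhds
  refine mem_closure_of_tendsto hlim ?_
  filter_upwards [Ioo_mem_nhdsLT (one_pos : (0 : ℝ) < 1)] with l hl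
  obtain ⟨h1, h2, h3⟩ := (mem_triangle hd hβ0).1 hz
  have hl0 := hl.1
  have hl1 := hl.2
  have h4 : 0 < (d : ℝ) - 1 - d * (l * z.1) + (1 - β) * (l * z.2) := by
    have : (d : ℝ) - 1 - d * (l * z.1) + (1 - β) * (l * z.2) =
      (1 - l) * (d - 1) + l * (d - 1 - d * z.1 + (1 - β) * z.2) := by ring
    rw [this]
    have h5 : 0 < (1 - l) * ((d : ℝ) - 1) := mul_pos (by linarith) (by linarith)
    have h6 := mul_nonneg hl0.le h3
    linarith
  refine ⟨(mem_triangle hd hβ0).2 ⟨?_, ?_, ?_⟩, ?_⟩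
  · simp only [Prod.smul_fst, Prod.smul_snd, smul_eq_mul]; gcongr
  · simp only [Prod.smul_fst, Prod.smul_snd, smul_eq_mul]; nlinarith
  · simpa using h4.le
  · simpa using h4

/-! ### Necessity -/

lemma rpow_le_of_le_rpow {a b y : ℝ} (ha : 0 ≤ a) (hy : 0 < y) (h : a ^ y ≤ b) : a ≤ b ^ (1 / y) := by
  have h1 := Real.rpow_le_rpow (Real.rpow_nonneg ha y) h (by positivity : 0 ≤ 1 / y)
  rwa [← Real.rpow_mul ha, mul_one_div_cancel hy.ne', Real.rpow_one] at h1

lemma exists_coverNum_le_of_bound {d : ℕ} (hd : 1 ≤ d) {E : Set ℝ} {x y : ℝ} (hy : 0 < y)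
    (h : ∃ C, ∀ δ ∈ Ioo (0 : ℝ) 1, (δ * coverNum E δ) ^ y * δ ^ (d - 1) ≤ C * δ ^ (d * x)) :
    ∃ C, ∀ δ ∈ Ioo (0 : ℝ) 1,
      (coverNum E δ : ℝ) ≤ C * δ ^ (-(1 - (d * x - (d - 1)) / y)) := by
  obtain ⟨C, hC⟩ := h
  refine ⟨(max C 0) ^ (1 / y), fun δ hδ => ?_⟩
  have hδ0 := hδ.1
  have h1 : (δ * coverNum E δ) ^ y ≤ max C 0 * δ ^ (d * x - (d - 1)) := by
    have h2 : (δ * coverNum E δ) ^ y * δ ^ (d - 1) ≤ max C 0 * δ ^ (d * x) :=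
      (hC δ hδ).trans (by gcongr; exact le_max_left _ _)
    have h3 : δ ^ ((d : ℝ) * x - (d - 1)) = δ ^ (d * x) / δ ^ (d - 1) := by
      rw [Real.rpow_sub hδ0, ← Real.rpow_natCast δ (d - 1), Nat.cast_sub hd, Nat.cast_one]
    rw [h3, mul_div_assoc', le_div_iff₀ (by positivity)]
    exact h2
  have h4 := rpow_le_of_le_rpow (by positivity) hy h1
  rw [Real.mul_rpow (le_max_right _ _) (by positivity), ← Real.rpow_mul hδ0.le,
    mul_one_div] at h4
  have h5 : δ ^ (-(1 - (d * x - (d - 1)) / y)) = δ ^ ((d * x - (d - 1)) / y) / δ := by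
    rw [neg_sub, Real.rpow_sub hδ0, Real.rpow_one]
  rw [h5, mul_div_assoc', le_div_iff₀ hδ0]
  linarith

/-- Each side comes from one test: large balls, thin shells, and functions at |x| ~ δ. The last
bounds the upper Minkowski dimension by 1 - (dx - (d-1))/y, a form of the third inequality; y = 0
forces x = 0 by the shell test. -/
lemma radialTypeSet_subset_triangle {d : ℕ} (hd : 3 ≤ d) {E : Set ℝ} (hE : E ⊆ Icc 1 2)
    (hne : E.Nonempty) : radialTypeSet d E ⊆ triangle d (upperMinkowskiDim E) := by
  rintro ⟨x, y⟩ ⟨⟨hx0, hx1⟩, ⟨hy0, hy1⟩, h⟩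
  simp only at hx0 hx1 hy0 hy1 h
  have hd' : (3 : ℝ) ≤ d := by exact_mod_cast hd
  have h1 := le_of_boundedRadial_ball (by omega) hE hne hx0 hy0 h
  have h2 := le_of_boundedRadial_shell (by omega) hE hne hx0 hy0 h
  refine (mem_triangle hd (upperMinkowskiDim_nonneg hE hne)).2 ⟨h1, h2, ?_⟩
  simp only
  rcases hy0.eq_or_lt with rfl | hy0
  · obtain rfl : x = 0 := by linarith
    linarith
  obtain ⟨C, hC⟩ := exists_coverNum_le_of_bound (by omega : 1 ≤ d) hy0
    (coverNum_bound_of_boundedRadial hd hE hne hx0 hy0.le h)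
  have h3 := upperMinkowskiDim_le hE hne hC
  have h4 : (d * x - (d - 1)) / y * y = d * x - (d - 1) := div_mul_cancel₀ _ hy0.ne'
  nlinarith

/-- On the edge the covering exponent forced by the small-scale test is exactly β, with no loss, so
boundedness at a single edge point already bounds δ^β N(E, δ). -/
lemma bddAbove_of_mem_edge {d : ℕ} (hd : 3 ≤ d) {E : Set ℝ} (hE : E ⊆ Icc 1 2)
    (hne : E.Nonempty) {z : ℝ × ℝ} (hz : z ∈ radialTypeSet d E)
    (hL : (d : ℝ) - 1 - d * z.1 + (1 - upperMinkowskiDim E) * z.2 = 0) :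
    BddAbove ((fun δ : ℝ => δ ^ upperMinkowskiDim E * (coverNum E δ : ℝ)) '' Ioo 0 1) := by
  obtain ⟨x, y⟩ := z
  obtain ⟨⟨hx0, hx1⟩, ⟨hy0, hy1⟩, h⟩ := hz
  simp only at hx0 hx1 hy0 hy1 h hL
  have hd' : (3 : ℝ) ≤ d := by exact_mod_cast hd
  have h2 := le_of_boundedRadial_shell (by omega) hE hne hx0 hy0 h
  have hy : 0 < y := by
    rcases hy0.eq_or_lt with rfl | hy0
    · obtain rfl : x = 0 := by linarith
      linarith
    · exact hy0
  obtain ⟨C, hC⟩ := exists_coverNum_le_of_bound (by omega : 1 ≤ d) hy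
    (coverNum_bound_of_boundedRadial hd hE hne hx0 hy0 h)
  have h3 : 1 - (d * x - (d - 1)) / y = upperMinkowskiDim E := by
    field_simp
    linarith
  rw [h3] at hC
  refine ⟨C, ?_⟩
  rintro _ ⟨δ, hδ, rfl⟩
  have h4 := hC δ hδ
  have h5 : 0 < δ ^ upperMinkowskiDim E := Real.rpow_pos_of_pos hδ.1 _
  rw [Real.rpow_neg hδ.1.le, ← div_eq_mul_inv, le_div_iff₀ h5] at h4
  simp only
  linarith

/-- The logarithmic test leaves the power 1 - x = 1/d of log(1/δ); extracting the root of order y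
turns it into q/d. -/
lemma bddAbove_log_of_mem {d : ℕ} (hd : 3 ≤ d) {E : Set ℝ} (hE : E ⊆ Icc 1 2)
    (hne : E.Nonempty) {z : ℝ × ℝ} (hz : z ∈ radialTypeSet d E)
    (hx : z.1 = ((d : ℝ) - 1) / d) :
    BddAbove ((fun δ : ℝ => δ * Real.log (1 / δ) ^ ((1 / z.2) / (d : ℝ)) *
      (coverNum E δ : ℝ)) '' Ioo 0 (1 / 2)) := by
  obtain ⟨x, y⟩ := z
  obtain ⟨⟨hx0, hx1⟩, ⟨hy0, hy1⟩, h⟩ := hz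
  simp only at hx0 hx1 hy0 hy1 h hx ⊢
  have hd' : (3 : ℝ) ≤ d := by exact_mod_cast hd
  have h2 := le_of_boundedRadial_shell (by omega) hE hne hx0 hy0 h
  have hx' : 0 < x := by rw [hx]; exact div_pos (by linarith) (by linarith)
  have hy : 0 < y := by
    rcases hy0.eq_or_lt with rfl | hy0
    · linarith
    · exact hy0
  obtain ⟨C, hC⟩ := log_bound_of_boundedRadial hd hE hne hx hy0 h
  refine ⟨C ^ (1 / y), ?_⟩
  rintro _ ⟨δ, hδ, rfl⟩
  have hδ0 := hδ.1
  have hδ1 : δ < 1 := by linarith [hδ.2]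
  have hL : 0 < Real.log (1 / δ) := Real.log_pos (by rw [lt_div_iff₀ hδ0]; linarith)
  have h3 := hC δ ⟨hδ0, hδ1⟩
  have h4 : (δ * Real.log (1 / δ) ^ ((1 / y) / (d : ℝ)) * coverNum E δ) ^ y ≤ C := by
    have h5 : (δ * Real.log (1 / δ) ^ ((1 / y) / (d : ℝ)) * coverNum E δ) ^ y =
        (δ * coverNum E δ) ^ y * Real.log (1 / δ) / Real.log (1 / δ) ^ x := by
      rw [mul_right_comm, Real.mul_rpow (by positivity) (by positivity), ← Real.rpow_mul hL.le,
        mul_div_assoc]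
      congr 1
      have : 1 / y / (d : ℝ) * y = 1 - x := by rw [hx]; field_simp; ring
      rw [this, Real.rpow_sub hL, Real.rpow_one]
    rw [h5, div_le_iff₀ (by positivity)]
    exact h3
  exact rpow_le_of_le_rpow (by positivity) hy h4

/-! ### Sufficiency -/

lemma mem_radialTypeSet_of_midBound {d : ℕ} (hd : 3 ≤ d) {E : Set ℝ} (hE : E ⊆ Icc 1 2)
    (hne : E.Nonempty) {x y : ℝ} (hy : 0 < y) (hx1 : x ≤ 1) (hyx : y ≤ x) (hxy : x ≤ d * y)
    (h : x < d * y ∨ x < 1) (hmid : MidBound d E (1 / x) (1 / y)) :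
    (x, y) ∈ radialTypeSet d E := by
  have hx : 0 < x := hy.trans_le hyx
  refine ⟨⟨hx.le, hx1⟩, ⟨hy.le, hyx.trans hx1⟩, ?_⟩
  simp only
  rw [← ENNReal.ofReal_inv_of_pos hx, ← ENNReal.ofReal_inv_of_pos hy, ← one_div, ← one_div]
  refine boundedRadial_of_midBound hd hE hne ?_ ?_ ?_ ?_ hmid
  · rwa [le_div_iff₀ hx, one_mul]
  · gcongr
  · rw [mul_one_div, div_le_div_iff₀ hy hx]; linarith
  · refine h.imp (fun h => ?_) fun h => ?_
    · rw [mul_one_div, div_lt_div_iff₀ hy hx]; linarith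
    · rwa [lt_div_iff₀ hx, one_mul]

lemma volume_inter_infDist_lt_le {E : Set ℝ} (hE : E ⊆ Icc 1 2) (hne : E.Nonempty) {b : ℝ}
    (hb : b ≤ 1) (h : ∃ C, ∀ δ ∈ Ioo (0 : ℝ) 1, (coverNum E δ : ℝ) ≤ C * δ ^ (-b)) :
    ∃ C, 0 ≤ C ∧ ∀ ρ : ℝ, 0 < ρ → volume (Icc (1 / 2 : ℝ) 4 ∩ {r | Metric.infDist r E < ρ}) ≤
      ENNReal.ofReal (C * ρ ^ (1 - b)) := by
  obtain ⟨C, hC⟩ := h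
  refine ⟨max (3 * C) 4, by positivity, fun ρ hρ => ?_⟩
  rcases lt_or_ge ρ 1 with h1 | h1
  · refine (measure_mono inter_subset_right).trans ((volume_infDist_lt_le hE hne hρ).trans
      (ENNReal.ofReal_le_ofReal ?_))
    have h2 := hC ρ ⟨hρ, h1⟩
    have h3 : ρ ^ (1 - b) = ρ * ρ ^ (-b) := by
      rw [sub_eq_add_neg, Real.rpow_add hρ, Real.rpow_one]
    calc 3 * ρ * (coverNum E ρ : ℝ) ≤ 3 * ρ * (C * ρ ^ (-b)) := by gcongr
      _ = 3 * C * ρ ^ (1 - b) := by rw [h3]; ring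
      _ ≤ _ := by gcongr; exact le_max_left _ _
  · refine (volume_inter_le _).trans (ENNReal.ofReal_le_ofReal ?_)
    have h2 : 1 ≤ ρ ^ (1 - b) := Real.one_le_rpow h1 (by linarith)
    calc (4 : ℝ) = 4 * 1 := by ring
      _ ≤ _ := mul_le_mul (le_max_right _ _) h2 zero_le_one (by positivity)

/-- A positive power of ρ beats every power of the logarithm. This settles p = d/(d-1) when β < 1.
-/
lemma rpow_le_log_rpow {κ a : ℝ} (hκ : 0 < κ) (ha : 0 < a) :
    ∃ C, 0 ≤ C ∧ ∀ ρ ∈ Ioo (0 : ℝ) (1 / 2), ρ ^ κ ≤ C * Real.log (1 / ρ) ^ (-a) := by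
  refine ⟨(κ / a)⁻¹ ^ a, by positivity, fun ρ hρ => ?_⟩
  have hρ0 := hρ.1
  have hL : 0 < Real.log (1 / ρ) :=
    Real.log_pos (by rw [lt_div_iff₀ hρ0]; linarith [hρ.2])
  have h1 := Real.log_le_rpow_div (by positivity : 0 ≤ 1 / ρ) (by positivity : 0 < κ / a)
  have h2 := Real.rpow_le_rpow hL.le h1 ha.le
  rw [Real.div_rpow (by positivity) (by positivity), ← Real.rpow_mul (by positivity),
    div_mul_cancel₀ _ ha.ne'] at h2
  have h3 : 0 < ρ ^ κ := Real.rpow_pos_of_pos hρ0 _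
  have h4 : 0 < (κ / a) ^ a := by positivity
  have h5 : 0 < Real.log (1 / ρ) ^ a := by positivity
  have h6 : (1 / ρ) ^ κ = (ρ ^ κ)⁻¹ := by rw [one_div, Real.inv_rpow hρ0.le]
  rw [h6, le_div_iff₀ h4] at h2
  rw [Real.rpow_neg hL.le, Real.inv_rpow (by positivity), ← mul_inv,
    le_inv_comm₀ h3 (by positivity), mul_comm]
  exact h2

lemma exponent_eq {d : ℕ} {x y : ℝ} :
    1 / y * (d / (1 / x) - (d - 1)) = (d * x - (d - 1)) / y := by
  rw [div_div_eq_mul_div, div_one, one_div, inv_mul_eq_div]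

lemma mem_radialTypeSet_of_log {d : ℕ} (hd : 3 ≤ d) {E : Set ℝ} (hE : E ⊆ Icc 1 2)
    (hne : E.Nonempty) {x y : ℝ} (hyx : y ≤ x) (hxy : x ≤ d * y) (hx : x = ((d : ℝ) - 1) / d)
    {C : ℝ} (hC : 0 ≤ C) (hM : ∀ ρ ∈ Ioo (0 : ℝ) (1 / 2),
      volume (Icc (1 / 2 : ℝ) 4 ∩ {r | Metric.infDist r E < ρ}) ≤
      ENNReal.ofReal (C * Real.log (1 / ρ) ^ (-(1 / y / d)))) :
    (x, y) ∈ radialTypeSet d E := by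
  have hd' : (3 : ℝ) ≤ d := by exact_mod_cast hd
  have hx0 : 0 < x := by rw [hx]; exact div_pos (by linarith) (by linarith)
  have hx1 : x < 1 := by rw [hx, div_lt_one (by linarith)]; linarith
  have hy : 0 < y := pos_of_mul_pos_right (hx0.trans_le hxy) (by linarith)
  refine mem_radialTypeSet_of_midBound hd hE hne hy hx1.le hyx hxy (Or.inr hx1)
    (midBound_of_log (by omega) hE hne ?_ (by gcongr) hC hM)
  rw [hx, one_div_div]

/-- The hypothesis `hbxy` says that the exponent κ of `midBound_of_pow` equals 1 - b, the decay
exponent of the neighbourhood measure for N = O(δ^(-b)). -/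
lemma mem_radialTypeSet_of_pow {d : ℕ} (hd : 3 ≤ d) {E : Set ℝ} (hE : E ⊆ Icc 1 2)
    (hne : E.Nonempty) {x y b : ℝ} (hy : 0 < y) (hx1 : x < 1) (hyx : y ≤ x) (hxy : x ≤ d * y)
    (hb : b < 1) (hbxy : (1 - b) * y = d * x - (d - 1))
    (h : ∃ C, ∀ δ ∈ Ioo (0 : ℝ) 1, (coverNum E δ : ℝ) ≤ C * δ ^ (-b)) :
    (x, y) ∈ radialTypeSet d E := by
  have hx : 0 < x := hy.trans_le hyx
  have h1 : 1 / y * (d / (1 / x) - (d - 1)) = 1 - b := by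
    rw [exponent_eq, ← hbxy, mul_div_cancel_right₀ _ hy.ne']
  obtain ⟨C, hC0, hC⟩ := volume_inter_infDist_lt_le hE hne hb.le h
  refine mem_radialTypeSet_of_midBound hd hE hne hy hx1.le hyx hxy (Or.inr hx1)
    (midBound_of_pow (by omega) hE hne ?_ (by gcongr) ?_ hC0 ?_)
  · rwa [lt_div_iff₀ hx, one_mul]
  · rw [h1]; linarith
  · rwa [h1]

/-- The three cases compare p with d/(d-1). Strictness of `hL` leaves room for some b > β in the
covering bound, rules out p = 1, and forces β < 1 at p = d/(d-1). -/
lemma mem_radialTypeSet_of_lt {d : ℕ} (hd : 3 ≤ d) {E : Set ℝ} (hE : E ⊆ Icc 1 2)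
    (hne : E.Nonempty) {z : ℝ × ℝ} (hz : z ∈ triangle d (upperMinkowskiDim E))
    (hL : 0 < (d : ℝ) - 1 - d * z.1 + (1 - upperMinkowskiDim E) * z.2) :
    z ∈ radialTypeSet d E := by
  have hd' : (3 : ℝ) ≤ d := by exact_mod_cast hd
  have hβ0 := upperMinkowskiDim_nonneg hE hne
  have hβ1 := upperMinkowskiDim_le_one hE hne
  obtain ⟨x, y⟩ := z
  obtain ⟨h1, h2, -⟩ := (mem_triangle hd hβ0).1 hz
  simp only at h1 h2 hL
  have hy0 : 0 ≤ y := by nlinarith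
  rcases hy0.eq_or_lt with rfl | hy
  · obtain rfl : x = 0 := by linarith
    refine ⟨by simp, by simp, ?_⟩
    simpa using boundedRadial_top hd hE
  have hx : 0 < x := hy.trans_le h1
  have hx1 : x < 1 := by nlinarith
  rcases lt_trichotomy (d * x) ((d : ℝ) - 1) with h | h | h
  · refine mem_radialTypeSet_of_midBound hd hE hne hy hx1.le h1 h2 (Or.inr hx1)
      (midBound_of_integrable_weight (by omega) E (γ := 1 / (1 - x)) ?_ (by positivity) ?_ ?_)
    · rwa [lt_div_iff₀ hx, one_mul]
    · have : 1 - x ≠ 0 := by linarith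
      field_simp
      ring
    · rw [div_lt_iff₀ (by linarith)]; linarith
  · have hβ : upperMinkowskiDim E < 1 := by nlinarith
    obtain ⟨b, hb1, hb2⟩ := exists_between hβ
    obtain ⟨C, hC0, hC⟩ := volume_inter_infDist_lt_le hE hne hb2.le (coverNum_le_rpow hE hne hb1)
    obtain ⟨K, hK0, hK⟩ := rpow_le_log_rpow (by linarith : 0 < 1 - b)
      (by positivity : 0 < 1 / y / d)
    refine mem_radialTypeSet_of_log hd hE hne h1 h2 ?_ (mul_nonneg hC0 hK0) fun ρ hρ => ?_
    · rw [eq_div_iff (by linarith)]; linarith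
    · refine (hC ρ hρ.1).trans (ENNReal.ofReal_le_ofReal ?_)
      rw [mul_assoc]
      exact mul_le_mul_of_nonneg_left (hK ρ hρ) hC0
  -- The point lies on the edge line belonging to b = 1 - (dx - (d-1))/y. By `hL` this b exceeds the
  -- dimension, so N = O(δ^(-b)) holds automatically.
  · have h3 : (d * x - (d - 1)) / y * y = d * x - (d - 1) := div_mul_cancel₀ _ hy.ne'
    have h4 : 0 < (d * x - (d - 1)) / y := div_pos (by linarith) hy
    refine mem_radialTypeSet_of_pow hd hE hne (b := 1 - (d * x - (d - 1)) / y) hy hx1 h1 h2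
      (by linarith) (by linarith) (coverNum_le_rpow hE hne ?_)
    have h5 : (d * x - (d - 1)) / y < 1 - upperMinkowskiDim E := by
      rw [div_lt_iff₀ hy]; linarith
    linarith

/-- The hypothesis permits the exponent b = β itself, so the whole closed edge is reached. -/
lemma mem_radialTypeSet_of_bddAbove {d : ℕ} (hd : 3 ≤ d) {E : Set ℝ} (hE : E ⊆ Icc 1 2)
    (hne : E.Nonempty) (hβ : upperMinkowskiDim E < 1)
    (hb : BddAbove ((fun δ : ℝ => δ ^ upperMinkowskiDim E * (coverNum E δ : ℝ)) '' Ioo 0 1))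
    {z : ℝ × ℝ} (hz : z ∈ triangle d (upperMinkowskiDim E))
    (hL : (d : ℝ) - 1 - d * z.1 + (1 - upperMinkowskiDim E) * z.2 = 0) :
    z ∈ radialTypeSet d E := by
  have hd' : (3 : ℝ) ≤ d := by exact_mod_cast hd
  have hβ0 := upperMinkowskiDim_nonneg hE hne
  obtain ⟨x, y⟩ := z
  obtain ⟨h1, h2, -⟩ := (mem_triangle hd hβ0).1 hz
  simp only at h1 h2 hL
  have hy : 0 < y := by
    have hy0 : 0 ≤ y := by nlinarith
    rcases hy0.eq_or_lt with rfl | hy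
    · obtain rfl : x = 0 := by linarith
      linarith
    · exact hy
  obtain ⟨C, hC⟩ := hb
  have hN : ∃ C, ∀ δ ∈ Ioo (0 : ℝ) 1, (coverNum E δ : ℝ) ≤ C * δ ^ (-upperMinkowskiDim E) := by
    refine ⟨C, fun δ hδ => ?_⟩
    have h3 : δ ^ upperMinkowskiDim E * (coverNum E δ : ℝ) ≤ C := hC ⟨δ, hδ, rfl⟩
    rw [Real.rpow_neg hδ.1.le, ← div_eq_mul_inv, le_div_iff₀ (Real.rpow_pos_of_pos hδ.1 _)]
    linarith
  have hx1 : x ≤ 1 := by nlinarith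
  rcases hx1.lt_or_eq with hx1 | rfl
  · exact mem_radialTypeSet_of_pow hd hE hne hy hx1 h1 h2 hβ (by linarith) hN
  -- At x = 1 the edge equation reads (1 - β)y = 1. With y ≤ 1 and β ≥ 0 this gives y = 1 and β = 0,
  -- the case p = q = 1 left to `midBound_one`.
  · have hy1 : y = 1 := by nlinarith
    subst hy1
    have hβ' : upperMinkowskiDim E = 0 := by linarith
    obtain ⟨K, hK0, hK⟩ := volume_inter_infDist_lt_le hE hne hβ.le hN
    rw [hβ'] at hK
    simp only [sub_zero, Real.rpow_one] at hK
    refine mem_radialTypeSet_of_midBound hd hE hne one_pos le_rfl le_rfl (by linarith)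
      (Or.inl (by linarith)) ?_
    rw [div_one]
    exact midBound_one (by omega) hK0 hK

/-- For β = 1 the edge lies on the vertical line x = (d-1)/d. There the bound 3ρ N(E, ρ) for the
neighbourhood measure turns the hypothesis into the one of `midBound_of_log`. -/
lemma mem_radialTypeSet_of_bddAbove_log {d : ℕ} (hd : 3 ≤ d) {E : Set ℝ} (hE : E ⊆ Icc 1 2)
    (hne : E.Nonempty) (hβ : upperMinkowskiDim E = 1) {z : ℝ × ℝ} (hz : z ∈ triangle d 1)
    (hb : BddAbove ((fun δ : ℝ => δ * Real.log (1 / δ) ^ ((1 / z.2) / (d : ℝ)) *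
      (coverNum E δ : ℝ)) '' Ioo 0 (1 / 2))) :
    z ∈ radialTypeSet d E := by
  have hd' : (3 : ℝ) ≤ d := by exact_mod_cast hd
  obtain ⟨h1, h2, h3⟩ := (mem_triangle hd zero_le_one).1 hz
  rcases h3.lt_or_eq with h3 | h3
  · exact mem_radialTypeSet_of_lt hd hE hne (by rwa [hβ]) (by rwa [hβ])
  obtain ⟨x, y⟩ := z
  simp only at h1 h2 h3 hb
  obtain ⟨C, hC⟩ := hb
  refine mem_radialTypeSet_of_log hd hE hne h1 h2 (by rw [eq_div_iff (by linarith)]; linarith)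
    (C := max (3 * C) 0) (le_max_right _ _) fun ρ hρ => ?_
  refine (measure_mono inter_subset_right).trans ((volume_infDist_lt_le hE hne hρ.1).trans
      (ENNReal.ofReal_le_ofReal ?_))
  have hL : 0 < Real.log (1 / ρ) :=
    Real.log_pos (by rw [lt_div_iff₀ hρ.1]; linarith [hρ.2])
  have h4 : ρ * Real.log (1 / ρ) ^ ((1 / y) / (d : ℝ)) * coverNum E ρ ≤ C := hC ⟨ρ, hρ, rfl⟩
  rw [Real.rpow_neg hL.le, ← div_eq_mul_inv, le_div_iff₀ (by positivity)]
  refine le_trans ?_ (le_max_left _ _)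
  linarith

end RadialSpherical

theorem theorem1p1 (d : ℕ) (hd : 3 ≤ d) (E : Set ℝ) (hE : E ⊆ Set.Icc 1 2)
    (hne : E.Nonempty) (β : ℝ) (hβ : β = RadialSpherical.upperMinkowskiDim E) :
    closure (RadialSpherical.radialTypeSet d E) = RadialSpherical.triangle d β ∧
    (β < 1 →
      BddAbove ((fun δ : ℝ => δ ^ β * (RadialSpherical.coverNum E δ : ℝ)) '' Set.Ioo 0 1) →
      RadialSpherical.radialTypeSet d E = RadialSpherical.triangle d β) ∧
    (β < 1 →
      ¬ BddAbove ((fun δ : ℝ => δ ^ β * (RadialSpherical.coverNum E δ : ℝ)) '' Set.Ioo 0 1) →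
      RadialSpherical.radialTypeSet d E = RadialSpherical.triangle d β \
        segment ℝ (RadialSpherical.vertexTwo d β) (RadialSpherical.vertexThree d β)) ∧
    (β = 1 →
      RadialSpherical.radialTypeSet d E =
        {z ∈ RadialSpherical.triangle d 1 |
          z.1 < ((d : ℝ) - 1) / (d : ℝ) ∨
          -- here `1 / z.2` is `q`, since `z = (1/p, 1/q)`
          BddAbove ((fun δ : ℝ => δ * Real.log (1 / δ) ^ ((1 / z.2) / (d : ℝ)) *
            (RadialSpherical.coverNum E δ : ℝ)) '' Set.Ioo 0 (1 / 2))}) := by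
  open RadialSpherical in
  have hd' : (3 : ℝ) ≤ d := by exact_mod_cast hd
  have hβ0 := upperMinkowskiDim_nonneg hE hne
  have hsub := radialTypeSet_subset_triangle hd hE hne
  subst hβ
  refine ⟨?_, fun hβ hb => ?_, fun hβ hb => ?_, fun hβ => ?_⟩
  · refine subset_antisymm (closure_minimal hsub (isClosed_triangle _)) ?_
    refine (triangle_subset_closure hd hβ0).trans (closure_mono ?_)
    exact fun z hz => mem_radialTypeSet_of_lt hd hE hne hz.1 hz.2
  · refine subset_antisymm hsub fun z hz => ?_
    rcases ((mem_triangle hd hβ0).1 hz).2.2.lt_or_eq with h | h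
    · exact mem_radialTypeSet_of_lt hd hE hne hz h
    · exact mem_radialTypeSet_of_bddAbove hd hE hne hβ hb hz h.symm
  · ext z
    rw [Set.mem_sdiff, mem_segment_vertices hd hβ0]
    constructor
    · exact fun hz => ⟨hsub hz, fun h => hb (bddAbove_of_mem_edge hd hE hne hz h.2.2)⟩
    · rintro ⟨hz, hz'⟩
      obtain ⟨h1, h2, h3⟩ := (mem_triangle hd hβ0).1 hz
      exact mem_radialTypeSet_of_lt hd hE hne hz
        (h3.lt_of_ne fun h => hz' ⟨h1, h2, h.symm⟩)
  · rw [hβ] at hsub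
    ext z
    constructor
    · refine fun hz => ⟨hsub hz, ?_⟩
      obtain ⟨h1, h2, h3⟩ := (mem_triangle hd zero_le_one).1 (hsub hz)
      -- For β = 1 the third side of the triangle is x ≤ (d-1)/d, so failure of the strict
      -- inequality means equality.
      refine or_iff_not_imp_left.2 fun h => bddAbove_log_of_mem hd hE hne hz ?_
      refine le_antisymm ?_ (not_lt.1 h)
      rw [le_div_iff₀ (by linarith)]
      linarith
    · rintro ⟨hz, h | h⟩
      · refine mem_radialTypeSet_of_lt hd hE hne (by rwa [hβ]) ?_
        rw [lt_div_iff₀ (by linarith)] at h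
        rw [hβ]
        linarith
      · exact mem_radialTypeSet_of_bddAbove_log hd hE hne hβ hz h
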